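/- All vector spaces are over $\mathbb{C}$; modules over Lie superalgebras, their submodules and their isomorphisms are $\mathbb{Z}_2$-graded (isomorphisms preserve parity). Let $\dot{\mathfrak g}$ be a finite-dimensional Lie superalgebra (possibly a Lie algebra), let $d$ be an even derivation of $\dot{\mathfrak g}$ that does not have $1$ as an eigenvalue, and let $\sigma$ be an automorphism of $\dot{\mathfrak g}$ of finite order $n$ that commutes with $d$. Put $\omega_n=e^{2\pi\sqrt{-1}/n}$, $\dot{\mathfrak g}_{[k]}=\{x\in\dot{\mathfrak g}: \sigma(x)=\omega_n^{k}x\}$, $A=\mathbb{C}[t,t^{-1}]$, $W=\mathrm{Der}(A)=\bigoplus_{i\in\mathbb{Z}}\mathbb{C}\ell_i$ with $\ell_i=t^{i+1}\frac{d}{dt}$, and $\mathfrak g=\bigoplus_{k\in\mathbb{Z}}\dot{\mathfrak g}_{[k]}\otimes t^{k/n}$. Let $\mathfrak L=W\ltimes\mathfrak g$ and $\tilde{\mathfrak L}=\mathfrak L\ltimes A$ be the Lie superalgebras with brackets $$[\ell_i,\ell_j]=(j-i)\ell_{i+j},\quad [\ell_i,x t^a]=(ax+i\,d(x))t^{i+a},\quad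 [xt^a,yt^b]=[x,y]t^{a+b},$$ $$[\ell_i,t^j]=j\,t^{i+j},\quad [\mathfrak g,A]=[A,A]=0 .$$ An $A\mathfrak L$-module is an $\tilde{\mathfrak L}$-module $M$ on which $t^i(t^jv)=t^{i+j}v$ and $t^0v=v$ for all $i,j\in\mathbb{Z}$, $v\in M$. It is cuspidal if $\ell_0$ acts diagonalizably and the dimensions of the $\ell_0$-eigenspaces are finite and uniformly bounded. Let $\ddot{\mathfrak g}=\mathbb{C}\partial\ltimes\dot{\mathfrak g}$ with $\partial$ even and $[\partial,x]=d(x)$. For a $\ddot{\mathfrak g}$-module $V$ and $\lambda\in\mathbb{C}$ let $\Gamma(V,\lambda)=V\otimes\mathbb{C}[t^{1/n},t^{-1/n}]$ be the $A\mathfrak L$-module with $$t^i(v\otimes t^b)=v\otimes t^{b+i},\quad \ell_i(v\otimes t^b)=(\lambda+b+i\partial)v\otimes t^{b+i},\quad xt^a(v\otimes t^b)=xv\otimes t^{a+b}.$$ If $V=\bigoplus_{[j]\in\mathbb{Z}_n}V_{[j]}$ is a $\mathbb{Z}_n$-graded $\ddot{\mathfrak g}$-module, that is, the $V_{[j]}$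 are supersubspaces with $\partial V_{[j]}\subseteq V_{[j]}$ and $\dot{\mathfrak g}_{[k]}V_{[j]}\subseteq V_{[k+j]}$, let $F(V,\lambda)=\bigoplus_{j\in\mathbb{Z}}V_{[j]}\otimes t^{j/n}\subseteq\Gamma(V,\lambda)$, an $A\mathfrak L$-submodule. A $\mathbb{Z}_n$-graded module is $\mathbb{Z}_n$-graded-simple if it is nonzero and its only $\mathbb{Z}_n$-graded submodules are $0$ and itself. Theorem. Let $M$ be any simple cuspidal $A\mathfrak L$-module. Then (1) $M\cong F(V,\lambda)$ for some $\lambda\in\mathbb{C}$ and some finite-dimensional $\mathbb{Z}_n$-graded-simple $\ddot{\mathfrak g}$-module $V$; (2) $M$ is isomorphic to a simple $\tilde{\mathfrak L}$-subquotient of a loop module $\Gamma(V',\lambda)$ for some $\lambda\in\mathbb{C}$ and some finite-dimensional simple $\ddot{\mathfrak g}$-module $V'$. -/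

import Mathlib

noncomputable section

/-! ### Superspaces, Lie superalgebras and their modules (over `ℂ`) -/

/-- A superspace: a complex vector space with a decomposition `V = V₀ ⊕ V₁`. -/
structure Superspace (V : Type*) [AddCommGroup V] [Module ℂ V] where
  gr : ZMod 2 → Submodule ℂ V
  isCompl : IsCompl (gr 0) (gr 1)

/-- The Koszul sign `(-1)^{ij}`. -/
def koszul (i j : ZMod 2) : ℂ := (-1) ^ (i.val * j.val)

@[simp] theorem koszul_zero_left (j : ZMod 2) : koszul 0 j = 1 := by simp [koszul]

@[simp] theorem koszul_zero_right (j : ZMod 2) : koszul j 0 = 1 := by simp [koszul]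

@[simp] theorem koszul_one_one : koszul 1 1 = -1 := by simp [koszul, ZMod.val_one]

theorem parity_cases (i : ZMod 2) : i = 0 ∨ i = 1 := by
  revert i
  decide

/-- The homogeneous components of a purely even superspace. -/
def evenPart (V : Type*) [AddCommGroup V] [Module ℂ V] (i : ZMod 2) : Submodule ℂ V :=
  if i = 0 then ⊤ else ⊥

@[simp] theorem evenPart_zero (V : Type*) [AddCommGroup V] [Module ℂ V] :
    evenPart V 0 = ⊤ := rfl

@[simp] theorem evenPart_one (V : Type*) [AddCommGroup V] [Module ℂ V] :
    evenPart V 1 = ⊥ := rfl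

namespace Superspace

variable {V : Type*} [AddCommGroup V] [Module ℂ V]

/-- `P` is a supersubspace: `P = (P ∩ V₀) ⊕ (P ∩ V₁)`. -/
def IsGraded (S : Superspace V) (P : Submodule ℂ V) : Prop :=
  P ≤ (P ⊓ S.gr 0) ⊔ (P ⊓ S.gr 1)

theorem exists_add (S : Superspace V) (x : V) :
    ∃ a ∈ S.gr 0, ∃ b ∈ S.gr 1, a + b = x :=
  Submodule.mem_sup.1 (S.isCompl.sup_eq_top ▸ Submodule.mem_top)

theorem IsGraded.exists_add {S : Superspace V} {P : Submodule ℂ V} (h : S.IsGraded P)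
    {x : V} (hx : x ∈ P) :
    ∃ a ∈ S.gr 0, ∃ b ∈ S.gr 1, a ∈ P ∧ b ∈ P ∧ a + b = x := by
  obtain ⟨a, ha, b, hb, hab⟩ := Submodule.mem_sup.1 (h hx)
  exact ⟨a, ha.2, b, hb.2, ha.1, hb.1, hab⟩

theorem eq_zero (S : Superspace V) {x : V} (h0 : x ∈ S.gr 0) (h1 : x ∈ S.gr 1) : x = 0 :=
  Submodule.disjoint_def.1 S.isCompl.disjoint x h0 h1

theorem even_smul_mem (S : Superspace V) {i j : ZMod 2} {a : ℂ} {v : V} (ha : a ∈ evenPart ℂ i)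
    (hv : v ∈ S.gr j) : a • v ∈ S.gr (i + j) := by
  rcases parity_cases i with rfl | rfl
  · rw [zero_add]
    exact Submodule.smul_mem _ _ hv
  · rw [show a = 0 from ha, zero_smul]
    exact zero_mem _

theorem isCompl_of {P Q : Submodule ℂ V} (h0 : ∀ x, x ∈ P → x ∈ Q → x = 0)
    (h1 : ∀ x, ∃ a ∈ P, ∃ b ∈ Q, a + b = x) : IsCompl P Q :=
  ⟨Submodule.disjoint_def.2 h0,
    codisjoint_iff.2 (eq_top_iff.2 fun x _ => Submodule.mem_sup.2 (h1 x))⟩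

/-- A supersubspace as a superspace. -/
def sub (S : Superspace V) (P : Submodule ℂ V) (h : S.IsGraded P) : Superspace P where
  gr i := (S.gr i).comap P.subtype
  isCompl := by
    refine isCompl_of (fun x h0 h1 => Subtype.ext (S.eq_zero h0 h1)) fun x => ?_
    obtain ⟨a, ha, b, hb, haP, hbP, hab⟩ := h.exists_add x.2
    exact ⟨⟨a, haP⟩, ha, ⟨b, hbP⟩, hb, Subtype.ext hab⟩

/-- The quotient of a superspace by a supersubspace. -/
def quot (S : Superspace V) (P : Submodule ℂ V) (h : S.IsGraded P) : Superspace (V ⧸ P) where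
  gr i := (S.gr i).map P.mkQ
  isCompl := by
    refine isCompl_of ?_ ?_
    · rintro _ ⟨a, ha, rfl⟩ ⟨b, hb, hab⟩
      have h1 : a - b ∈ P := by
        rw [← Submodule.Quotient.eq]
        exact hab.symm
      obtain ⟨c, hc, e, he, hcP, _, hce⟩ := h.exists_add h1
      have h2 : a - c = b + e := by
        rw [sub_eq_iff_eq_add, add_assoc, add_comm e c, hce]
        abel
      have h3 : a - c = 0 :=
        S.eq_zero (sub_mem ha hc) (h2 ▸ add_mem hb he)
      rw [sub_eq_zero.1 h3]
      exact (Submodule.Quotient.mk_eq_zero P).2 hcP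
    · intro x
      obtain ⟨v, rfl⟩ := P.mkQ_surjective x
      obtain ⟨a, ha, b, hb, rfl⟩ := S.exists_add v
      exact ⟨_, ⟨a, ha, rfl⟩, _, ⟨b, hb, rfl⟩, (map_add _ _ _).symm⟩

end Superspace

/-- A complex Lie superalgebra structure on the vector space `L`. -/
structure LieSuperalgebra (L : Type*) [AddCommGroup L] [Module ℂ L] extends Superspace L where
  br : L →ₗ[ℂ] L →ₗ[ℂ] L
  br_mem : ∀ {i j : ZMod 2} {x y : L}, x ∈ gr i → y ∈ gr j → br x y ∈ gr (i + j)
  skew : ∀ {i j : ZMod 2} {x y : L}, x ∈ gr i → y ∈ gr j →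
    br x y = -(koszul i j • br y x)
  jacobi : ∀ {i j : ZMod 2} {x y : L}, x ∈ gr i → y ∈ gr j → ∀ z : L,
    br x (br y z) = br (br x y) z + koszul i j • br y (br x z)

/-- A (graded) subalgebra of a Lie superalgebra, as a Lie superalgebra. -/
def LieSuperalgebra.subalgebra {L : Type*} [AddCommGroup L] [Module ℂ L] (S : LieSuperalgebra L)
    (P : Submodule ℂ L) (h : S.IsGraded P) (hb : ∀ x ∈ P, ∀ y ∈ P, S.br x y ∈ P) :
    LieSuperalgebra P where
  toSuperspace := S.toSuperspace.sub P h
  br := LinearMap.mk₂ ℂ (fun x y => ⟨S.br x y, hb x x.2 y y.2⟩)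
    (fun _ _ _ => Subtype.ext (by simp)) (fun _ _ _ => Subtype.ext (by simp))
    (fun _ _ _ => Subtype.ext (by simp)) (fun _ _ _ => Subtype.ext (by simp))
  br_mem hx hy := S.br_mem hx hy
  skew hx hy := Subtype.ext (S.skew hx hy)
  jacobi hx hy z := Subtype.ext (S.jacobi hx hy z)

/-- A (`ℤ₂`-graded) module structure on `M` over a Lie superalgebra. -/
structure SuperModule {L : Type*} [AddCommGroup L] [Module ℂ L] (S : LieSuperalgebra L)
    (M : Type*) [AddCommGroup M] [Module ℂ M] extends Superspace M where
  act : L →ₗ[ℂ] M →ₗ[ℂ] M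
  act_mem : ∀ {i j : ZMod 2} {x : L} {m : M}, x ∈ S.gr i → m ∈ gr j → act x m ∈ gr (i + j)
  act_br : ∀ {i j : ZMod 2} {x y : L}, x ∈ S.gr i → y ∈ S.gr j → ∀ m : M,
    act (S.br x y) m = act x (act y m) - koszul i j • act y (act x m)

namespace SuperModule

variable {L : Type*} [AddCommGroup L] [Module ℂ L] {S : LieSuperalgebra L}
variable {M : Type*} [AddCommGroup M] [Module ℂ M]
variable {N : Type*} [AddCommGroup N] [Module ℂ N]

/-- `P` is a (`ℤ₂`-graded) submodule. -/
structure IsSubmodule (X : SuperModule S M) (P : Submodule ℂ M) : Prop where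
  graded : X.IsGraded P
  act_mem : ∀ x : L, ∀ m ∈ P, X.act x m ∈ P

/-- Simple: nonzero, with no (`ℤ₂`-graded) submodules other than `0` and the whole module. -/
def IsSimple (X : SuperModule S M) : Prop :=
  Nontrivial M ∧ ∀ P : Submodule ℂ M, X.IsSubmodule P → P = ⊥ ∨ P = ⊤

/-- A submodule as a module. -/
def sub (X : SuperModule S M) (P : Submodule ℂ M) (h : X.IsSubmodule P) : SuperModule S P where
  toSuperspace := X.toSuperspace.sub P h.graded
  act := LinearMap.mk₂ ℂ (fun x m => ⟨X.act x m, h.act_mem x m m.2⟩)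
    (fun _ _ _ => Subtype.ext (by simp)) (fun _ _ _ => Subtype.ext (by simp))
    (fun _ _ _ => Subtype.ext (by simp)) (fun _ _ _ => Subtype.ext (by simp))
  act_mem hx hm := X.act_mem hx hm
  act_br hx hy m := Subtype.ext (X.act_br hx hy m)

/-- The quotient of a module by a submodule. -/
def quot (X : SuperModule S M) (P : Submodule ℂ M) (h : X.IsSubmodule P) :
    SuperModule S (M ⧸ P) where
  toSuperspace := X.toSuperspace.quot P h.graded
  act :=
    { toFun := fun x => P.mapQ P (X.act x) (fun m hm => h.act_mem x m hm)
      map_add' := fun x y => by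
        apply Submodule.linearMap_qext
        ext m
        simp
      map_smul' := fun c x => by
        apply Submodule.linearMap_qext
        ext m
        simp }
  act_mem := by
    rintro i j x _ hx ⟨m, hm, rfl⟩
    exact ⟨X.act x m, X.act_mem hx hm, rfl⟩
  act_br := by
    intro i j x y hx hy m
    obtain ⟨m, rfl⟩ := P.mkQ_surjective m
    simp [X.act_br hx hy m]

/-- If `P ≤ Q` are submodules, then `P` is a submodule of `Q`. -/
theorem IsSubmodule.inside {X : SuperModule S M} {P Q : Submodule ℂ M} (hP : X.IsSubmodule P)
    (hQ : X.IsSubmodule Q) (hPQ : P ≤ Q) :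
    (X.sub Q hQ).IsSubmodule (P.comap Q.subtype) where
  graded := by
    intro x hx
    obtain ⟨a, ha, b, hb, haP, hbP, hab⟩ := hP.graded.exists_add (x := (x : M)) hx
    exact Submodule.mem_sup.2 ⟨⟨a, hPQ haP⟩, ⟨haP, ha⟩, ⟨b, hPQ hbP⟩, ⟨hbP, hb⟩, Subtype.ext hab⟩
  act_mem x m hm := hP.act_mem x m hm

/-- The sub-quotient `Q / P` for submodules `P ≤ Q`. -/
def subquot (X : SuperModule S M) {P Q : Submodule ℂ M} (hP : X.IsSubmodule P)
    (hQ : X.IsSubmodule Q) (hPQ : P ≤ Q) :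
    SuperModule S (Q ⧸ P.comap Q.subtype) :=
  (X.sub Q hQ).quot (P.comap Q.subtype) (hP.inside hQ hPQ)

/-- Isomorphism of modules: a parity-preserving linear bijection commuting with the action. -/
def IsIso (X : SuperModule S M) (Y : SuperModule S N) : Prop :=
  ∃ e : M ≃ₗ[ℂ] N, (∀ i, ∀ m ∈ X.gr i, e m ∈ Y.gr i) ∧ ∀ x m, e (X.act x m) = Y.act x (e m)

end SuperModule

/-! ### Laurent polynomials with coefficients in a vector space

`ℤ →₀ X` stands for `X ⊗ ℂ[s, s⁻¹]`: `Finsupp.single k x` is `x ⊗ s ^ k`. -/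

section Laurent

variable {X Y Z : Type*} [AddCommGroup X] [Module ℂ X] [AddCommGroup Y] [Module ℂ Y]
  [AddCommGroup Z] [Module ℂ Z]

/-- The bilinear map with `(x s^i, y s^j) ↦ B i j x y s^{r i j}`. -/
def laurentBilin (r : ℤ → ℤ → ℤ) (B : ℤ → ℤ → X →ₗ[ℂ] Y →ₗ[ℂ] Z) :
    (ℤ →₀ X) →ₗ[ℂ] (ℤ →₀ Y) →ₗ[ℂ] (ℤ →₀ Z) :=
  Finsupp.lsum ℂ fun i => LinearMap.flip <| Finsupp.lsum ℂ fun j =>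
    LinearMap.flip <| (B i j).compr₂ (Finsupp.lsingle (r i j))

@[simp] theorem laurentBilin_single (r : ℤ → ℤ → ℤ) (B : ℤ → ℤ → X →ₗ[ℂ] Y →ₗ[ℂ] Z)
    (i j : ℤ) (x : X) (y : Y) :
    laurentBilin r B (Finsupp.single i x) (Finsupp.single j y) =
      Finsupp.single (r i j) (B i j x y) := by
  simp [laurentBilin]

/-- The elements `∑ x_k s^k` with `x_k ∈ P k` for all `k`. -/
def coeffIn (P : ℤ → Submodule ℂ X) : Submodule ℂ (ℤ →₀ X) where
  carrier := {f | ∀ k, f k ∈ P k}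
  add_mem' hf hg k := add_mem (hf k) (hg k)
  zero_mem' k := zero_mem _
  smul_mem' c _ hf k := (P k).smul_mem c (hf k)

theorem coeffIn_induction {P : ℤ → Submodule ℂ X} {p : (ℤ →₀ X) → Prop} (h0 : p 0)
    (ha : ∀ f g, p f → p g → p (f + g)) (hs : ∀ k : ℤ, ∀ x ∈ P k, p (Finsupp.single k x))
    {f : ℤ →₀ X} (hf : f ∈ coeffIn P) : p f := by
  rw [← Finsupp.sum_single f]
  exact Finset.sum_induction _ p ha h0 fun k _ => hs k _ (hf k)

theorem single_mem_coeffIn {P : ℤ → Submodule ℂ X} {k : ℤ} {x : X} (hx : x ∈ P k) :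
    Finsupp.single k x ∈ coeffIn P := by
  intro l
  rw [Finsupp.single_apply]
  split_ifs with h
  · exact h ▸ hx
  · exact zero_mem _

theorem laurentBilin_mem {r : ℤ → ℤ → ℤ} {B : ℤ → ℤ → X →ₗ[ℂ] Y →ₗ[ℂ] Z}
    {P : ℤ → Submodule ℂ X} {Q : ℤ → Submodule ℂ Y} {R : ℤ → Submodule ℂ Z}
    (h : ∀ i j, ∀ x ∈ P i, ∀ y ∈ Q j, B i j x y ∈ R (r i j)) {f : ℤ →₀ X} {g : ℤ →₀ Y}
    (hf : f ∈ coeffIn P) (hg : g ∈ coeffIn Q) : laurentBilin r B f g ∈ coeffIn R := by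
  refine coeffIn_induction (P := P) (p := fun f => laurentBilin r B f g ∈ coeffIn R)
    ?_ ?_ ?_ hf
  · simp
  · intro f f' h1 h2
    simpa using add_mem h1 h2
  · intro i x hx
    refine coeffIn_induction (P := Q)
      (p := fun g => laurentBilin r B (Finsupp.single i x) g ∈ coeffIn R) ?_ ?_ ?_ hg
    · simp
    · intro f f' h1 h2
      simpa using add_mem h1 h2
    · intro j y hy
      rw [laurentBilin_single]
      exact single_mem_coeffIn (h i j x hx y hy)

theorem mem_coeffIn_top (f : ℤ →₀ X) : f ∈ coeffIn (fun _ => (⊤ : Submodule ℂ X)) :=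
  fun _ => Submodule.mem_top

/-- `X ⊗ ℂ[s, s⁻¹]` is a superspace when `X` is one, with `s` even; more generally for
families of supersubspaces. -/
theorem coeffIn_exists_add (S : Superspace X) {P : ℤ → Submodule ℂ X}
    (hP : ∀ k, S.IsGraded (P k)) {f : ℤ →₀ X} (hf : f ∈ coeffIn P) :
    ∃ a ∈ coeffIn (fun _ => S.gr 0), ∃ b ∈ coeffIn (fun _ => S.gr 1),
      a ∈ coeffIn P ∧ b ∈ coeffIn P ∧ a + b = f := by
  refine coeffIn_induction (P := P) (p := fun f => ∃ a ∈ coeffIn (fun _ => S.gr 0),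
    ∃ b ∈ coeffIn (fun _ => S.gr 1), a ∈ coeffIn P ∧ b ∈ coeffIn P ∧ a + b = f) ?_ ?_ ?_ hf
  · exact ⟨0, zero_mem _, 0, zero_mem _, zero_mem _, zero_mem _, add_zero _⟩
  · rintro f g ⟨a, h1, b, h2, h3, h4, rfl⟩ ⟨a', h1', b', h2', h3', h4', rfl⟩
    exact ⟨a + a', add_mem h1 h1', b + b', add_mem h2 h2', add_mem h3 h3', add_mem h4 h4',
      by abel⟩
  · intro k x hx
    obtain ⟨a, ha, b, hb, haP, hbP, rfl⟩ := (hP k).exists_add hx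
    exact ⟨_, single_mem_coeffIn ha, _, single_mem_coeffIn hb, single_mem_coeffIn haP,
      single_mem_coeffIn hbP, (Finsupp.single_add _ _ _).symm⟩

/-- The superspace `X ⊗ ℂ[s, s⁻¹]`, with `s` even. -/
def Superspace.laurent (S : Superspace X) : Superspace (ℤ →₀ X) where
  gr i := coeffIn fun _ => S.gr i
  isCompl := by
    refine Superspace.isCompl_of (fun f h0 h1 => Finsupp.ext fun k => S.eq_zero (h0 k) (h1 k))
      fun f => ?_
    obtain ⟨a, ha, b, hb, -, -, hab⟩ := coeffIn_exists_add S (P := fun _ => ⊤)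
      (fun _ x _ => by simp [S.isCompl.sup_eq_top]) (mem_coeffIn_top f)
    exact ⟨a, ha, b, hb, hab⟩

end Laurent

/-! ### The data `(d, σ)` and the Lie superalgebras built from it -/

/-- An even derivation `d` of a Lie superalgebra and an (even) automorphism `σ` of order `n`,
`1 ≤ n < ∞`, commuting with `d`. -/
structure TwistDatum {g : Type*} [AddCommGroup g] [Module ℂ g] (G : LieSuperalgebra g) where
  d : g →ₗ[ℂ] g
  d_mem : ∀ {i : ZMod 2} {x : g}, x ∈ G.gr i → d x ∈ G.gr i
  d_br : ∀ x y : g, d (G.br x y) = G.br (d x) y + G.br x (d y)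
  σ : g ≃ₗ[ℂ] g
  σ_mem : ∀ {i : ZMod 2} {x : g}, x ∈ G.gr i → σ x ∈ G.gr i
  σ_br : ∀ x y : g, σ (G.br x y) = G.br (σ x) (σ y)
  σ_d : ∀ x : g, σ (d x) = d (σ x)
  n : ℕ
  n_pos : 0 < n
  order_σ : orderOf σ = n

/-- The vector space underlying `(W ⋉ (g ⊗ ℂ[t^{1/n}, t^{-1/n}])) ⋉ A`, where
`A = ℂ[t, t⁻¹]` and `W = Der A = ⨁ ℂ ℓ_i`, `ℓ_i = t^{i+1} d/dt`:
`(single i 1, 0, 0)` is `ℓ_i`, `(0, single k x, 0)` is `x ⊗ t^{k/n}`, and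
`(0, 0, single j 1)` is `t^j`. -/
abbrev FullTilde (g : Type*) [AddCommGroup g] : Type _ :=
  (ℤ →₀ ℂ) × (ℤ →₀ g) × (ℤ →₀ ℂ)

/-- `[ℓ_i, ℓ_j] = (j - i) ℓ_{i+j}`. -/
def brWW : (ℤ →₀ ℂ) →ₗ[ℂ] (ℤ →₀ ℂ) →ₗ[ℂ] (ℤ →₀ ℂ) :=
  laurentBilin (fun i j => i + j) fun i j => ((j : ℂ) - i) • LinearMap.mul ℂ ℂ

/-- `[ℓ_i, t^j] = j t^{i+j}`. -/
def brWA : (ℤ →₀ ℂ) →ₗ[ℂ] (ℤ →₀ ℂ) →ₗ[ℂ] (ℤ →₀ ℂ) :=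
  laurentBilin (fun i j => i + j) fun _ j => (j : ℂ) • LinearMap.mul ℂ ℂ

namespace TwistDatum

variable {g : Type*} [AddCommGroup g] [Module ℂ g] {G : LieSuperalgebra g} (D : TwistDatum G)

/-- `ω_n = exp(2π√-1/n)`. -/
def omega : ℂ := Complex.exp (2 * Real.pi * Complex.I / D.n)

/-- `g_{[k]} = {x : σ x = ω_n^k x}`. -/
def comp (k : ℤ) : Submodule ℂ g where
  carrier := {x | D.σ x = D.omega ^ k • x}
  add_mem' hx hy := by
    simp only [Set.mem_ofPred_eq] at *
    rw [map_add, hx, hy, smul_add]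
  zero_mem' := by simp
  smul_mem' c x hx := by
    simp only [Set.mem_ofPred_eq] at *
    rw [map_smul, hx, smul_comm]

theorem omega_ne_zero : D.omega ≠ 0 := Complex.exp_ne_zero _

theorem omega_pow : D.omega ^ (D.n : ℤ) = 1 := by
  have hn : (D.n : ℂ) ≠ 0 := Nat.cast_ne_zero.2 D.n_pos.ne'
  rw [zpow_natCast, omega, ← Complex.exp_nat_mul, mul_div_cancel₀ _ hn, Complex.exp_two_pi_mul_I]

theorem comp_add_mul (i k : ℤ) : D.comp (D.n * i + k) = D.comp k := by
  ext x
  change D.σ x = _ ↔ D.σ x = _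
  rw [zpow_add₀ D.omega_ne_zero, zpow_mul, D.omega_pow, one_zpow, one_mul]

theorem d_mem_comp {k : ℤ} {x : g} (hx : x ∈ D.comp k) : D.d x ∈ D.comp k := by
  change D.σ (D.d x) = _
  rw [D.σ_d, show D.σ x = _ from hx, map_smul]

theorem br_mem_comp {k l : ℤ} {x y : g} (hx : x ∈ D.comp k) (hy : y ∈ D.comp l) :
    G.br x y ∈ D.comp (k + l) := by
  change D.σ (G.br x y) = _
  rw [D.σ_br, show D.σ x = _ from hx, show D.σ y = _ from hy, zpow_add₀ D.omega_ne_zero]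
  simp [smul_smul, mul_comm]

theorem comp_isGraded (k : ℤ) : G.IsGraded (D.comp k) := by
  intro x hx
  obtain ⟨a, ha, b, hb, rfl⟩ := G.exists_add x
  have h : D.σ a + D.σ b = D.omega ^ k • a + D.omega ^ k • b := by
    rw [← map_add, ← smul_add]
    exact hx
  have h1 : D.σ a - D.omega ^ k • a = D.omega ^ k • b - D.σ b := by
    rw [sub_eq_sub_iff_add_eq_add, h, add_comm]
  have h2 : D.σ a - D.omega ^ k • a = 0 :=
    G.eq_zero (sub_mem (D.σ_mem ha) (Submodule.smul_mem _ _ ha))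
      (h1 ▸ sub_mem (Submodule.smul_mem _ _ hb) (D.σ_mem hb))
  refine Submodule.mem_sup.2 ⟨a, ⟨sub_eq_zero.1 h2, ha⟩, b, ⟨?_, hb⟩, rfl⟩
  rw [h2] at h1
  exact (sub_eq_zero.1 h1.symm).symm

/-- The Lie superalgebra `ℂ∂ ⋉ g`, with `[∂, x] = d x` and `∂` even; `(a, x)` is `a∂ + x`. -/
def ddg : LieSuperalgebra (ℂ × g) where
  gr i := (evenPart ℂ i).prod (G.gr i)
  isCompl := by
    refine Superspace.isCompl_of ?_ ?_
    · rintro ⟨a, x⟩ ⟨_, h0⟩ ⟨h1, h2⟩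
      exact Prod.ext h1 (G.eq_zero h0 h2)
    · rintro ⟨a, x⟩
      obtain ⟨y, hy, z, hz, rfl⟩ := G.exists_add x
      exact ⟨(a, y), ⟨trivial, hy⟩, (0, z), ⟨zero_mem _, hz⟩, by simp⟩
  br := LinearMap.mk₂ ℂ
    (fun u v => (0, u.1 • D.d v.2 - v.1 • D.d u.2 + G.br u.2 v.2))
    (fun u u' v => Prod.ext (by simp) (by simp; module))
    (fun c u v => Prod.ext (by simp) (by simp; module))
    (fun u v v' => Prod.ext (by simp) (by simp; module))
    (fun c u v => Prod.ext (by simp) (by simp; module))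
  br_mem := by
    rintro i j ⟨a, x⟩ ⟨b, y⟩ ⟨ha, hx⟩ ⟨hb, hy⟩
    have h1 : b • D.d x ∈ G.gr (i + j) := add_comm j i ▸ G.even_smul_mem hb (D.d_mem hx)
    exact ⟨zero_mem _, add_mem (sub_mem (G.even_smul_mem ha (D.d_mem hy)) h1) (G.br_mem hx hy)⟩
  skew := by
    rintro i j ⟨a, x⟩ ⟨b, y⟩ ⟨ha, hx⟩ ⟨hb, hy⟩
    refine Prod.ext (by simp) ?_
    have h3 := G.skew hx hy
    rcases parity_cases i with rfl | rfl <;> rcases parity_cases j with rfl | rfl <;>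
      simp_all <;> abel
  jacobi := by
    rintro i j ⟨a, x⟩ ⟨b, y⟩ ⟨ha, hx⟩ ⟨hb, hy⟩ ⟨c, z⟩
    refine Prod.ext (by simp) ?_
    have h1 := G.skew hx (D.d_mem hy)
    have h2 := G.skew (D.d_mem hx) hy
    have h3 := G.jacobi hx hy z
    rcases parity_cases i with rfl | rfl <;> rcases parity_cases j with rfl | rfl <;>
      simp_all [D.d_br] <;> module

/-- `[ℓ_i, x t^a] = (a x + i d(x)) t^{i+a}` for `a = k/n`. -/
def brWL : (ℤ →₀ ℂ) →ₗ[ℂ] (ℤ →₀ g) →ₗ[ℂ] (ℤ →₀ g) :=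
  laurentBilin (fun i k => D.n * i + k) fun i k =>
    LinearMap.mk₂ ℂ (fun c x => c • (((k : ℂ) / D.n) • x + (i : ℂ) • D.d x))
      (fun _ _ _ => by module) (fun _ _ _ => by module)
      (fun _ _ _ => by rw [map_add]; module) (fun _ _ _ => by rw [map_smul]; module)

end TwistDatum

/-- `[x t^a, y t^b] = [x, y] t^{a+b}`. -/
def brLL {g : Type*} [AddCommGroup g] [Module ℂ g] (G : LieSuperalgebra g) :
    (ℤ →₀ g) →ₗ[ℂ] (ℤ →₀ g) →ₗ[ℂ] (ℤ →₀ g) :=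
  laurentBilin (fun k l => k + l) fun _ _ => G.br

section Identities

theorem brWW_skew (w w' : ℤ →₀ ℂ) : brWW w w' = -brWW w' w := by
  induction w using Finsupp.induction_linear with
  | zero => simp
  | add f g hf hg => simp only [map_add, LinearMap.add_apply, hf, hg, neg_add]
  | single i a =>
    induction w' using Finsupp.induction_linear with
    | zero => simp
    | add f g hf hg => simp only [map_add, LinearMap.add_apply, hf, hg, neg_add]
    | single j b =>
      simp only [brWW, laurentBilin_single, ← Finsupp.single_neg, add_comm j i]
      congr 1
      simp
      ring

theorem brWW_brWW (w w' w'' : ℤ →₀ ℂ) :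
    brWW w (brWW w' w'') = brWW (brWW w w') w'' + brWW w' (brWW w w'') := by
  induction w using Finsupp.induction_linear with
  | zero => simp
  | add f g hf hg => simp only [map_add, LinearMap.add_apply, hf, hg]; abel
  | single i a =>
    induction w' using Finsupp.induction_linear with
    | zero => simp
    | add f g hf hg => simp only [map_add, LinearMap.add_apply, hf, hg]; abel
    | single j b =>
      induction w'' using Finsupp.induction_linear with
      | zero => simp
      | add f g hf hg => simp only [map_add, hf, hg]; abel
      | single k c =>
        simp only [brWW, laurentBilin_single, add_assoc, add_left_comm j i k,
          ← Finsupp.single_add]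
        congr 1
        simp
        ring

theorem brWA_brWW (w w' p : ℤ →₀ ℂ) :
    brWA w (brWA w' p) = brWA (brWW w w') p + brWA w' (brWA w p) := by
  induction w using Finsupp.induction_linear with
  | zero => simp
  | add f g hf hg => simp only [map_add, LinearMap.add_apply, hf, hg]; abel
  | single i a =>
    induction w' using Finsupp.induction_linear with
    | zero => simp
    | add f g hf hg => simp only [map_add, LinearMap.add_apply, hf, hg]; abel
    | single j b =>
      induction p using Finsupp.induction_linear with
      | zero => simp
      | add f g hf hg => simp only [map_add, hf, hg]; abel
      | single k c =>
        simp only [brWW, brWA, laurentBilin_single, add_assoc, add_left_comm j i k,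
          ← Finsupp.single_add]
        congr 1
        simp
        ring

variable {g : Type*} [AddCommGroup g] [Module ℂ g] {G : LieSuperalgebra g}

theorem brLL_skew {i j : ZMod 2} {f f' : ℤ →₀ g} (hf : f ∈ G.laurent.gr i)
    (hf' : f' ∈ G.laurent.gr j) : brLL G f f' = -(koszul i j • brLL G f' f) := by
  refine coeffIn_induction (p := fun f => brLL G f f' = -(koszul i j • brLL G f' f))
    ?_ ?_ ?_ hf
  · simp
  · intro f g hf hg
    simp only [map_add, LinearMap.add_apply, hf, hg]
    module
  · intro k x hx
    refine coeffIn_induction (p := fun f' => brLL G (Finsupp.single k x) f' =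
      -(koszul i j • brLL G f' (Finsupp.single k x))) ?_ ?_ ?_ hf'
    · simp
    · intro f g hf hg
      simp only [map_add, LinearMap.add_apply, hf, hg]
      module
    · intro l y hy
      simp only [brLL, laurentBilin_single, add_comm l k, Finsupp.smul_single,
        ← Finsupp.single_neg]
      rw [G.skew hx hy]

theorem brLL_jacobi {i j : ZMod 2} {f f' : ℤ →₀ g} (hf : f ∈ G.laurent.gr i)
    (hf' : f' ∈ G.laurent.gr j) (f'' : ℤ →₀ g) :
    brLL G f (brLL G f' f'') =
      brLL G (brLL G f f') f'' + koszul i j • brLL G f' (brLL G f f'') := by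
  refine coeffIn_induction (p := fun f => brLL G f (brLL G f' f'') =
      brLL G (brLL G f f') f'' + koszul i j • brLL G f' (brLL G f f'')) ?_ ?_ ?_ hf
  · simp
  · intro f g hf hg
    simp only [map_add, LinearMap.add_apply, hf, hg]
    module
  · intro k x hx
    refine coeffIn_induction (p := fun f' => brLL G (Finsupp.single k x) (brLL G f' f'') =
      brLL G (brLL G (Finsupp.single k x) f') f'' +
        koszul i j • brLL G f' (brLL G (Finsupp.single k x) f'')) ?_ ?_ ?_ hf'
    · simp
    · intro f g hf hg
      simp only [map_add, LinearMap.add_apply, hf, hg]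
      module
    · intro l y hy
      induction f'' using Finsupp.induction_linear with
      | zero => simp
      | add f g hf hg => simp only [map_add, hf, hg]; module
      | single m z =>
        simp only [brLL, laurentBilin_single, add_assoc, add_left_comm l k m,
          Finsupp.smul_single, ← Finsupp.single_add]
        rw [G.jacobi hx hy]

variable (D : TwistDatum G)

theorem TwistDatum.n_ne_zero : (D.n : ℂ) ≠ 0 := Nat.cast_ne_zero.2 D.n_pos.ne'

theorem brWL_brWW (w w' : ℤ →₀ ℂ) (f : ℤ →₀ g) :
    D.brWL w (D.brWL w' f) = D.brWL (brWW w w') f + D.brWL w' (D.brWL w f) := by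
  have hn := D.n_ne_zero
  induction w using Finsupp.induction_linear with
  | zero => simp
  | add f g hf hg => simp only [map_add, LinearMap.add_apply, hf, hg]; abel
  | single i a =>
    induction w' using Finsupp.induction_linear with
    | zero => simp
    | add f g hf hg => simp only [map_add, LinearMap.add_apply, hf, hg]; abel
    | single j b =>
      induction f using Finsupp.induction_linear with
      | zero => simp
      | add f g hf hg => simp only [map_add, hf, hg]; abel
      | single k x =>
        simp only [brWW, TwistDatum.brWL, laurentBilin_single, mul_add, add_assoc,
          add_left_comm (D.n * j : ℤ) (D.n * i) k, ← Finsupp.single_add]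
        congr 1
        simp only [LinearMap.mk₂_apply, LinearMap.smul_apply, LinearMap.mul_apply', map_add,
          map_smul, smul_eq_mul, Int.cast_add, Int.cast_mul, Int.cast_natCast, add_div,
          mul_div_cancel_left₀ _ hn]
        module

theorem brWL_brLL (w : ℤ →₀ ℂ) (f f' : ℤ →₀ g) :
    D.brWL w (brLL G f f') = brLL G (D.brWL w f) f' + brLL G f (D.brWL w f') := by
  induction w using Finsupp.induction_linear with
  | zero => simp
  | add f g hf hg => simp only [map_add, LinearMap.add_apply, hf, hg]; abel
  | single i a =>
    induction f using Finsupp.induction_linear with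
    | zero => simp
    | add f g hf hg => simp only [map_add, LinearMap.add_apply, hf, hg]; abel
    | single k x =>
      induction f' using Finsupp.induction_linear with
      | zero => simp
      | add f g hf hg => simp only [map_add, hf, hg]; abel
      | single l y =>
        simp only [brLL, TwistDatum.brWL, laurentBilin_single, add_assoc,
          add_left_comm k (D.n * i : ℤ) l, ← Finsupp.single_add]
        congr 1
        simp only [LinearMap.mk₂_apply, map_add, map_smul, LinearMap.add_apply,
          LinearMap.smul_apply, D.d_br, Int.cast_add, add_div]
        module

theorem brWL_mem {i j : ZMod 2} {w : ℤ →₀ ℂ} {f : ℤ →₀ g} (hw : w ∈ evenPart (ℤ →₀ ℂ) i)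
    (hf : f ∈ G.laurent.gr j) : D.brWL w f ∈ G.laurent.gr (i + j) := by
  rcases parity_cases i with rfl | rfl
  · rw [zero_add]
    refine laurentBilin_mem (fun i j c _ x hx => ?_) (mem_coeffIn_top w) hf
    exact Submodule.smul_mem _ _ (add_mem (Submodule.smul_mem _ _ hx)
      (Submodule.smul_mem _ _ (D.d_mem hx)))
  · rw [show w = 0 from hw]
    simp

theorem brLL_mem {i j : ZMod 2} {f f' : ℤ →₀ g} (hf : f ∈ G.laurent.gr i)
    (hf' : f' ∈ G.laurent.gr j) : brLL G f f' ∈ G.laurent.gr (i + j) :=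
  laurentBilin_mem (fun _ _ _ hx _ hy => G.br_mem hx hy) hf hf'

theorem evenPart_bilin_mem {X Y Z : Type*} [AddCommGroup X] [Module ℂ X] [AddCommGroup Y]
    [Module ℂ Y] [AddCommGroup Z] [Module ℂ Z] (B : X →ₗ[ℂ] Y →ₗ[ℂ] Z) {i j : ZMod 2} {x : X}
    {y : Y} (hx : x ∈ evenPart X i) (hy : y ∈ evenPart Y j) :
    B x y ∈ evenPart Z (i + j) := by
  rcases parity_cases i with rfl | rfl
  · rcases parity_cases j with rfl | rfl
    · exact Submodule.mem_top
    · rw [show y = 0 from hy, map_zero]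
      exact zero_mem _
  · rw [show x = 0 from hx, map_zero]
    exact zero_mem _

end Identities

namespace TwistDatum

variable {g : Type*} [AddCommGroup g] [Module ℂ g] {G : LieSuperalgebra g} (D : TwistDatum G)

/-- The bracket of `(W ⋉ (g ⊗ ℂ[t^{1/n}, t^{-1/n}])) ⋉ A`. -/
def fullBr : FullTilde g →ₗ[ℂ] FullTilde g →ₗ[ℂ] FullTilde g :=
  LinearMap.mk₂ ℂ
    (fun u v => (brWW u.1 v.1, D.brWL u.1 v.2.1 - D.brWL v.1 u.2.1 + brLL G u.2.1 v.2.1,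
      brWA u.1 v.2.2 - brWA v.1 u.2.2))
    (fun u u' v => Prod.ext (by simp) (Prod.ext (by simp; abel) (by simp; abel)))
    (fun c u v => Prod.ext (by simp) (Prod.ext (by simp; module) (by simp; module)))
    (fun u v v' => Prod.ext (by simp) (Prod.ext (by simp; abel) (by simp; abel)))
    (fun c u v => Prod.ext (by simp) (Prod.ext (by simp; module) (by simp; module)))

theorem fullBr_apply (w w' p p' : ℤ →₀ ℂ) (f f' : ℤ →₀ g) :
    D.fullBr (w, f, p) (w', f', p') =
      (brWW w w', D.brWL w f' - D.brWL w' f + brLL G f f', brWA w p' - brWA w' p) := rfl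

/-- The Lie superalgebra `(W ⋉ (g ⊗ ℂ[t^{1/n}, t^{-1/n}])) ⋉ A`, with `W` and `A` even,
`[A, A] = 0` and `[g ⊗ ℂ[t^{1/n}, t^{-1/n}], A] = 0`. -/
def fullTilde : LieSuperalgebra (FullTilde g) where
  gr i := (evenPart (ℤ →₀ ℂ) i).prod ((G.laurent.gr i).prod (evenPart (ℤ →₀ ℂ) i))
  isCompl := by
    refine Superspace.isCompl_of ?_ ?_
    · rintro ⟨w, f, p⟩ ⟨_, h0, _⟩ ⟨h1, h2, h3⟩
      exact Prod.ext h1 (Prod.ext (G.laurent.eq_zero h0 h2) h3)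
    · rintro ⟨w, f, p⟩
      obtain ⟨y, hy, z, hz, rfl⟩ := G.laurent.exists_add f
      exact ⟨(w, y, p), ⟨trivial, hy, trivial⟩, (0, z, 0), ⟨zero_mem _, hz, zero_mem _⟩, by simp⟩
  br := D.fullBr
  br_mem := by
    rintro i j ⟨w, f, p⟩ ⟨w', f', p'⟩ ⟨hw, hf, hp⟩ ⟨hw', hf', hp'⟩
    have h1 := brWL_mem D hw' hf
    have h2 := evenPart_bilin_mem brWA hw' hp
    rw [add_comm j i] at h1 h2
    rw [fullBr_apply]
    exact ⟨evenPart_bilin_mem brWW hw hw',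
      add_mem (sub_mem (brWL_mem D hw hf') h1) (brLL_mem hf hf'),
      sub_mem (evenPart_bilin_mem brWA hw hp') h2⟩
  skew := by
    rintro i j ⟨w, f, p⟩ ⟨w', f', p'⟩ ⟨hw, hf, hp⟩ ⟨hw', hf', hp'⟩
    have h1 := brLL_skew hf hf'
    have h2 := brWW_skew w w'
    refine Prod.ext ?_ (Prod.ext ?_ ?_) <;>
    simp only [fullBr_apply, Prod.smul_mk, Prod.neg_mk]
    · rcases parity_cases i with rfl | rfl
      · rw [koszul_zero_left, one_smul, h2]
      · obtain rfl : w = 0 := hw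
        simp only [map_zero, LinearMap.zero_apply, smul_zero, neg_zero]
    · rcases parity_cases i with rfl | rfl
      · simp only [koszul_zero_left] at *
        linear_combination (norm := module) h1
      · obtain rfl : w = 0 := hw
        rcases parity_cases j with rfl | rfl
        · simp only [koszul_zero_right, map_zero, LinearMap.zero_apply] at *
          linear_combination (norm := module) h1
        · obtain rfl : w' = 0 := hw'
          simp only [map_zero, LinearMap.zero_apply]
          linear_combination (norm := module) h1
    · rcases parity_cases i with rfl | rfl
      · rw [koszul_zero_left, one_smul, neg_sub]
      · obtain rfl : w = 0 := hw
        obtain rfl : p = 0 := hp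
        simp only [map_zero, LinearMap.zero_apply, sub_zero, smul_zero, neg_zero]
  jacobi := by
    rintro i j ⟨w, f, p⟩ ⟨w', f', p'⟩ ⟨hw, hf, hp⟩ ⟨hw', hf', hp'⟩ ⟨w'', f'', p''⟩
    refine Prod.ext ?_ (Prod.ext ?_ ?_)
    · have h := brWW_brWW w w' w''
      simp only [fullBr_apply, Prod.smul_mk, Prod.mk_add_mk]
      rcases parity_cases i with rfl | rfl
      · rw [koszul_zero_left, one_smul, h]
      · obtain rfl : w = 0 := hw
        simp only [map_zero, LinearMap.zero_apply, smul_zero, add_zero]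
    · have e1 := brWL_brWW D w w' f''
      have e2 := brWL_brWW D w w'' f'
      have e3 := brWL_brWW D w' w'' f
      have e4 := brWL_brLL D w f' f''
      have e5 := brWL_brLL D w' f f''
      have e6 := brWL_brLL D w'' f f'
      have e7 := brLL_jacobi hf hf' f''
      have e8 : brLL G (D.brWL w'' f) f' = -(koszul i j • brLL G f' (D.brWL w'' f)) := by
        refine brLL_skew ?_ hf'
        have := brWL_mem D (i := 0) (w := w'') trivial hf
        rwa [zero_add] at this
      simp only [fullBr_apply, Prod.smul_mk, Prod.mk_add_mk, map_add, map_sub,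
        LinearMap.add_apply, LinearMap.sub_apply]
      rcases parity_cases i with rfl | rfl
      · simp only [koszul_zero_left, one_smul] at *
        linear_combination (norm := module) e1 - e2 + e3 + e4 - e5 + e6 + e7 + e8
      · obtain rfl : w = 0 := hw
        rcases parity_cases j with rfl | rfl
        · simp only [koszul_zero_right, one_smul, map_zero, LinearMap.zero_apply] at *
          linear_combination (norm := module) e3 - e5 + e6 + e7 + e8
        · obtain rfl : w' = 0 := hw'
          simp only [koszul_one_one, map_zero, LinearMap.zero_apply] at *
          linear_combination (norm := module) e6 + e7 + e8
    · have h := brWA_brWW w w' p''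
      have h1 := brWA_brWW w w'' p'
      have h2 := brWA_brWW w' w'' p
      simp only [fullBr_apply, Prod.smul_mk, Prod.mk_add_mk, map_add, map_sub,
        LinearMap.add_apply, LinearMap.sub_apply]
      rcases parity_cases i with rfl | rfl
      · simp only [koszul_zero_left, one_smul] at *
        linear_combination (norm := module) h - h1 + h2
      · obtain rfl : w = 0 := hw
        obtain rfl : p = 0 := hp
        simp only [map_zero, LinearMap.zero_apply] at *
        module

end TwistDatum

namespace TwistDatum

variable {g : Type*} [AddCommGroup g] [Module ℂ g] {G : LieSuperalgebra g} (D : TwistDatum G)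

/-- The subspace `(W ⋉ 𝔤) ⋉ A`, where `𝔤 = ⨁_k g_{[k]} ⊗ t^{k/n}` is the fixed point subalgebra
of the automorphism `x ⊗ t^{k/n} ↦ σ(x) ⊗ (ω_n⁻¹ t^{1/n})^k` of `g ⊗ ℂ[t^{1/n}, t^{-1/n}]`. -/
def tildeSpace : Submodule ℂ (FullTilde g) :=
  (⊤ : Submodule ℂ (ℤ →₀ ℂ)).prod ((coeffIn D.comp).prod ⊤)

theorem brWL_mem_comp (w : ℤ →₀ ℂ) {f : ℤ →₀ g} (hf : f ∈ coeffIn D.comp) :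
    D.brWL w f ∈ coeffIn D.comp := by
  refine laurentBilin_mem (fun i k c _ x hx => ?_) (mem_coeffIn_top w) hf
  rw [D.comp_add_mul]
  exact Submodule.smul_mem _ _ (add_mem (Submodule.smul_mem _ _ hx)
    (Submodule.smul_mem _ _ (D.d_mem_comp hx)))

theorem mem_tildeSpace {x : FullTilde g} : x ∈ D.tildeSpace ↔ x.2.1 ∈ coeffIn D.comp :=
  ⟨fun h => h.2.1, fun h => ⟨trivial, h, trivial⟩⟩

theorem tildeSpace_isGraded : D.fullTilde.IsGraded D.tildeSpace := by
  rintro ⟨w, f, p⟩ hf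
  obtain ⟨a, ha, b, hb, haP, hbP, hab⟩ :=
    coeffIn_exists_add G.toSuperspace D.comp_isGraded (D.mem_tildeSpace.1 hf)
  refine Submodule.mem_sup.2 ⟨(w, a, p), ⟨D.mem_tildeSpace.2 haP, ?_⟩,
    (0, b, 0), ⟨D.mem_tildeSpace.2 hbP, ?_⟩, ?_⟩
  · exact ⟨trivial, ha, trivial⟩
  · exact ⟨zero_mem _, hb, zero_mem _⟩
  · rw [Prod.mk_add_mk, Prod.mk_add_mk, hab, add_zero, add_zero]

theorem brLL_mem_comp {f f' : ℤ →₀ g} (hf : f ∈ coeffIn D.comp)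
    (hf' : f' ∈ coeffIn D.comp) : brLL G f f' ∈ coeffIn D.comp := by
  unfold brLL
  refine laurentBilin_mem (R := D.comp) (fun k l x hx y hy => ?_) hf hf'
  exact D.br_mem_comp hx hy

theorem fullBr_snd_fst_mem {f f' : ℤ →₀ g} (w w' : ℤ →₀ ℂ) (hf : f ∈ coeffIn D.comp)
    (hf' : f' ∈ coeffIn D.comp) :
    D.brWL w f' - D.brWL w' f + brLL G f f' ∈ coeffIn D.comp :=
  add_mem (sub_mem (D.brWL_mem_comp w hf') (D.brWL_mem_comp w' hf)) (D.brLL_mem_comp hf hf')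

theorem tildeSpace_br (x : FullTilde g) (hx : x ∈ D.tildeSpace) (y : FullTilde g)
    (hy : y ∈ D.tildeSpace) : D.fullTilde.br x y ∈ D.tildeSpace :=
  D.mem_tildeSpace.2 (D.fullBr_snd_fst_mem x.1 y.1 (D.mem_tildeSpace.1 hx)
    (D.mem_tildeSpace.1 hy))

/-- The Lie superalgebra `𝔏 ⋉ A`, where `𝔏 = W ⋉ 𝔤` is the `(d, σ)`-twisted algebra. -/
def tilde : LieSuperalgebra D.tildeSpace :=
  D.fullTilde.subalgebra D.tildeSpace D.tildeSpace_isGraded D.tildeSpace_br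

theorem mem_tilde_gr {i : ZMod 2} {x : D.tildeSpace} : x ∈ D.tilde.gr i ↔
    x.1.1 ∈ evenPart (ℤ →₀ ℂ) i ∧ x.1.2.1 ∈ G.laurent.gr i ∧
      x.1.2.2 ∈ evenPart (ℤ →₀ ℂ) i := Iff.rfl

/-- The element `ℓ_i` of `𝔏 ⋉ A`. -/
def ell (i : ℤ) : D.tildeSpace :=
  ⟨(Finsupp.single i 1, 0, 0), trivial, zero_mem _, trivial⟩

/-- The element `t^j` of `𝔏 ⋉ A`. -/
def tpow (j : ℤ) : D.tildeSpace :=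
  ⟨(0, 0, Finsupp.single j 1), trivial, zero_mem _, trivial⟩

end TwistDatum

namespace SuperModule

variable {g : Type*} [AddCommGroup g] [Module ℂ g] {G : LieSuperalgebra g} {D : TwistDatum G}

section Tilde

variable {M : Type*} [AddCommGroup M] [Module ℂ M]

/-- An `A𝔏`-module: an `𝔏 ⋉ A`-module on which `A` acts associatively. -/
def IsALModule (X : SuperModule D.tilde M) : Prop :=
  (∀ (i j : ℤ) (m : M), X.act (D.tpow i) (X.act (D.tpow j) m) = X.act (D.tpow (i + j)) m) ∧
    ∀ m : M, X.act (D.tpow 0) m = m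

/-- The weight space `M_μ = {m : ℓ_0 m = μ m}`. -/
def weightSpace (X : SuperModule D.tilde M) (μ : ℂ) : Submodule ℂ M :=
  Module.End.eigenspace (X.act (D.ell 0)) μ

/-- Cuspidal: `ℓ_0` is diagonalizable, and the weight spaces are finite-dimensional of uniformly
bounded dimension. -/
def IsCuspidal (X : SuperModule D.tilde M) : Prop :=
  (⨆ μ : ℂ, X.weightSpace μ) = ⊤ ∧
    ∃ N : ℕ, ∀ μ : ℂ, FiniteDimensional ℂ (X.weightSpace μ) ∧
      Module.finrank ℂ (X.weightSpace μ) ≤ N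

end Tilde

section Loop

variable {V : Type*} [AddCommGroup V] [Module ℂ V]

/-- `ℓ_i · (v ⊗ t^b) = ((λ + b + i∂) v) ⊗ t^{b+i}`, for `b ∈ (1/n)ℤ`. -/
def loopW (X : SuperModule D.ddg V) (lam : ℂ) : (ℤ →₀ ℂ) →ₗ[ℂ] (ℤ →₀ V) →ₗ[ℂ] (ℤ →₀ V) :=
  laurentBilin (fun i k => D.n * i + k) fun i k =>
    LinearMap.mk₂ ℂ (fun c v => c • ((lam + (k : ℂ) / D.n) • v + (i : ℂ) • X.act (1, 0) v))
      (fun _ _ _ => by module) (fun _ _ _ => by module)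
      (fun _ _ _ => by rw [map_add]; module) (fun _ _ _ => by rw [map_smul]; module)

/-- `x t^a · (v ⊗ t^b) = x v ⊗ t^{a+b}`. -/
def loopL (X : SuperModule D.ddg V) : (ℤ →₀ g) →ₗ[ℂ] (ℤ →₀ V) →ₗ[ℂ] (ℤ →₀ V) :=
  laurentBilin (fun k l => k + l) fun _ _ => X.act ∘ₗ LinearMap.inr ℂ ℂ g

/-- `t^i · (v ⊗ t^b) = v ⊗ t^{b+i}`. -/
def loopA (n : ℕ) (V : Type*) [AddCommGroup V] [Module ℂ V] :
    (ℤ →₀ ℂ) →ₗ[ℂ] (ℤ →₀ V) →ₗ[ℂ] (ℤ →₀ V) :=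
  laurentBilin (fun i k => n * i + k) fun _ _ => LinearMap.lsmul ℂ V

theorem loopW_brWW (X : SuperModule D.ddg V) (lam : ℂ) (w w' : ℤ →₀ ℂ) (m : ℤ →₀ V) :
    X.loopW lam (brWW w w') m =
      X.loopW lam w (X.loopW lam w' m) - X.loopW lam w' (X.loopW lam w m) := by
  have hn := D.n_ne_zero
  induction w using Finsupp.induction_linear with
  | zero => simp
  | add f g hf hg => simp only [map_add, LinearMap.add_apply, hf, hg]; abel
  | single i a =>
    induction w' using Finsupp.induction_linear with
    | zero => simp
    | add f g hf hg => simp only [map_add, LinearMap.add_apply, hf, hg]; abel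
    | single j b =>
      induction m using Finsupp.induction_linear with
      | zero => simp
      | add f g hf hg => simp only [map_add, hf, hg]; abel
      | single k v =>
        simp only [brWW, loopW, laurentBilin_single, mul_add, add_assoc,
          add_left_comm (D.n * j : ℤ) (D.n * i) k, ← Finsupp.single_sub]
        congr 1
        simp only [LinearMap.mk₂_apply, LinearMap.smul_apply, LinearMap.mul_apply', map_add,
          map_smul, smul_eq_mul, Int.cast_add, Int.cast_mul, Int.cast_natCast, add_div,
          mul_div_cancel_left₀ _ hn]
        module

theorem loopL_brWL (X : SuperModule D.ddg V) (lam : ℂ) (w : ℤ →₀ ℂ) (f : ℤ →₀ g)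
    (m : ℤ →₀ V) :
    X.loopL (D.brWL w f) m = X.loopW lam w (X.loopL f m) - X.loopL f (X.loopW lam w m) := by
  have hn := D.n_ne_zero
  induction w using Finsupp.induction_linear with
  | zero => simp
  | add f g hf hg => simp only [map_add, LinearMap.add_apply, hf, hg]; abel
  | single i a =>
    induction f using Finsupp.induction_linear with
    | zero => simp
    | add f g hf hg => simp only [map_add, LinearMap.add_apply, hf, hg]; abel
    | single j x =>
      induction m using Finsupp.induction_linear with
      | zero => simp
      | add f g hf hg => simp only [map_add, hf, hg]; abel
      | single k v =>
        simp only [TwistDatum.brWL, loopW, loopL, laurentBilin_single, add_assoc,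
          add_left_comm j (D.n * i : ℤ) k, ← Finsupp.single_sub]
        congr 1
        have hb : D.ddg.br (1, 0) (0, x) = (0, D.d x) := by
          simp [TwistDatum.ddg]
        have key : X.act (0, D.d x) v =
            X.act (1, 0) (X.act (0, x) v) - X.act (0, x) (X.act (1, 0) v) := by
          obtain ⟨y, hy, z, hz, rfl⟩ := G.exists_add x
          have h10 : ((1, 0) : ℂ × g) ∈ D.ddg.gr 0 := ⟨trivial, zero_mem _⟩
          have h1 := X.act_br h10 (y := (0, y)) (j := 0) ⟨zero_mem _, hy⟩ v
          have h2 := X.act_br h10 (y := (0, z)) (j := 1) ⟨zero_mem _, hz⟩ v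
          have e : ((0, y + z) : ℂ × g) = (0, y) + (0, z) := by simp
          rw [← hb, e, map_add, map_add, LinearMap.add_apply, h1, h2, map_add]
          simp only [koszul_zero_left, LinearMap.add_apply, map_add]
          module
        have e1 : ∀ (c r s : ℂ) (x y : g), X.act (0, c • (r • x + s • y)) =
            c • (r • X.act (0, x) + s • X.act (0, y)) := by
          intro c r s x y
          have e : ((0, c • (r • x + s • y)) : ℂ × g) =
              c • (r • ((0, x) : ℂ × g) + s • ((0, y) : ℂ × g)) := by
            simp
          rw [e, map_smul, map_add, map_smul, map_smul]
        simp only [LinearMap.mk₂_apply, LinearMap.comp_apply, LinearMap.inr_apply, e1]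
        simp only [map_add, map_smul, LinearMap.smul_apply, LinearMap.add_apply, Int.cast_add,
          add_div, key]
        module

theorem loopL_brLL (X : SuperModule D.ddg V) {i j : ZMod 2} {f f' : ℤ →₀ g}
    (hf : f ∈ G.laurent.gr i) (hf' : f' ∈ G.laurent.gr j) (m : ℤ →₀ V) :
    X.loopL (brLL G f f') m =
      X.loopL f (X.loopL f' m) - koszul i j • X.loopL f' (X.loopL f m) := by
  refine coeffIn_induction (p := fun f => X.loopL (brLL G f f') m =
      X.loopL f (X.loopL f' m) - koszul i j • X.loopL f' (X.loopL f m)) ?_ ?_ ?_ hf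
  · simp
  · intro f g hf hg
    simp only [map_add, LinearMap.add_apply, hf, hg]
    module
  · intro k x hx
    refine coeffIn_induction (p := fun f' => X.loopL (brLL G (Finsupp.single k x) f') m =
      X.loopL (Finsupp.single k x) (X.loopL f' m) -
        koszul i j • X.loopL f' (X.loopL (Finsupp.single k x) m)) ?_ ?_ ?_ hf'
    · simp
    · intro f g hf hg
      simp only [map_add, LinearMap.add_apply, hf, hg]
      module
    · intro l y hy
      induction m using Finsupp.induction_linear with
      | zero => simp
      | add f g hf hg => simp only [map_add, hf, hg]; module
      | single q v =>
        simp only [brLL, loopL, laurentBilin_single, add_assoc, add_left_comm l k q,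
          Finsupp.smul_single, ← Finsupp.single_sub]
        congr 1
        have hb : D.ddg.br (0, x) (0, y) = (0, G.br x y) := by
          simp [TwistDatum.ddg]
        have h1 := X.act_br (x := (0, x)) (y := (0, y)) (i := i) (j := j)
          ⟨zero_mem _, hx⟩ ⟨zero_mem _, hy⟩ v
        rwa [hb] at h1

theorem loopA_brWA (X : SuperModule D.ddg V) (lam : ℂ) (w p : ℤ →₀ ℂ) (m : ℤ →₀ V) :
    loopA D.n V (brWA w p) m =
      X.loopW lam w (loopA D.n V p m) - loopA D.n V p (X.loopW lam w m) := by
  have hn := D.n_ne_zero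
  induction w using Finsupp.induction_linear with
  | zero => simp
  | add f g hf hg => simp only [map_add, LinearMap.add_apply, hf, hg]; abel
  | single i a =>
    induction p using Finsupp.induction_linear with
    | zero => simp
    | add f g hf hg => simp only [map_add, LinearMap.add_apply, hf, hg]; abel
    | single j b =>
      induction m using Finsupp.induction_linear with
      | zero => simp
      | add f g hf hg => simp only [map_add, hf, hg]; abel
      | single k v =>
        simp only [brWA, loopW, loopA, laurentBilin_single, mul_add, add_assoc,
          add_left_comm (D.n * j : ℤ) (D.n * i) k, ← Finsupp.single_sub]
        congr 1
        simp only [LinearMap.mk₂_apply, LinearMap.smul_apply, LinearMap.mul_apply', map_add,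
          map_smul, smul_eq_mul, Int.cast_add, Int.cast_mul, Int.cast_natCast, add_div,
          mul_div_cancel_left₀ _ hn, LinearMap.lsmul_apply]
        module

theorem loopA_loopA (n : ℕ) (p p' : ℤ →₀ ℂ) (m : ℤ →₀ V) :
    loopA n V p (loopA n V p' m) = loopA n V p' (loopA n V p m) := by
  induction p using Finsupp.induction_linear with
  | zero => simp
  | add f g hf hg => simp only [map_add, LinearMap.add_apply, hf, hg]
  | single i a =>
    induction p' using Finsupp.induction_linear with
    | zero => simp
    | add f g hf hg => simp only [map_add, LinearMap.add_apply, hf, hg]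
    | single j b =>
      induction m using Finsupp.induction_linear with
      | zero => simp
      | add f g hf hg => simp only [map_add, hf, hg]
      | single k v =>
        simp only [loopA, laurentBilin_single, add_left_comm (n * j : ℤ) (n * i) k]
        congr 1
        simp only [LinearMap.lsmul_apply]
        module

theorem loopA_loopL (X : SuperModule D.ddg V) (p : ℤ →₀ ℂ) (f : ℤ →₀ g) (m : ℤ →₀ V) :
    loopA D.n V p (X.loopL f m) = X.loopL f (loopA D.n V p m) := by
  induction p using Finsupp.induction_linear with
  | zero => simp
  | add f g hf hg => simp only [map_add, LinearMap.add_apply, hf, hg]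
  | single i a =>
    induction f using Finsupp.induction_linear with
    | zero => simp
    | add f g hf hg => simp only [map_add, LinearMap.add_apply, hf, hg]
    | single j x =>
      induction m using Finsupp.induction_linear with
      | zero => simp
      | add f g hf hg => simp only [map_add, hf, hg]
      | single k v =>
        simp only [loopA, loopL, laurentBilin_single, add_left_comm j (D.n * i : ℤ) k]
        congr 1
        simp

theorem loopW_mem (X : SuperModule D.ddg V) (lam : ℂ) {P : ℤ → Submodule ℂ V}
    (hP : ∀ i k, P (D.n * i + k) = P k) (hd : ∀ k, ∀ v ∈ P k, X.act (1, 0) v ∈ P k)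
    (w : ℤ →₀ ℂ) {m : ℤ →₀ V} (hm : m ∈ coeffIn P) : X.loopW lam w m ∈ coeffIn P := by
  refine laurentBilin_mem (fun i k c _ v hv => ?_) (mem_coeffIn_top w) hm
  rw [hP]
  exact Submodule.smul_mem _ _ (add_mem (Submodule.smul_mem _ _ hv)
    (Submodule.smul_mem _ _ (hd k v hv)))

theorem loopA_mem (n : ℕ) {P : ℤ → Submodule ℂ V} (hP : ∀ i k, P (n * i + k) = P k)
    (w : ℤ →₀ ℂ) {m : ℤ →₀ V} (hm : m ∈ coeffIn P) : loopA n V w m ∈ coeffIn P := by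
  refine laurentBilin_mem (fun i k c _ v hv => ?_) (mem_coeffIn_top w) hm
  rw [hP]
  exact Submodule.smul_mem _ _ hv

theorem act_partial_mem (X : SuperModule D.ddg V) {j : ZMod 2} {v : V} (hv : v ∈ X.gr j) :
    X.act (1, 0) v ∈ X.gr j := by
  have h := X.act_mem (i := 0) (x := (1, 0)) ⟨trivial, zero_mem _⟩ hv
  rwa [zero_add] at h

/-- The loop module `Γ(V, λ) = V ⊗ ℂ[t^{1/n}, t^{-1/n}]` of a `ℂ∂ ⋉ g`-module `V`;
`Finsupp.single k v` is `v ⊗ t^{k/n}`. -/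
def Gamma (X : SuperModule D.ddg V) (lam : ℂ) : SuperModule D.tilde (ℤ →₀ V) where
  toSuperspace := X.toSuperspace.laurent
  act := LinearMap.mk₂ ℂ
    (fun x m => X.loopW lam x.1.1 m + X.loopL x.1.2.1 m + loopA D.n V x.1.2.2 m)
    (fun x y m => by
      simp only [Submodule.coe_add, Prod.fst_add, Prod.snd_add, map_add, LinearMap.add_apply]
      abel)
    (fun c x m => by
      simp only [Submodule.coe_smul, Prod.smul_fst, Prod.smul_snd, map_smul,
        LinearMap.smul_apply, smul_add])
    (fun x m m' => by
      simp only [map_add]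
      abel)
    (fun c x m => by simp only [map_smul, smul_add])
  act_mem := by
    rintro i j ⟨⟨w, f, p⟩, hx⟩ m hi hm
    obtain ⟨hw, hf, hp⟩ := D.mem_tilde_gr.1 hi
    refine add_mem (add_mem ?_ ?_) ?_
    · rcases parity_cases i with rfl | rfl
      · rw [zero_add]
        exact X.loopW_mem lam (fun _ _ => rfl) (fun _ _ hv => X.act_partial_mem hv) w hm
      · obtain rfl : w = 0 := hw
        simp only [map_zero, LinearMap.zero_apply, zero_mem]
    · refine laurentBilin_mem (fun _ _ x hx v hv => ?_) hf hm
      exact X.act_mem (x := (0, x)) ⟨zero_mem _, hx⟩ hv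
    · rcases parity_cases i with rfl | rfl
      · rw [zero_add]
        exact loopA_mem D.n (fun _ _ => rfl) p hm
      · obtain rfl : p = 0 := hp
        simp only [map_zero, LinearMap.zero_apply, zero_mem]
  act_br := by
    rintro i j ⟨⟨w, f, p⟩, hx⟩ ⟨⟨w', f', p'⟩, hx'⟩ hi hj m
    obtain ⟨hw, hf, hp⟩ := D.mem_tilde_gr.1 hi
    obtain ⟨hw', hf', hp'⟩ := D.mem_tilde_gr.1 hj
    have h1 := X.loopW_brWW lam w w' m
    have h2 := X.loopL_brWL lam w f' m
    have h3 := X.loopL_brWL lam w' f m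
    have h4 := X.loopL_brLL hf hf' m
    have h5 := X.loopA_brWA lam w p' m
    have h6 := X.loopA_brWA lam w' p m
    have h7 := loopA_loopA D.n p p' m
    have h8 := X.loopA_loopL p f' m
    have h9 := X.loopA_loopL p' f m
    change X.loopW lam (brWW w w') m +
      X.loopL (D.brWL w f' - D.brWL w' f + brLL G f f') m +
      loopA D.n V (brWA w p' - brWA w' p) m = _
    simp only [LinearMap.mk₂_apply, map_add, map_sub, LinearMap.add_apply, LinearMap.sub_apply]
    rcases parity_cases i with rfl | rfl
    · simp only [koszul_zero_left, one_smul] at *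
      linear_combination (norm := module) h1 + h2 - h3 + h4 + h5 - h6 - h7 - h8 + h9
    · obtain rfl : w = 0 := hw
      obtain rfl : p = 0 := hp
      rcases parity_cases j with rfl | rfl
      · simp only [koszul_zero_right, one_smul, map_zero, LinearMap.zero_apply] at *
        linear_combination (norm := module) h4 + h9 - h3
      · obtain rfl : w' = 0 := hw'
        obtain rfl : p' = 0 := hp'
        simp only [map_zero, LinearMap.zero_apply] at *
        linear_combination (norm := module) h4

/-- A `ℤ_n`-gradation of a `ℂ∂ ⋉ g`-module: a decomposition `V = ⨁ V_{[i]}` into supersubspaces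
with `∂ V_{[j]} ⊆ V_{[j]}` and `g_{[k]} V_{[j]} ⊆ V_{[k+j]}`. -/
structure ZnGrading (X : SuperModule D.ddg V) where
  comp : ZMod D.n → Submodule ℂ V
  isInternal : DirectSum.IsInternal comp
  graded : ∀ i, X.IsGraded (comp i)
  partial_mem : ∀ j, ∀ v ∈ comp j, X.act (1, 0) v ∈ comp j
  act_mem : ∀ (k : ℤ) (j : ZMod D.n), ∀ x ∈ D.comp k, ∀ v ∈ comp j,
    X.act (0, x) v ∈ comp (k + j)

/-- `ℤ_n`-graded-simple: nonzero, with no `ℤ_n`-graded submodules other than `0` and the whole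
module. -/
def IsZnGradedSimple (X : SuperModule D.ddg V) (E : X.ZnGrading) : Prop :=
  Nontrivial V ∧ ∀ P : Submodule ℂ V, X.IsSubmodule P → P ≤ ⨆ i, P ⊓ E.comp i →
    P = ⊥ ∨ P = ⊤

/-- The subspace `⨁_k V_{[k]} ⊗ t^{k/n}` of `Γ(V, λ)`. -/
def FSpace {X : SuperModule D.ddg V} (E : X.ZnGrading) : Submodule ℂ (ℤ →₀ V) :=
  coeffIn fun k : ℤ => E.comp k

theorem FSpace_isSubmodule (X : SuperModule D.ddg V) (E : X.ZnGrading) (lam : ℂ) :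
    (X.Gamma lam).IsSubmodule (FSpace E) where
  graded := by
    intro m hm
    obtain ⟨a, ha, b, hb, haP, hbP, hab⟩ :=
      coeffIn_exists_add X.toSuperspace (fun k : ℤ => E.graded k) hm
    exact Submodule.mem_sup.2 ⟨a, ⟨haP, ha⟩, b, ⟨hbP, hb⟩, hab⟩
  act_mem := by
    rintro ⟨⟨w, f, p⟩, -, hf, -⟩ m hm
    have hP : ∀ i k : ℤ, E.comp ((D.n * i + k : ℤ) : ZMod D.n) = E.comp (k : ZMod D.n) := by
      intro i k
      simp
    refine add_mem (add_mem (X.loopW_mem lam hP (fun k => E.partial_mem k) w hm) ?_)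
      (loopA_mem D.n hP p hm)
    refine laurentBilin_mem (fun k j x hx v hv => ?_) hf hm
    rw [Int.cast_add]
    exact E.act_mem k j x hx v hv

/-- The loop module `F(V, λ) = ⨁_k V_{[k]} ⊗ t^{k/n} ⊆ Γ(V, λ)` of a `ℤ_n`-graded module. -/
def F (X : SuperModule D.ddg V) (E : X.ZnGrading) (lam : ℂ) :
    SuperModule D.tilde (FSpace E) :=
  (X.Gamma lam).sub (FSpace E) (X.FSpace_isSubmodule E lam)

end Loop

end SuperModule

end

universe u v

/-! Since `t` acts invertibly, an `A𝔏`-module is determined by its fibre at `t = 1`, just as an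
equivariant bundle on the punctured line is determined by one fibre. The fibre is realized by
`secSpace`: families `v_k` in the weight spaces `M_{λ+k/n}` with `t v_k = v_{k+n}`. It carries the
operators `t^{-i} ℓ_i - ℓ_0`, which represent the vector fields `(T^i - 1) T d/dT` vanishing at `1`,
together with the currents `x t^{l/n}` and the projections onto the classes of `k` modulo `n`. For
simple cuspidal `M` the fibre is finite-dimensional, nonzero, and simple as a `ℤ₂`- and `ℤ_n`-graded
module (`finiteDimensional_secSpace`, `nontrivial_secSpace`, `fiber_isSimple`).

The heart of the matter is `IsSimple.rigid`: on such a fibre a vector field acts through its linear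
part at `1` and a current through its value at `1`. With `s = T - 1`, the fields `s^{k+1} d/ds` are
eigenvectors of the adjoint action of `-s d/ds` with eigenvalues `-k`. Finite dimension allows only
finitely many eigenvalues, so fields of high order vanish (`exists_forall_LP_eq_zero`). Brackets of
fields with currents then kill the currents `x - d(x)` of high order; as `1` is not an eigenvalue of
`d`, these are all currents of high order (`XP_eq_zero_of_LP_eq_zero`). Finally the order drops one
step at a time (`IsSimple.descend`): the top surviving layer is an ideal of pairwise supercommuting
operators, nilpotent by Jacobson's lemma or by oddness. Its common kernel is a nonzero graded
submodule, hence everything, and the layer acts by zero.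

Rigidity gives `t^{-i} ℓ_i - ℓ_0 = i ∂`, and the action of `x t^{l/n}` depends only on `l` modulo
`n`. So the fibre is a `ℤ_n`-graded-simple module `V` over `ℂ∂ ⋉ g`, and evaluating sections
identifies `F(V, λ)` with `M` (`iso_F`). For the second claim, take a simple quotient `V'` of `V`.
The composite of `M ≅ F(V, λ) ⊆ Γ(V, λ)` with the projection to `Γ(V', λ)` is nonzero because the
components `V_{[j]}` span `V`, hence injective because `M` is simple. -/

noncomputable section

/-! ### Nilpotency and common kernels in finite dimension -/

section LinearAlgebra

variable {V : Type*} [AddCommGroup V] [Module ℂ V]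

theorem commute_aeval_of_commute {C N : Module.End ℂ V} (h : Commute C N) (p : Polynomial ℂ) :
    Commute C (Polynomial.aeval N p) := by
  induction p using Polynomial.induction_on' with
  | add p q hp hq => rw [map_add]; exact hp.add_right hq
  | monomial k a =>
    rw [Polynomial.aeval_monomial]
    exact (show Commute C (algebraMap ℂ _ a) from (Algebra.commutes a C).symm).mul_right
      (h.pow_right k)

/-- Jacobson's lemma: an endomorphism `N = C B - B C` commuting with `C` is nilpotent. -/
theorem isNilpotent_commutator [FiniteDimensional ℂ V] {B C N : Module.End ℂ V}
    (hN : N = C * B - B * C) (hC : Commute C N) : IsNilpotent N := by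
  obtain ⟨m, u, hm, hu⟩ : ∃ (m : ℕ) (u : Polynomial ℂ), minpoly ℂ N = Polynomial.X ^ m * u ∧
      ¬ Polynomial.X ∣ u := by
    have h0 : minpoly ℂ N ≠ 0 := minpoly.ne_zero (Algebra.IsIntegral.isIntegral N)
    obtain ⟨u, hu, hu'⟩ := Polynomial.exists_eq_pow_rootMultiplicity_mul_and_not_dvd _ h0 0
    rw [Polynomial.C_0, sub_zero] at hu hu'
    exact ⟨_, u, hu, hu'⟩
  -- The Bézout identity yields the projection `e` onto the part where `N` is invertible. The
  -- exponent `m + 1`, rather than `m`, gives `e` a factor `N` even when `m = 0`.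
  have hcop : IsCoprime ((Polynomial.X : Polynomial ℂ) ^ (m + 1)) u :=
    ((Polynomial.irreducible_X.coprime_iff_not_dvd).2 hu).pow_left
  obtain ⟨a, b, hab⟩ := hcop
  have hmin : Polynomial.aeval N (Polynomial.X ^ m * u) = 0 := hm ▸ minpoly.aeval ℂ N
  set e := Polynomial.aeval N (a * Polynomial.X ^ (m + 1)) with he
  have hidem : IsIdempotentElem e := by
    have h : a * Polynomial.X ^ (m + 1) * (a * Polynomial.X ^ (m + 1)) =
        a * Polynomial.X ^ (m + 1) -
          a * Polynomial.X * b * (Polynomial.X ^ m * u) := by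
      linear_combination (a * Polynomial.X ^ (m + 1)) * hab
    change e * e = e
    rw [he, ← map_mul, h, map_sub, map_mul _ (a * Polynomial.X * b), hmin, mul_zero, sub_zero]
  -- Write `e = N W` with `W` a polynomial in `N`. As `C` commutes with `W`, `e` is the commutator
  -- of `C` and `B W`, so it has trace zero; an idempotent of trace zero vanishes in characteristic
  -- zero.
  have htr : LinearMap.trace ℂ V e = 0 := by
    set W := Polynomial.aeval N (a * Polynomial.X ^ m) with hW
    have h1 : e = C * (B * W) - (B * W) * C := by
      have h2 : C * W = W * C := commute_aeval_of_commute hC _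
      have h3 : e = N * W := by
        rw [he, hW, show a * Polynomial.X ^ (m + 1) = Polynomial.X * (a * Polynomial.X ^ m) by ring,
          map_mul _ Polynomial.X, Polynomial.aeval_X]
      rw [h3, mul_assoc B W C, ← h2, ← mul_assoc, ← mul_assoc, ← sub_mul, hN]
    rw [h1, map_sub, LinearMap.trace_mul_comm, sub_self]
  have he0 : e = 0 := LinearMap.IsIdempotentElem.eq_zero_of_trace_eq_zero hidem htr
  refine ⟨m, ?_⟩
  have h : (Polynomial.X : Polynomial ℂ) ^ m =
      Polynomial.X ^ m * (a * Polynomial.X ^ (m + 1)) + b * (Polynomial.X ^ m * u) := by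
    linear_combination (-Polynomial.X ^ m) * hab
  have := congrArg (Polynomial.aeval N) h
  rwa [map_add, map_mul, map_mul _ b, hmin, ← he, he0, mul_zero, mul_zero, add_zero, map_pow,
    Polynomial.aeval_X] at this

theorem exists_ne_zero_apply_eq_zero {f : Module.End ℂ V} (hf : IsNilpotent f)
    {P : Submodule ℂ V} (hP : P ≠ ⊥) (hfP : ∀ v ∈ P, f v ∈ P) : ∃ v ∈ P, v ≠ 0 ∧ f v = 0 := by
  classical
  obtain ⟨w, hw, hw0⟩ := Submodule.exists_mem_ne_zero_of_ne_bot hP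
  obtain ⟨k, hk⟩ := hf
  have hex : ∃ k, (f ^ k) w = 0 := ⟨k, by rw [hk]; rfl⟩
  have hmem : ∀ k, (f ^ k) w ∈ P := by
    intro k
    induction k with
    | zero => simpa using hw
    | succ k ih => rw [pow_succ']; exact hfP _ ih
  obtain ⟨m, hm⟩ : ∃ m, Nat.find hex = m + 1 := by
    refine Nat.exists_eq_succ_of_ne_zero fun h => hw0 ?_
    have := Nat.find_spec hex
    rw [h] at this
    simpa using this
  refine ⟨(f ^ m) w, hmem m, Nat.find_min hex (by omega), ?_⟩
  have := Nat.find_spec hex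
  rwa [hm, pow_succ'] at this

/-- A family of nilpotent endomorphisms that commute up to scalars has a common kernel vector. -/
theorem exists_common_kernel [FiniteDimensional ℂ V] [Nontrivial V] (S : Set (Module.End ℂ V))
    (hnil : ∀ f ∈ S, IsNilpotent f) (hcomm : ∀ f ∈ S, ∀ h ∈ S, ∃ c : ℂ, f * h = c • (h * f)) :
    ∃ v : V, v ≠ 0 ∧ ∀ f ∈ S, f v = 0 := by
  let Q : Set (Submodule ℂ V) := {P | P ≠ ⊥ ∧ ∀ f ∈ S, ∀ v ∈ P, f v ∈ P}
  -- On a minimal nonzero invariant subspace the kernel of each `f` is nonzero by nilpotency and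
  -- invariant by commutation up to scalars, so it is the whole subspace.
  obtain ⟨P, ⟨hP, hPS⟩, hmin⟩ := (wellFounded_lt (α := Submodule ℂ V)).has_min Q
    ⟨⊤, top_ne_bot, fun _ _ _ _ => trivial⟩
  obtain ⟨v, hv, hv0⟩ := Submodule.exists_mem_ne_zero_of_ne_bot hP
  refine ⟨v, hv0, fun f hf => ?_⟩
  have hle : P ≤ LinearMap.ker f := by
    by_contra hle
    refine hmin (P ⊓ LinearMap.ker f) ⟨?_, ?_⟩ (inf_lt_left.2 hle)
    · obtain ⟨w, hw, hw0, hfw⟩ := exists_ne_zero_apply_eq_zero (hnil f hf) hP (hPS f hf)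
      exact Submodule.ne_bot_iff _ |>.2 ⟨w, ⟨hw, hfw⟩, hw0⟩
    · rintro h hh w ⟨hw, hfw⟩
      refine ⟨hPS h hh w hw, ?_⟩
      obtain ⟨c, hc⟩ := hcomm f hf h hh
      have : f (h w) = c • h (f w) := congrArg (fun e => e w) hc
      change f (h w) = 0
      rw [this, show f w = 0 from hfw, map_zero, smul_zero]
  exact hle hv

/-- In a finite-dimensional space, an endomorphism has eigenvectors for only finitely many of the
eigenvalues `-k`, `k ∈ ℕ`. -/
theorem exists_forall_eigenvector_eq_zero [FiniteDimensional ℂ V] (f : Module.End ℂ V)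
    (v : ℕ → V) (hv : ∀ k, f (v k) = (-(k : ℂ)) • v k) : ∃ N, ∀ k ≥ N, v k = 0 := by
  have hfin := Module.End.finite_hasEigenvalue f
  have hfin' : {k : ℕ | f.HasEigenvalue (-(k : ℂ))}.Finite :=
    hfin.preimage (Set.injOn_of_injective fun a b h => by simpa using h)
  obtain ⟨N, hN⟩ := hfin'.bddAbove
  refine ⟨N + 1, fun k hk => ?_⟩
  by_contra h0
  have : k ≤ N := hN (Module.End.hasEigenvalue_of_hasEigenvector
    (Module.End.hasEigenvector_iff.2 ⟨Module.End.mem_eigenspace_iff.2 (hv k), h0⟩))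
  omega

end LinearAlgebra

/-! ### Homomorphisms, submodules and simple quotients -/

namespace SuperModule

variable {L : Type*} [AddCommGroup L] [Module ℂ L] {S : LieSuperalgebra L}
variable {M : Type*} [AddCommGroup M] [Module ℂ M]
variable {N : Type*} [AddCommGroup N] [Module ℂ N]

/-- `IsIso` demands parity preservation in one direction only; uniqueness of the even and odd
components gives the other. -/
theorem IsIso.symm {X : SuperModule S M} {Y : SuperModule S N} (h : X.IsIso Y) : Y.IsIso X := by
  obtain ⟨e, he, hact⟩ := h
  refine ⟨e.symm, fun i m hm => ?_, fun x m => ?_⟩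
  · obtain ⟨a, ha, b, hb, hab⟩ := X.exists_add (e.symm m)
    have hm' : m = e a + e b := by rw [← map_add, hab, e.apply_symm_apply]
    rw [← hab]
    rcases parity_cases i with rfl | rfl
    · have : e b = 0 := Y.eq_zero (eq_sub_of_add_eq' hm'.symm ▸ sub_mem hm (he 0 a ha)) (he 1 b hb)
      rw [(map_eq_zero_iff e e.injective).1 this, add_zero]
      exact ha
    · have : e a = 0 := Y.eq_zero (he 0 a ha) (eq_sub_of_add_eq hm'.symm ▸ sub_mem hm (he 1 b hb))
      rw [(map_eq_zero_iff e e.injective).1 this, zero_add]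
      exact hb
  · rw [e.symm_apply_eq, hact, e.apply_symm_apply]

/-- A parity-preserving homomorphism of modules. -/
structure IsHom (X : SuperModule S M) (Y : SuperModule S N) (f : M →ₗ[ℂ] N) : Prop where
  map_mem : ∀ i, ∀ m ∈ X.gr i, f m ∈ Y.gr i
  map_act : ∀ x m, f (X.act x m) = Y.act x (f m)

variable {X : SuperModule S M} {Y : SuperModule S N} {f : M →ₗ[ℂ] N}

/-- Gradedness passes to the preimage because the homogeneous components of `f m` are the images of
those of `m`. -/
theorem IsSubmodule.comap (hf : X.IsHom Y f) {P : Submodule ℂ N} (hP : Y.IsSubmodule P) :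
    X.IsSubmodule (P.comap f) where
  graded := by
    intro m hm
    obtain ⟨a, ha, b, hb, hab⟩ := X.exists_add m
    obtain ⟨a', ha', b', hb', haP, hbP, hab'⟩ := hP.graded.exists_add hm
    have h : f a - a' = b' - f b := by
      rw [sub_eq_sub_iff_add_eq_add, ← map_add, hab, add_comm b', hab']
    have h0 : f a - a' = 0 := Y.eq_zero (sub_mem (hf.map_mem 0 a ha) ha')
      (h ▸ sub_mem hb' (hf.map_mem 1 b hb))
    rw [h0] at h
    refine Submodule.mem_sup.2 ⟨a, ⟨?_, ha⟩, b, ⟨?_, hb⟩, hab⟩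
    · exact (sub_eq_zero.1 h0 ▸ haP : f a ∈ P)
    · exact (sub_eq_zero.1 h.symm ▸ hbP : f b ∈ P)
  act_mem x m hm := by
    change f _ ∈ P
    rw [hf.map_act]
    exact hP.act_mem x _ hm

theorem bot_isSubmodule (X : SuperModule S M) : X.IsSubmodule ⊥ where
  graded := bot_le
  act_mem x m hm := by
    rw [(Submodule.mem_bot ℂ).1 hm, map_zero]
    exact zero_mem _

theorem range_isSubmodule (hf : X.IsHom Y f) : Y.IsSubmodule (LinearMap.range f) where
  graded := by
    rintro _ ⟨m, rfl⟩
    obtain ⟨a, ha, b, hb, hab⟩ := X.exists_add m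
    exact Submodule.mem_sup.2 ⟨f a, ⟨⟨a, rfl⟩, hf.map_mem 0 a ha⟩, f b,
      ⟨⟨b, rfl⟩, hf.map_mem 1 b hb⟩, by rw [← map_add, hab]⟩
  act_mem := by
    rintro x _ ⟨m, rfl⟩
    exact ⟨X.act x m, hf.map_act x m⟩

theorem IsSimple.of_iso (h : X.IsSimple) (e : X.IsIso Y) : Y.IsSimple := by
  obtain ⟨e, he, hact⟩ := e
  obtain ⟨hM, hs⟩ := h
  refine ⟨e.symm.toEquiv.nontrivial, fun P hP => ?_⟩
  rcases hs (P.comap (e : M →ₗ[ℂ] N)) (hP.comap ⟨he, hact⟩) with h | h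
  · left
    refine eq_bot_iff.2 fun v hv => ?_
    have : e.symm v ∈ P.comap (e : M →ₗ[ℂ] N) := by simpa using hv
    rw [h, Submodule.mem_bot] at this
    simpa using this
  · right
    refine eq_top_iff.2 fun v _ => ?_
    have : e.symm v ∈ P.comap (e : M →ₗ[ℂ] N) := h ▸ trivial
    simpa using this

/-- A nonzero homomorphism from a simple module identifies it with a subquotient. -/
theorem IsSimple.iso_subquot (h : X.IsSimple) (hf : X.IsHom Y f) (h0 : f ≠ 0) :
    X.IsIso (Y.subquot Y.bot_isSubmodule (range_isSubmodule hf) bot_le) := by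
  have hinj : Function.Injective f := by
    rw [← LinearMap.ker_eq_bot]
    rcases h.2 _ (Y.bot_isSubmodule.comap hf) with h' | h'
    · exact h'
    · exact absurd (LinearMap.ker_eq_top.1 h') h0
  have hbot : (⊥ : Submodule ℂ N).comap (LinearMap.range f).subtype = ⊥ := by
    rw [Submodule.comap_bot, Submodule.ker_subtype]
  refine ⟨(LinearEquiv.ofInjective f hinj).trans (Submodule.quotEquivOfEqBot _ hbot).symm,
    fun i m hm => ?_, fun x m => ?_⟩
  · exact ⟨LinearEquiv.ofInjective f hinj m, hf.map_mem i m hm, rfl⟩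
  · change Submodule.Quotient.mk (LinearEquiv.ofInjective f hinj (X.act x m)) =
      Submodule.Quotient.mk ((Y.sub _ (range_isSubmodule hf)).act x
        (LinearEquiv.ofInjective f hinj m))
    congr 1
    exact Subtype.ext (hf.map_act x m)

theorem mkQ_isHom (X : SuperModule S M) {P : Submodule ℂ M} (hP : X.IsSubmodule P) :
    X.IsHom (X.quot P hP) P.mkQ where
  map_mem _ m hm := ⟨m, hm, rfl⟩
  map_act _ _ := rfl

/-- A nonzero finite-dimensional module has a simple quotient. -/
theorem exists_simple_quotient (X : SuperModule S M) [FiniteDimensional ℂ M] [Nontrivial M] :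
    ∃ (P : Submodule ℂ M) (hP : X.IsSubmodule P), (X.quot P hP).IsSimple := by
  let Q : Set (Submodule ℂ M) := {P | P ≠ ⊤ ∧ X.IsSubmodule P}
  -- A minimum for the reversed order: `P` is a maximal proper graded submodule.
  obtain ⟨P, ⟨hP, hPX⟩, hmax⟩ := (wellFounded_gt (α := Submodule ℂ M)).has_min Q
    ⟨⊥, bot_ne_top, X.bot_isSubmodule⟩
  refine ⟨P, hPX, Submodule.Quotient.nontrivial_iff.2 hP, fun R hR => ?_⟩
  have hle : P ≤ R.comap P.mkQ := by
    intro m hm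
    change P.mkQ m ∈ R
    rw [show P.mkQ m = 0 from (Submodule.Quotient.mk_eq_zero P).2 hm]
    exact zero_mem _
  by_cases hT : R.comap P.mkQ = ⊤
  · right
    rw [← Submodule.map_comap_eq_of_surjective P.mkQ_surjective R, hT, Submodule.map_top,
      Submodule.range_mkQ]
  · left
    have hn := hmax _ ⟨hT, hR.comap (X.mkQ_isHom hPX)⟩
    have : R.comap P.mkQ = P := (hle.eq_of_not_lt hn).symm
    rw [← Submodule.map_comap_eq_of_surjective P.mkQ_surjective R, this, Submodule.mkQ_map_self]

end SuperModule

/-! ### Laurent polynomials near the point `T = 1` -/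

open scoped LaurentPolynomial
open LaurentPolynomial (T T_zero T_add)

section LaurentSum

variable {W : Type*} [AddCommGroup W] [Module ℂ W]

/-- The linear map `∑ c_i T^i ↦ ∑ c_i f_i`. -/
def laurentSum (f : ℤ → W) : ℂ[T;T⁻¹] →ₗ[ℂ] W :=
  Finsupp.linearCombination ℂ f ∘ₗ (AddMonoidAlgebra.coeffLinearEquiv ℂ).toLinearMap

@[simp] theorem laurentSum_T (f : ℤ → W) (i : ℤ) : laurentSum f (T i) = f i := by
  rw [laurentSum, T]
  simp [-LaurentPolynomial.single_eq_C_mul_T]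

theorem laurent_induction {p : ℂ[T;T⁻¹] → Prop} (hadd : ∀ a b, p a → p b → p (a + b))
    (hsmul : ∀ (c : ℂ) a, p a → p (c • a)) (hT : ∀ i, p (T i)) (a : ℂ[T;T⁻¹]) : p a := by
  induction a using LaurentPolynomial.induction_on' with
  | add a b ha hb => exact hadd a b ha hb
  | C_mul_T i c => rw [← LaurentPolynomial.smul_eq_C_mul]; exact hsmul _ _ (hT i)

/-- The Euler derivation `T d/dT`. -/
def eulerD : ℂ[T;T⁻¹] →ₗ[ℂ] ℂ[T;T⁻¹] := laurentSum fun i => (i : ℂ) • T i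

/-- Evaluation at `1`. -/
def evalOne : ℂ[T;T⁻¹] →ₗ[ℂ] ℂ := laurentSum fun _ => 1

@[simp] theorem eulerD_T (i : ℤ) : eulerD (T i) = (i : ℂ) • T i := laurentSum_T _ i

@[simp] theorem evalOne_T (i : ℤ) : evalOne (T i) = 1 := laurentSum_T _ i

theorem eulerD_mul (p q : ℂ[T;T⁻¹]) : eulerD (p * q) = eulerD p * q + p * eulerD q := by
  induction p using laurent_induction with
  | hadd a b ha hb => rw [add_mul, map_add, ha, hb, map_add]; ring
  | hsmul c a ha =>
    rw [smul_mul_assoc, map_smul, ha, map_smul, smul_mul_assoc, smul_mul_assoc, smul_add]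
  | hT i =>
    induction q using laurent_induction with
    | hadd a b ha hb => rw [mul_add, map_add, ha, hb, map_add]; ring
    | hsmul c a ha =>
      rw [mul_smul_comm, map_smul, ha, map_smul, mul_smul_comm, mul_smul_comm, smul_add]
    | hT j =>
      rw [← T_add, eulerD_T, eulerD_T, eulerD_T, smul_mul_assoc, mul_smul_comm, ← T_add,
        ← add_smul, Int.cast_add]

/-- The local parameter `T - 1` at `1`. -/
def sT : ℂ[T;T⁻¹] := T 1 - 1

theorem eulerD_sT_pow (k : ℕ) : eulerD (sT ^ (k + 1)) = ((k : ℂ) + 1) • (sT ^ k * T 1) := by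
  have h1 : eulerD sT = T 1 := by
    rw [sT, ← T_zero, map_sub, eulerD_T, eulerD_T]
    simp
  induction k with
  | zero => simp [h1]
  | succ k ih =>
    rw [pow_succ, eulerD_mul, ih, h1, Nat.cast_succ, pow_succ, smul_mul_assoc]
    have : (sT ^ k * T 1 * sT : ℂ[T;T⁻¹]) = sT ^ k * sT * T 1 := by ring
    rw [this]
    module

theorem evalOne_sT_mul (p : ℂ[T;T⁻¹]) : evalOne (sT * p) = 0 := by
  induction p using laurent_induction with
  | hadd a b ha hb => rw [mul_add, map_add, ha, hb, add_zero]
  | hsmul c a ha => rw [mul_smul_comm, map_smul, ha, smul_zero]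
  | hT i => rw [sT, sub_mul, one_mul, ← T_add, map_sub, evalOne_T, evalOne_T, sub_self]

theorem T_one_mul_T_neg_one : (T 1 * T (-1) : ℂ[T;T⁻¹]) = 1 := by
  rw [← T_add]; simp [T_zero]

/-- Each monomial is congruent to `1` modulo `sT`; negative exponents cause no trouble because `T`
is a unit. This is what makes the multiples of `sT` the kernel of evaluation at `1`. -/
theorem exists_T_sub_one_eq (i : ℤ) : ∃ q : ℂ[T;T⁻¹], T i - 1 = sT * q := by
  induction i with
  | zero => exact ⟨0, by rw [T_zero, sub_self, mul_zero]⟩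
  | succ i ih =>
    obtain ⟨q, hq⟩ := ih
    refine ⟨q * T 1 + 1, ?_⟩
    rw [T_add]
    simp only [sT] at *
    linear_combination (T 1) * hq
  | pred i ih =>
    obtain ⟨q, hq⟩ := ih
    refine ⟨q * T (-1) - T (-1), ?_⟩
    rw [sub_eq_add_neg (-(i : ℤ)), T_add]
    simp only [sT] at *
    linear_combination (T (-1)) * hq + T_one_mul_T_neg_one

end LaurentSum

/-! ### Vector fields and currents acting on the fibre at `t = 1` -/

namespace TwistDatum

variable {g : Type*} [AddCommGroup g] [Module ℂ g] {G : LieSuperalgebra g} (D : TwistDatum G)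

/-- The projection of `g` onto `g_{[k]}` along the other eigenspaces of `σ`. -/
def proj (k : ℤ) : g →ₗ[ℂ] g :=
  (D.n : ℂ)⁻¹ • ∑ j ∈ Finset.range D.n, D.omega ^ (-(k * j)) • ((D.σ : g →ₗ[ℂ] g) ^ j)

/-- The fibre at `t = 1` of an `A𝔏`-module: an action of the operators `t^{-i} ℓ_i - ℓ_0` and
`x t^{l/n}` on a `ℤ₂`- and `ℤ_n`-graded space, where `r` are the components of the
`ℤ_n`-gradation. -/
structure FiberModule (V : Type*) [AddCommGroup V] [Module ℂ V] extends Superspace V where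
  L : ℤ → Module.End ℂ V
  X : ℤ → g →ₗ[ℂ] Module.End ℂ V
  r : ZMod D.n → Module.End ℂ V
  L_mem : ∀ (i : ℤ) {j : ZMod 2} {v : V}, v ∈ gr j → L i v ∈ gr j
  X_mem : ∀ (l : ℤ) {i j : ZMod 2} {x : g} {v : V}, x ∈ G.gr i → v ∈ gr j → X l x v ∈ gr (i + j)
  X_proj : ∀ (l : ℤ) (x : g), X l (D.proj l x) = X l x
  L_r : ∀ i j, L i * r j = r j * L i
  X_r : ∀ (l : ℤ) x j, X l x * r j = r (l + j) * X l x
  L_zero : L 0 = 0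
  L_L : ∀ i j : ℤ, L i * L j - L j * L i =
    ((j : ℂ) - i) • L (i + j) + (i : ℂ) • L i - (j : ℂ) • L j
  L_X : ∀ (i l : ℤ) (x : g), L i * X l x - X l x * L i =
    ((l : ℂ) / D.n) • X (D.n * i + l) x + (i : ℂ) • X (D.n * i + l) (D.d x) -
      ((l : ℂ) / D.n) • X l x
  X_X : ∀ (l m : ℤ) {a b : ZMod 2} {x y : g}, x ∈ G.gr a → y ∈ G.gr b →
    X l x * X m y - koszul a b • (X m y * X l x) = X (l + m) (G.br (D.proj l x) (D.proj m y))

variable {D}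

namespace FiberModule

variable {V : Type*} [AddCommGroup V] [Module ℂ V] (J : D.FiberModule V)

/-- A `ℤ₂`- and `ℤ_n`-graded submodule. -/
structure IsSubmodule (P : Submodule ℂ V) : Prop where
  graded : J.IsGraded P
  r_mem : ∀ j, ∀ v ∈ P, J.r j v ∈ P
  L_mem : ∀ i, ∀ v ∈ P, J.L i v ∈ P
  X_mem : ∀ l x, ∀ v ∈ P, J.X l x v ∈ P

/-- Simple as a graded module. -/
def IsSimple : Prop := ∀ P : Submodule ℂ V, J.IsSubmodule P → P = ⊥ ∨ P = ⊤

/-- The operator of the vector field `(p - p(1)) T d/dT`. -/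
def LP : ℂ[T;T⁻¹] →ₗ[ℂ] Module.End ℂ V := laurentSum J.L

/-- The operators of `x t^{l/n} p`. -/
def XP (l : ℤ) : ℂ[T;T⁻¹] →ₗ[ℂ] g →ₗ[ℂ] Module.End ℂ V := laurentSum fun i => J.X (D.n * i + l)

@[simp] theorem LP_T (i : ℤ) : J.LP (T i) = J.L i := laurentSum_T _ i

@[simp] theorem XP_T (l i : ℤ) : J.XP l (T i) = J.X (D.n * i + l) := laurentSum_T _ i

theorem XP_one (l : ℤ) : J.XP l 1 = J.X l := by
  rw [← T_zero, XP_T, mul_zero, zero_add]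

/-- This is the bracket of the vector fields `(p - p(1)) T d/dT` and `(q - q(1)) T d/dT`. The
resulting coefficient again vanishes at `1`, so no correction is needed. By bilinearity only
monomials matter, and there it is `L_L`. -/
theorem LP_LP (p q : ℂ[T;T⁻¹]) : J.LP p * J.LP q - J.LP q * J.LP p =
    J.LP ((p - evalOne p • 1) * eulerD q - (q - evalOne q • 1) * eulerD p) := by
  induction p using laurent_induction with
  | hadd a b ha hb =>
    simp only [map_add, map_sub, map_smul, add_smul, add_mul, mul_add, sub_mul, one_mul,
      smul_mul_assoc] at *
    linear_combination (norm := module) ha + hb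
  | hsmul c a ha =>
    simp only [map_sub, map_smul, sub_mul, one_mul, smul_mul_assoc, mul_smul_comm,
      smul_eq_mul] at *
    linear_combination (norm := module) c • ha
  | hT i =>
    induction q using laurent_induction with
    | hadd a b ha hb =>
      simp only [map_add, map_sub, map_smul, add_smul, add_mul, mul_add, sub_mul, one_mul,
        smul_mul_assoc] at *
      linear_combination (norm := module) ha + hb
    | hsmul c a ha =>
      simp only [map_sub, map_smul, sub_mul, one_mul, smul_mul_assoc, mul_smul_comm,
        smul_eq_mul] at *
      linear_combination (norm := module) c • ha
    | hT j =>
      have : (T i - evalOne (T i) • 1) * eulerD (T j) - (T j - evalOne (T j) • 1) * eulerD (T i) =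
          ((j : ℂ) - i) • T (i + j) + (i : ℂ) • T i - (j : ℂ) • T j := by
        simp only [evalOne_T, eulerD_T, one_smul, mul_smul_comm, sub_mul, one_mul, ← T_add,
          add_comm j i]
        module
      rw [this]
      simp only [map_sub, map_add, map_smul, LP_T, J.L_L]

/-- The first term differentiates the coefficient `t^{l/n} q` along the field, whence the summand `l
/ n`; the second twists by `d`, weighted by the derivative of the field's coefficient. -/
theorem LP_XP (p q : ℂ[T;T⁻¹]) (l : ℤ) (x : g) : J.LP p * J.XP l q x - J.XP l q x * J.LP p =
    J.XP l ((p - evalOne p • 1) * (eulerD q + ((l : ℂ) / D.n) • q)) x +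
      J.XP l (q * eulerD p) (D.d x) := by
  have hn := D.n_ne_zero
  induction p using laurent_induction with
  | hadd a b ha hb =>
    simp only [map_add, map_sub, map_smul, add_smul, add_mul, mul_add, sub_mul, one_mul,
      smul_mul_assoc, LinearMap.add_apply, LinearMap.sub_apply] at *
    linear_combination (norm := module) ha + hb
  | hsmul c a ha =>
    simp only [map_sub, map_smul, sub_mul, one_mul, smul_mul_assoc, mul_smul_comm,
      smul_eq_mul, LinearMap.sub_apply, LinearMap.smul_apply] at *
    linear_combination (norm := module) c • ha
  | hT i =>
    induction q using laurent_induction with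
    | hadd a b ha hb =>
      simp only [map_add, smul_add, mul_add, add_mul, LinearMap.add_apply] at *
      linear_combination (norm := abel) ha + hb
    | hsmul c a ha =>
      simp only [map_smul, smul_comm _ c, ← smul_add, smul_mul_assoc, mul_smul_comm,
        LinearMap.smul_apply] at *
      linear_combination (norm := module) c • ha
    | hT m =>
      have h1 : (T i - evalOne (T i) • 1) * (eulerD (T m) + ((l : ℂ) / D.n) • T m) =
          (((D.n * m + l : ℤ) : ℂ) / D.n) • (T (i + m) - T m : ℂ[T;T⁻¹]) := by
        simp only [evalOne_T, eulerD_T, one_smul, mul_smul_comm, sub_mul, one_mul, ← T_add,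
          mul_add]
        rw [Int.cast_add, Int.cast_mul, Int.cast_natCast, add_div, mul_div_cancel_left₀ _ hn]
        module
      have h2 : (T m * eulerD (T i) : ℂ[T;T⁻¹]) = (i : ℂ) • T (i + m) := by
        rw [eulerD_T, mul_smul_comm, ← T_add, add_comm]
      rw [h1, h2, LP_T, XP_T, J.L_X]
      simp only [map_smul, map_sub, XP_T, LinearMap.smul_apply, LinearMap.sub_apply, mul_add,
        add_assoc]
      module

theorem proj_add_mul (D : TwistDatum G) (i l : ℤ) : D.proj (D.n * i + l) = D.proj l := by
  unfold proj
  congr 1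
  refine Finset.sum_congr rfl fun j _ => ?_
  congr 1
  rw [show -((D.n * i + l) * j) = (D.n : ℤ) * (-(i * j)) + -(l * j) by ring,
    zpow_add₀ D.omega_ne_zero, zpow_mul, D.omega_pow, one_zpow, one_mul]

theorem XP_XP {a b : ZMod 2} {x y : g} (hx : x ∈ G.gr a) (hy : y ∈ G.gr b) (l m : ℤ)
    (p q : ℂ[T;T⁻¹]) :
    J.XP l p x * J.XP m q y - koszul a b • (J.XP m q y * J.XP l p x) =
      J.XP (l + m) (p * q) (G.br (D.proj l x) (D.proj m y)) := by
  induction p using laurent_induction with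
  | hadd p p' h h' =>
    simp only [map_add, add_mul, mul_add, LinearMap.add_apply, smul_add] at *
    linear_combination (norm := abel) h + h'
  | hsmul c p h =>
    simp only [map_smul, smul_mul_assoc, LinearMap.smul_apply, mul_smul_comm] at *
    rw [← h, smul_sub, smul_comm c]
  | hT i =>
    induction q using laurent_induction with
    | hadd p p' h h' =>
      simp only [map_add, add_mul, mul_add, LinearMap.add_apply, smul_add] at *
      linear_combination (norm := abel) h + h'
    | hsmul c p h =>
      simp only [map_smul, smul_mul_assoc, LinearMap.smul_apply, mul_smul_comm] at *
      rw [← h, smul_sub, smul_comm c]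
    | hT j =>
      rw [XP_T, XP_T, J.X_X _ _ hx hy, ← T_add, XP_T, proj_add_mul, proj_add_mul]
      congr 2
      ring

end FiberModule

end TwistDatum

/-! ### Operators vanishing to high order act by zero, and descent of the order -/

theorem evalOne_sT_pow_mul (k : ℕ) (p : ℂ[T;T⁻¹]) : evalOne (sT ^ (k + 1) * p) = 0 := by
  rw [pow_succ', mul_assoc, evalOne_sT_mul]

theorem evalOne_sT_pow (k : ℕ) : evalOne (sT ^ (k + 1)) = 0 := by
  rw [← mul_one (sT ^ (k + 1)), evalOne_sT_pow_mul]

@[simp] theorem evalOne_one : evalOne 1 = 1 := by rw [← T_zero, evalOne_T]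

/-- A linear map killing the multiples of `T - 1` factors through evaluation at `1`. -/
theorem apply_eq_evalOne_smul {W : Type*} [AddCommGroup W] [Module ℂ W] (φ : ℂ[T;T⁻¹] →ₗ[ℂ] W)
    (h : ∀ p, φ (sT * p) = 0) (p : ℂ[T;T⁻¹]) : φ p = evalOne p • φ 1 := by
  induction p using laurent_induction with
  | hadd a b ha hb => rw [map_add, map_add, ha, hb, add_smul]
  | hsmul c a ha => rw [map_smul, map_smul, ha, smul_assoc]
  | hT i =>
    obtain ⟨q, hq⟩ := exists_T_sub_one_eq i
    rw [evalOne_T, one_smul, ← sub_eq_zero, ← map_sub, hq, h]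

theorem Superspace.eq_zero_of_add_eq_zero {V : Type*} [AddCommGroup V] [Module ℂ V]
    (S : Superspace V) {i : ZMod 2} {a b : V} (ha : a ∈ S.gr i) (hb : b ∈ S.gr (i + 1))
    (h : a + b = 0) : a = 0 ∧ b = 0 := by
  have hab : a = -b := eq_neg_of_add_eq_zero_left h
  have ha0 : a = 0 := by
    have h1 : a ∈ S.gr (i + 1) := hab ▸ neg_mem hb
    rcases parity_cases i with rfl | rfl
    · exact S.eq_zero ha h1
    · exact S.eq_zero h1 ha
  exact ⟨ha0, by rw [ha0, zero_add] at h; exact h⟩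

namespace TwistDatum.FiberModule

variable {g : Type*} [AddCommGroup g] [Module ℂ g] {G : LieSuperalgebra g} {D : TwistDatum G}
variable {V : Type*} [AddCommGroup V] [Module ℂ V] (J : D.FiberModule V)

theorem LP_mem (p : ℂ[T;T⁻¹]) {j : ZMod 2} {v : V} (hv : v ∈ J.gr j) : J.LP p v ∈ J.gr j := by
  induction p using laurent_induction with
  | hadd a b ha hb => rw [map_add]; exact add_mem ha hb
  | hsmul c a ha => rw [map_smul]; exact Submodule.smul_mem _ _ ha
  | hT i => rw [LP_T]; exact J.L_mem i hv

theorem XP_mem (l : ℤ) (p : ℂ[T;T⁻¹]) {i j : ZMod 2} {x : g} {v : V} (hx : x ∈ G.gr i)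
    (hv : v ∈ J.gr j) : J.XP l p x v ∈ J.gr (i + j) := by
  induction p using laurent_induction with
  | hadd a b ha hb => rw [map_add]; exact add_mem ha hb
  | hsmul c a ha => rw [map_smul]; exact Submodule.smul_mem _ _ ha
  | hT i => rw [XP_T]; exact J.X_mem _ hx hv

theorem LP_r (p : ℂ[T;T⁻¹]) (j : ZMod D.n) : J.LP p * J.r j = J.r j * J.LP p := by
  induction p using laurent_induction with
  | hadd a b ha hb => rw [map_add, add_mul, mul_add, ha, hb]
  | hsmul c a ha => rw [map_smul, smul_mul_assoc, ha, mul_smul_comm]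
  | hT i => rw [LP_T, J.L_r]

theorem XP_r (l : ℤ) (p : ℂ[T;T⁻¹]) (x : g) (j : ZMod D.n) :
    J.XP l p x * J.r j = J.r (l + j) * J.XP l p x := by
  induction p using laurent_induction with
  | hadd a b ha hb => rw [map_add, LinearMap.add_apply, add_mul, mul_add, ha, hb]
  | hsmul c a ha => rw [map_smul, LinearMap.smul_apply, smul_mul_assoc, ha, mul_smul_comm]
  | hT i => rw [XP_T, J.X_r]; simp

/-- Put `s = T - 1`. The coefficients `T (-1)` and `sT ^ (k + 1) * T (-1)` stand for the fields `-s
d/ds` and `s^{k+1} d/ds`, so the second is an eigenvector of the adjoint action of the first with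
eigenvalue `-k`. On a finite-dimensional endomorphism space it must vanish for large `k`; the other
coefficients follow by algebra. -/
theorem exists_forall_LP_eq_zero [FiniteDimensional ℂ V] :
    ∃ R : ℕ, ∀ p, J.LP (sT ^ (R + 1) * p) = 0 := by
  have hbr : ∀ k : ℕ, J.LP (T (-1)) * J.LP (sT ^ (k + 1) * T (-1)) -
      J.LP (sT ^ (k + 1) * T (-1)) * J.LP (T (-1)) = -(k : ℂ) • J.LP (sT ^ (k + 1) * T (-1)) := by
    intro k
    rw [J.LP_LP, evalOne_T, evalOne_sT_pow_mul, ← map_smul, eulerD_mul, eulerD_sT_pow, eulerD_T]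
    congr 1
    simp only [LaurentPolynomial.smul_eq_C_mul, map_add, map_natCast, map_neg, map_one, map_zero,
      Int.cast_neg, Int.cast_one, sT]
    have h := T_one_mul_T_neg_one
    linear_combination ((k + 1) * (T 1 - 1) ^ k * T (-1)) * h
  obtain ⟨N, hN⟩ := exists_forall_eigenvector_eq_zero
    (LinearMap.mulLeft ℂ (J.LP (T (-1))) - LinearMap.mulRight ℂ (J.LP (T (-1))))
    (fun k => J.LP (sT ^ (k + 1) * T (-1))) hbr
  -- Exponents from `-1` upwards: replace `T` by `sT + 1` and use the vanishing for both `k + 1` and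
  -- `k`.
  have hpos : ∀ i : ℕ, ∀ k ≥ N, J.LP (sT ^ (k + 1) * T ((i : ℤ) - 1)) = 0 := by
    intro i
    induction i with
    | zero => simpa using hN
    | succ i ih =>
      intro k hk
      have h1 : (sT ^ (k + 1) * T (((i + 1 : ℕ) : ℤ) - 1) : ℂ[T;T⁻¹]) =
          sT ^ (k + 1 + 1) * T ((i : ℤ) - 1) + sT ^ (k + 1) * T ((i : ℤ) - 1) := by
        rw [show ((i + 1 : ℕ) : ℤ) - 1 = ((i : ℤ) - 1) + 1 by push_cast; ring, T_add]
        simp only [sT]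
        ring
      rw [h1, map_add, ih k hk, ih (k + 1) (by omega), add_zero]
  refine ⟨N + 1, fun p => ?_⟩
  -- All other exponents are reached by bracketing an arbitrary `T j` with a field already known to
  -- vanish. The two choices of `i` give two relations between the same pair of operators.
  have key : ∀ i j : ℤ, (i = 0 ∨ i = 1) →
      ((N : ℂ) + 1 + 1) • J.LP (sT ^ (N + 1) * T (i + j + 1)) +
        ((i : ℂ) - j) • J.LP (sT ^ (N + 1 + 1) * T (i + j)) = 0 := by
    intro i j hi
    have hz : ∀ k ≥ N, J.LP (sT ^ (k + 1) * T i) = 0 ∧ J.LP (sT ^ (k + 1) * T (i + 1)) = 0 := by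
      intro k hk
      rcases hi with rfl | rfl
      · exact ⟨by simpa using hpos 1 k hk, by simpa using hpos 2 k hk⟩
      · exact ⟨by simpa using hpos 2 k hk, by simpa using hpos 3 k hk⟩
    have h1 := J.LP_LP (T j) (sT ^ (N + 1 + 1) * T i)
    rw [(hz (N + 1) (by omega)).1, mul_zero, zero_mul, sub_zero, evalOne_T, evalOne_sT_pow_mul,
      eulerD_mul, eulerD_sT_pow, eulerD_T, eulerD_T] at h1
    have h2 : ((T j - (1 : ℂ) • 1) * (((N + 1 : ℕ) : ℂ) + 1) • (sT ^ (N + 1) * T 1) * T i +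
          (T j - (1 : ℂ) • 1) * (sT ^ (N + 1 + 1) * (i : ℂ) • T i) -
        (sT ^ (N + 1 + 1) * T i - (0 : ℂ) • 1) * (j : ℂ) • T j : ℂ[T;T⁻¹]) =
        ((N : ℂ) + 1 + 1) • (sT ^ (N + 1) * T (i + j + 1)) +
        ((i : ℂ) - j) • (sT ^ (N + 1 + 1) * T (i + j)) -
        ((N : ℂ) + 1 + 1) • (sT ^ (N + 1) * T (i + 1)) - (i : ℂ) • (sT ^ (N + 1 + 1) * T i) := by
      simp only [LaurentPolynomial.smul_eq_C_mul, map_add, map_sub, map_natCast, map_one,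
        map_zero, T_add, Nat.cast_add, Nat.cast_one]
      ring
    rw [mul_add, ← mul_assoc, h2, map_sub, map_sub, map_smul _ (i : ℂ),
      map_smul _ ((N : ℂ) + 1 + 1) (sT ^ (N + 1) * T (i + 1)), (hz (N + 1) (by omega)).1,
      (hz N le_rfl).2, smul_zero, smul_zero, sub_zero, sub_zero, map_add, map_smul, map_smul] at h1
    exact h1.symm
  induction p using laurent_induction with
  | hadd a b ha hb => rw [mul_add, map_add, ha, hb, add_zero]
  | hsmul c a ha => rw [mul_smul_comm, map_smul, ha, smul_zero]
  | hT e =>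
    -- Both relations have the same first term, and the second coefficients are `-e` and `2 - e`;
    -- subtracting leaves twice the wanted operator.
    have h0 := key 0 e (Or.inl rfl)
    have h1 := key 1 (e - 1) (Or.inr rfl)
    rw [zero_add] at h0
    rw [add_sub_cancel] at h1
    have h2 : (2 : ℂ) • J.LP (sT ^ (N + 1 + 1) * T e) = 0 := by
      push_cast at h0 h1
      linear_combination (norm := module) h1 - h0
    exact (smul_eq_zero.1 h2).resolve_left two_ne_zero

theorem surjective_id_sub [FiniteDimensional ℂ g] (D : TwistDatum G)
    (hd : ¬ Module.End.HasEigenvalue D.d 1) (y : g) : ∃ x, x - D.d x = y := by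
  have hinj : Function.Injective (LinearMap.id - D.d : g →ₗ[ℂ] g) := by
    rw [← LinearMap.ker_eq_bot, eq_bot_iff]
    intro x hx
    by_contra h0
    refine hd (Module.End.hasEigenvalue_of_hasEigenvector (x := x)
      (Module.End.hasEigenvector_iff.2 ⟨Module.End.mem_eigenspace_iff.2 ?_, h0⟩))
    rw [one_smul]
    exact (sub_eq_zero.1 hx).symm
  exact LinearMap.injective_iff_surjective.1 hinj y

/-- Splitting the order differently between field and current, as `(f, 1)` and `(f T⁻¹, T)`, gives
two vanishing brackets. In their difference the derivative terms and the `l / n` terms cancel,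
leaving the current `f` with coefficient `x - d(x)`. Such elements exhaust `g` because `1` is not an
eigenvalue of `d`. -/
theorem XP_eq_zero_of_LP_eq_zero [FiniteDimensional ℂ g]
    (hd : ¬ Module.End.HasEigenvalue D.d 1) {R : ℕ} (hR : ∀ p, J.LP (sT ^ (R + 1) * p) = 0)
    (l : ℤ) (p : ℂ[T;T⁻¹]) (y : g) : J.XP l (sT ^ (R + 1) * p) y = 0 := by
  obtain ⟨x, rfl⟩ := surjective_id_sub D hd y
  have h1 := J.LP_XP (sT ^ (R + 1) * p) 1 l x
  have h2 := J.LP_XP (sT ^ (R + 1) * (p * T (-1))) (T 1) l x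
  rw [hR, zero_mul, mul_zero, sub_zero, evalOne_sT_pow_mul, zero_smul, sub_zero] at h1 h2
  have e1 : eulerD (1 : ℂ[T;T⁻¹]) = 0 := by rw [← T_zero, eulerD_T]; simp
  have e2 : (T 1 * eulerD (sT ^ (R + 1) * (p * T (-1))) : ℂ[T;T⁻¹]) =
      eulerD (sT ^ (R + 1) * p) - sT ^ (R + 1) * p := by
    rw [← mul_assoc, eulerD_mul _ (T (-1)), eulerD_T, Int.cast_neg, Int.cast_one, neg_smul,
      one_smul]
    linear_combination (eulerD (sT ^ (R + 1) * p) - sT ^ (R + 1) * p) * T_one_mul_T_neg_one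
  have e3 : (sT ^ (R + 1) * (p * T (-1)) * (eulerD (T 1) + ((l : ℂ) / D.n) • T 1) : ℂ[T;T⁻¹]) =
      sT ^ (R + 1) * p + sT ^ (R + 1) * p * ((l : ℂ) / D.n) • 1 := by
    rw [eulerD_T, Int.cast_one, one_smul]
    simp only [LaurentPolynomial.smul_eq_C_mul]
    linear_combination (sT ^ (R + 1) * p + sT ^ (R + 1) * p * LaurentPolynomial.C ((l : ℂ) / D.n)) *
      T_one_mul_T_neg_one
  rw [e1, zero_add, one_mul] at h1
  rw [e2, e3, map_add, map_sub, LinearMap.add_apply, LinearMap.sub_apply] at h2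
  rw [map_sub]
  linear_combination (norm := abel) h1 - h2

theorem isNilpotent_of_smul {R : Type*} [Ring R] [Algebra ℂ R] {c : ℂ} (hc : c ≠ 0) {a : R}
    (h : IsNilpotent (c • a)) : IsNilpotent a := by
  rw [← inv_smul_smul₀ hc a]
  exact h.smul _

/-- If the vector fields vanishing to order `k + 3` and the currents vanishing to order `k + 2`
at `t = 1` act trivially on a simple module, so do those of order `k + 2` and `k + 1`. -/
theorem IsSimple.descend [FiniteDimensional ℂ V] [Nontrivial V] (hs : J.IsSimple) {k : ℕ}
    (hL : ∀ p, J.LP (sT ^ (k + 3) * p) = 0) (hX : ∀ l p x, J.XP l (sT ^ (k + 2) * p) x = 0) :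
    (∀ p, J.LP (sT ^ (k + 2) * p) = 0) ∧ ∀ l p x, J.XP l (sT ^ (k + 1) * p) x = 0 := by
  set C := J.LP (sT ^ (k + 2)) with hC
  set Y : ℤ → g → Module.End ℂ V := fun l x => J.XP l (sT ^ (k + 1)) x with hY
  have hYadd : ∀ l x y, Y l (x + y) = Y l x + Y l y := fun l x y => map_add _ _ _
  -- One more factor `sT` gives zero, so the top surviving layer is spanned by `C` and the operators
  -- `Y l x`.
  have f1 : ∀ p, J.LP (sT ^ (k + 2) * p) = evalOne p • C := by
    intro p
    have := apply_eq_evalOne_smul (J.LP ∘ₗ LinearMap.mulLeft ℂ (sT ^ (k + 2)))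
      (fun p => by
        simp only [LinearMap.comp_apply, LinearMap.mulLeft_apply]
        rw [← mul_assoc, ← pow_succ, hL]) p
    simpa only [LinearMap.comp_apply, LinearMap.mulLeft_apply, mul_one] using this
  have f2 : ∀ l p x, J.XP l (sT ^ (k + 1) * p) x = evalOne p • Y l x := by
    intro l p x
    have := apply_eq_evalOne_smul ((J.XP l).flip x ∘ₗ LinearMap.mulLeft ℂ (sT ^ (k + 1)))
      (fun p => by
        simp only [LinearMap.comp_apply, LinearMap.mulLeft_apply, LinearMap.flip_apply]
        rw [← mul_assoc, ← pow_succ, hX]) p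
    simpa only [LinearMap.comp_apply, LinearMap.mulLeft_apply, LinearMap.flip_apply,
      mul_one] using this
  have hLC : ∀ i, ∃ c : ℂ, J.L i * C - C * J.L i = c • C := by
    intro i
    obtain ⟨q, hq⟩ := exists_T_sub_one_eq i
    have h := J.LP_LP (T i) (sT ^ (k + 2))
    rw [evalOne_T, one_smul, hq, evalOne_sT_pow, zero_smul, sub_zero, eulerD_sT_pow, eulerD_T,
      LP_T] at h
    rw [h, show (sT * q * (((k + 1 : ℕ) : ℂ) + 1) • (sT ^ (k + 1) * T 1) -
      sT ^ (k + 2) * (i : ℂ) • T i : ℂ[T;T⁻¹]) =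
      sT ^ (k + 2) * (q * (((k + 1 : ℕ) : ℂ) + 1) • T 1 - (i : ℂ) • T i) by
        simp only [LaurentPolynomial.smul_eq_C_mul]
        ring, f1]
    exact ⟨_, rfl⟩
  have hLY : ∀ i l x, ∃ c c' : ℂ, J.L i * Y l x - Y l x * J.L i =
      c • Y l x + c' • Y l (D.d x) := by
    intro i l x
    obtain ⟨q, hq⟩ := exists_T_sub_one_eq i
    have h := J.LP_XP (T i) (sT ^ (k + 1)) l x
    rw [evalOne_T, one_smul, hq, eulerD_sT_pow, LP_T, f2] at h
    rw [h, show (sT * q * (((k : ℂ) + 1) • (sT ^ k * T 1) + ((l : ℂ) / D.n) • sT ^ (k + 1)) :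
      ℂ[T;T⁻¹]) = sT ^ (k + 1) * (q * (((k : ℂ) + 1) • T 1 + ((l : ℂ) / D.n) • sT)) by
        simp only [LaurentPolynomial.smul_eq_C_mul]
        ring, f2]
    exact ⟨_, _, rfl⟩
  -- `L (-1)` is the field `-s d/ds`, with `s = T - 1`, and so measures the order of vanishing. On
  -- currents, `hEY` shows an additional contribution of `d`.
  have hEC : J.L (-1) * C - C * J.L (-1) = -((k : ℂ) + 1) • C := by
    have h := J.LP_LP (T (-1)) (sT ^ (k + 2))
    rw [evalOne_T, one_smul, evalOne_sT_pow, zero_smul, sub_zero, eulerD_sT_pow, eulerD_T,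
      LP_T] at h
    rw [h, show ((T (-1) - 1) * (((k + 1 : ℕ) : ℂ) + 1) • (sT ^ (k + 1) * T 1) -
      sT ^ (k + 2) * ((-1 : ℤ) : ℂ) • T (-1) : ℂ[T;T⁻¹]) =
      sT ^ (k + 2) * (T (-1) - ((k : ℂ) + 2) • T 0) by
        simp only [LaurentPolynomial.smul_eq_C_mul, map_add, map_natCast, map_one, map_neg,
          Int.cast_neg, Int.cast_one, Nat.cast_add, Nat.cast_one, T_zero,
          map_ofNat LaurentPolynomial.C, sT]
        linear_combination ((k + 2) * (T 1 - 1) ^ (k + 1)) * T_one_mul_T_neg_one, f1]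
    simp only [map_sub, map_smul, evalOne_T, smul_eq_mul]
    module
  have hEY : ∀ l x, J.L (-1) * Y l x - Y l x * J.L (-1) =
      -((k : ℂ) + 1) • Y l x - Y l (D.d x) := by
    intro l x
    have h := J.LP_XP (T (-1)) (sT ^ (k + 1)) l x
    rw [evalOne_T, one_smul, eulerD_sT_pow, LP_T, eulerD_T, f2] at h
    rw [h, show ((T (-1) - 1) * (((k : ℂ) + 1) • (sT ^ k * T 1) + ((l : ℂ) / D.n) • sT ^ (k + 1)) :
      ℂ[T;T⁻¹]) = sT ^ (k + 1) * (((l : ℂ) / D.n) • (T (-1) - T 0) - ((k : ℂ) + 1) • T 0) by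
        simp only [LaurentPolynomial.smul_eq_C_mul, map_add, map_natCast, map_one, T_zero, sT]
        linear_combination ((k + 1) * (T 1 - 1) ^ k) * T_one_mul_T_neg_one, f2]
    simp only [map_sub, map_smul, evalOne_T, smul_eq_mul]
    push_cast
    module
  -- Differentiating `sT ^ (k + 2)` loses one order, which lands exactly in the top layer of
  -- currents.
  have hCX : ∀ l x, C * J.X l x - J.X l x * C = ((k : ℂ) + 2) • Y l (D.d x) := by
    intro l x
    have h := J.LP_XP (sT ^ (k + 2)) 1 l x
    rw [evalOne_sT_pow, zero_smul, sub_zero, hX, eulerD_sT_pow, one_mul, zero_add, XP_one,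
      map_smul, LinearMap.smul_apply, f2, evalOne_T, one_smul] at h
    rw [h]
    push_cast
    module
  -- The bracket has order at least `2k + 2`, hence at least `k + 2`, where currents act by zero.
  -- The same count gives `hYY`.
  have hCY : ∀ l x, C * Y l x = Y l x * C := by
    intro l x
    have h := J.LP_XP (sT ^ (k + 2)) (sT ^ (k + 1)) l x
    rw [evalOne_sT_pow, zero_smul, sub_zero, hX, eulerD_sT_pow, zero_add,
      show (sT ^ (k + 1) * (((k + 1 : ℕ) : ℂ) + 1) • (sT ^ (k + 1) * T 1) : ℂ[T;T⁻¹]) =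
        sT ^ (k + 2) * ((((k + 1 : ℕ) : ℂ) + 1) • (sT ^ k * T 1)) by
        simp only [LaurentPolynomial.smul_eq_C_mul]
        ring, hX] at h
    exact sub_eq_zero.1 h
  have hYX : ∀ {a b : ZMod 2} {x y : g}, x ∈ G.gr a → y ∈ G.gr b → ∀ l m,
      Y l x * J.X m y - koszul a b • (J.X m y * Y l x) =
        Y (l + m) (G.br (D.proj l x) (D.proj m y)) := by
    intro a b x y hx hy l m
    have h := J.XP_XP hx hy l m (sT ^ (k + 1)) 1
    rwa [XP_one, mul_one] at h
  have hYY : ∀ {a b : ZMod 2} {x y : g}, x ∈ G.gr a → y ∈ G.gr b → ∀ l m,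
      Y l x * Y m y = koszul a b • (Y m y * Y l x) := by
    intro a b x y hx hy l m
    have h := J.XP_XP hx hy l m (sT ^ (k + 1)) (sT ^ (k + 1))
    rw [show (sT ^ (k + 1) * sT ^ (k + 1) : ℂ[T;T⁻¹]) = sT ^ (k + 2) * sT ^ k by ring, hX] at h
    exact sub_eq_zero.1 h
  have hk1 : (k : ℂ) + 1 ≠ 0 := Nat.cast_add_one_ne_zero k
  have hk2 : (k : ℂ) + 2 ≠ 0 := by exact_mod_cast (by omega : k + 2 ≠ 0)
  -- Jacobson's lemma: `(k + 1) C` is the commutator of `C` with `L (-1)`.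
  have nC : IsNilpotent C := by
    refine isNilpotent_of_smul hk1 (isNilpotent_commutator (C := C) (B := J.L (-1)) ?_ ?_)
    · linear_combination (norm := module) hEC
    · exact (Commute.refl C).smul_right _
  -- Jacobson's lemma again: `(k + 2) Y l (d x)` is the commutator of `C` with `X l x`, and it
  -- commutes with `C`.
  have nYd : ∀ l x, IsNilpotent (Y l (D.d x)) := by
    intro l x
    refine isNilpotent_of_smul hk2 (isNilpotent_commutator (hCX l x).symm ?_)
    exact (show Commute C _ from hCY l _).smul_right _
  -- For even `x`, the commutator of `Y l x` with `L (-1)` is `(k + 1) Y l x + Y l (d x)`. It is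
  -- nilpotent by Jacobson's lemma, and subtracting the commuting nilpotent `Y l (d x)` leaves `(k +
  -- 1) Y l x`, whatever the eigenvalues of `d`. For odd `x`, supercommutation with itself makes the
  -- square zero.
  have nY : ∀ (a : ZMod 2), ∀ x ∈ G.gr a, ∀ l, IsNilpotent (Y l x) := by
    intro a x hx l
    rcases parity_cases a with rfl | rfl
    · have hcd : Commute (Y l x) (Y l (D.d x)) := by
        have := hYY hx (D.d_mem hx) l l
        rwa [koszul_zero_left, one_smul] at this
      have hN : IsNilpotent (((k : ℂ) + 1) • Y l x + Y l (D.d x)) := by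
        refine isNilpotent_commutator (C := Y l x) (B := J.L (-1)) ?_
          (((Commute.refl _).smul_right _).add_right hcd)
        linear_combination (norm := module) hEY l x
      refine isNilpotent_of_smul hk1 ?_
      have := Commute.isNilpotent_sub
        (((hcd.smul_left ((k : ℂ) + 1)).add_left (Commute.refl (Y l (D.d x))))) hN (nYd l x)
      rwa [add_sub_cancel_right] at this
    · refine ⟨2, ?_⟩
      have h := hYY hx hx l l
      rw [koszul_one_one, neg_smul, one_smul, eq_neg_iff_add_eq_zero, ← two_smul ℂ] at h
      rw [pow_two]
      exact (smul_eq_zero.1 h).resolve_left two_ne_zero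
  obtain ⟨v, hv0, hv⟩ := exists_common_kernel
    ({f | f = C ∨ ∃ l a x, x ∈ G.gr a ∧ f = Y l x} : Set (Module.End ℂ V))
    (by
      rintro f (rfl | ⟨l, a, x, hx, rfl⟩)
      · exact nC
      · exact nY a x hx l)
    (by
      rintro f (rfl | ⟨l, a, x, hx, rfl⟩) h (rfl | ⟨m, b, y, hy, rfl⟩)
      · exact ⟨1, (one_smul _ _).symm⟩
      · exact ⟨1, by rw [one_smul, hCY]⟩
      · exact ⟨1, by rw [one_smul, hCY]⟩
      · exact ⟨_, hYY hx hy l m⟩)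
  let Z : Submodule ℂ V :=
    { carrier := {v | C v = 0 ∧ ∀ l x, Y l x v = 0}
      add_mem' := fun ha hb => ⟨by rw [map_add, ha.1, hb.1, add_zero],
        fun l x => by rw [map_add, ha.2, hb.2, add_zero]⟩
      zero_mem' := ⟨map_zero _, fun l x => map_zero _⟩
      smul_mem' := fun c a ha => ⟨by rw [map_smul, ha.1, smul_zero],
        fun l x => by rw [map_smul, ha.2, smul_zero]⟩ }
  -- The bracket relations of currents are available for homogeneous elements only, so the kernel
  -- conditions are tested there.
  have hom : ∀ w, (∀ l (a : ZMod 2), ∀ x ∈ G.gr a, Y l x w = 0) → ∀ l x, Y l x w = 0 := by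
    intro w h l x
    obtain ⟨y, hy, z, hz, rfl⟩ := G.exists_add x
    rw [hYadd, LinearMap.add_apply, h l 0 y hy, h l 1 z hz, add_zero]
  have hvZ : v ∈ Z := ⟨hv _ (Or.inl rfl),
    hom v fun l a x hx => hv _ (Or.inr ⟨l, a, x, hx, rfl⟩)⟩
  -- Bracketing `C` or `Y l x` with any generator stays in the top layer, which is thus an ideal;
  -- its common kernel is therefore stable.
  have hZ : J.IsSubmodule Z := by
    refine ⟨?_, ?_, ?_, ?_⟩
    · rintro w ⟨h1, h2⟩
      obtain ⟨a, ha, b, hb, rfl⟩ := J.exists_add w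
      have hCab := J.eq_zero_of_add_eq_zero (i := 0) (J.LP_mem _ ha) (J.LP_mem _ hb)
        ((map_add _ _ _).symm.trans h1)
      have hYab : ∀ l (i : ZMod 2), ∀ x ∈ G.gr i, Y l x a = 0 ∧ Y l x b = 0 := by
        intro l i x hx
        have e1 := J.XP_mem l (sT ^ (k + 1)) hx ha
        rw [add_zero] at e1
        exact J.eq_zero_of_add_eq_zero (i := i) e1 (J.XP_mem l (sT ^ (k + 1)) hx hb)
          ((map_add _ _ _).symm.trans (h2 l x))
      exact Submodule.mem_sup.2
        ⟨a, ⟨⟨hCab.1, hom a fun l i x hx => (hYab l i x hx).1⟩, ha⟩, b,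
          ⟨⟨hCab.2, hom b fun l i x hx => (hYab l i x hx).2⟩, hb⟩, rfl⟩
    · rintro j w ⟨h1, h2⟩
      refine ⟨?_, fun l x => ?_⟩
      · have := LinearMap.congr_fun (J.LP_r (sT ^ (k + 2)) j) w
        exact this.trans ((congrArg (J.r j) h1).trans (map_zero _))
      · have := LinearMap.congr_fun (J.XP_r l (sT ^ (k + 1)) x j) w
        exact this.trans ((congrArg (J.r _) (h2 l x)).trans (map_zero _))
    · rintro i w ⟨h1, h2⟩
      refine ⟨?_, fun l x => ?_⟩
      · obtain ⟨c, hc⟩ := hLC i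
        have := LinearMap.congr_fun hc w
        simp only [LinearMap.sub_apply, Module.End.mul_apply, LinearMap.smul_apply, h1, map_zero,
          smul_zero, zero_sub, neg_eq_zero] at this
        exact this
      · obtain ⟨c, c', hc⟩ := hLY i l x
        have := LinearMap.congr_fun hc w
        simp only [LinearMap.sub_apply, LinearMap.add_apply, Module.End.mul_apply,
          LinearMap.smul_apply, h2, map_zero, smul_zero, zero_sub, neg_eq_zero, add_zero] at this
        exact this
    · rintro m y w ⟨h1, h2⟩
      refine ⟨?_, ?_⟩
      · have := LinearMap.congr_fun (hCX m y) w
        simp only [LinearMap.sub_apply, Module.End.mul_apply, LinearMap.smul_apply, h1, h2,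
          map_zero, smul_zero, sub_zero] at this
        exact this
      · refine hom _ fun l a x hx => ?_
        have key : ∀ b, ∀ y ∈ G.gr b, Y l x (J.X m y w) = 0 := by
          intro b y hy
          have := LinearMap.congr_fun (hYX hx hy l m) w
          simp only [LinearMap.sub_apply, Module.End.mul_apply, LinearMap.smul_apply, h2,
            map_zero, smul_zero, sub_zero] at this
          exact this
        obtain ⟨y, hy, z, hz, rfl⟩ := G.exists_add y
        rw [map_add, LinearMap.add_apply, map_add, key 0 y hy, key 1 z hz, add_zero]
  have htop : Z = ⊤ := (hs Z hZ).resolve_left fun h => hv0 ((Submodule.mem_bot ℂ).1 (h ▸ hvZ))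
  have hmem : ∀ w, w ∈ Z := fun w => htop ▸ Submodule.mem_top
  refine ⟨fun p => ?_, fun l p x => ?_⟩
  · rw [f1, show C = 0 from LinearMap.ext fun w => (hmem w).1, smul_zero]
  · rw [f2, show Y l x = 0 from LinearMap.ext fun w => (hmem w).2 l x, smul_zero]

/-- On a simple finite-dimensional fibre, `L i` is linear in `i` and `X l` depends only on `l`
modulo `n`. -/
theorem IsSimple.rigid [FiniteDimensional ℂ V] [FiniteDimensional ℂ g] [Nontrivial V]
    (hd : ¬ Module.End.HasEigenvalue D.d 1) (hs : J.IsSimple) :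
    (∀ i : ℤ, J.L i = (i : ℂ) • J.L 1) ∧ ∀ i l : ℤ, J.X (D.n * i + l) = J.X l := by
  have main : (∀ p, J.LP (sT ^ 2 * p) = 0) ∧ ∀ l p x, J.XP l (sT ^ 1 * p) x = 0 := by
    obtain ⟨R, hR⟩ := J.exists_forall_LP_eq_zero
    have hR' := J.XP_eq_zero_of_LP_eq_zero hd hR
    have h : ∀ k : ℕ, (∀ p, J.LP (sT ^ (k + 2) * p) = 0) →
        (∀ l p x, J.XP l (sT ^ (k + 1) * p) x = 0) →
        (∀ p, J.LP (sT ^ 2 * p) = 0) ∧ ∀ l p x, J.XP l (sT ^ 1 * p) x = 0 := by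
      intro k
      induction k with
      | zero => exact fun h1 h2 => ⟨h1, h2⟩
      | succ k ih =>
        intro h1 h2
        obtain ⟨h3, h4⟩ := hs.descend J h1 h2
        exact ih h3 h4
    -- The descent expects fields to vanish one order later than currents, so one order is given
    -- away for the fields.
    refine h R (fun p => ?_) hR'
    rw [pow_succ _ (R + 1), mul_assoc, hR]
  obtain ⟨hL, hX⟩ := main
  constructor
  · have h1 : J.LP (sT * 1) = J.L 1 := by
      rw [mul_one, sT, ← T_zero, map_sub, LP_T, LP_T, J.L_zero, sub_zero]
    -- The difference is the operator of `sT * T i`, which depends only on the value of `T i` at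
    -- `1`.
    have step : ∀ i : ℤ, J.L (i + 1) - J.L i = J.L 1 := by
      intro i
      have := apply_eq_evalOne_smul (J.LP ∘ₗ LinearMap.mulLeft ℂ sT) (fun p => by
        simp only [LinearMap.comp_apply, LinearMap.mulLeft_apply]
        rw [← mul_assoc, ← pow_two, hL]) (T i)
      simp only [LinearMap.comp_apply, LinearMap.mulLeft_apply, h1, evalOne_T, one_smul] at this
      rw [← this, sT, sub_mul, one_mul, ← T_add, map_sub, LP_T, LP_T, add_comm]
    intro i
    induction i with
    | zero => rw [J.L_zero, Int.cast_zero, zero_smul]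
    | succ i ih =>
      rw [← sub_add_cancel (J.L (i + 1)) (J.L i), step, ih]
      push_cast
      module
    | pred i ih =>
      have := step (-i - 1)
      rw [sub_add_cancel, ih] at this
      rw [← sub_eq_zero]
      push_cast at this ⊢
      linear_combination (norm := module) -this
  · intro i l
    obtain ⟨q, hq⟩ := exists_T_sub_one_eq i
    ext1 x
    rw [← sub_eq_zero, ← XP_T, ← XP_one, ← LinearMap.sub_apply, ← map_sub, hq, ← pow_one sT, hX]

end TwistDatum.FiberModule
-- Eigenspace projections of `σ` and generators of `𝔏 ⋉ A`
theorem Superspace.eq_of_add_eq_add {V : Type*} [AddCommGroup V] [Module ℂ V] (S : Superspace V)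
    {a b a' b' : V} (ha : a ∈ S.gr 0) (hb : b ∈ S.gr 1) (ha' : a' ∈ S.gr 0) (hb' : b' ∈ S.gr 1)
    (h : a + b = a' + b') : a = a' ∧ b = b' := by
  have h' : (a - a') + (b - b') = 0 := by rw [sub_add_sub_comm, h, sub_self]
  have := S.eq_zero_of_add_eq_zero (i := 0) (sub_mem ha ha') (sub_mem hb hb') h'
  exact ⟨sub_eq_zero.1 this.1, sub_eq_zero.1 this.2⟩

namespace TwistDatum

variable {g : Type*} [AddCommGroup g] [Module ℂ g] {G : LieSuperalgebra g} (D : TwistDatum G)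

theorem isPrimitiveRoot_omega : IsPrimitiveRoot D.omega D.n := by
  have h := Complex.isPrimitiveRoot_exp D.n D.n_pos.ne'
  exact h

theorem sum_omega_zpow (k : ℤ) : ∑ j ∈ Finset.range D.n, D.omega ^ (k * j) =
    if (D.n : ℤ) ∣ k then (D.n : ℂ) else 0 := by
  have hj : ∀ j : ℕ, D.omega ^ (k * j) = (D.omega ^ k) ^ j := fun j => by
    rw [zpow_mul, zpow_natCast]
  simp only [hj]
  split_ifs with h
  · rw [(D.isPrimitiveRoot_omega.zpow_eq_one_iff_dvd k).2 h]
    simp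
  · have h1 : D.omega ^ k ≠ 1 := fun h' => h ((D.isPrimitiveRoot_omega.zpow_eq_one_iff_dvd k).1 h')
    have h2 : (D.omega ^ k) ^ D.n = 1 := by
      rw [← zpow_natCast, ← zpow_mul, mul_comm, zpow_mul, D.omega_pow, one_zpow]
    rw [geom_sum_eq h1, h2, sub_self, zero_div]

theorem proj_apply (k : ℤ) (x : g) : D.proj k x =
    (D.n : ℂ)⁻¹ • ∑ j ∈ Finset.range D.n, D.omega ^ (-(k * j)) • ((D.σ : g →ₗ[ℂ] g) ^ j) x := by
  simp [proj]

theorem σ_pow_n : (D.σ : g →ₗ[ℂ] g) ^ D.n = 1 := by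
  have h : D.σ ^ D.n = 1 := D.order_σ ▸ pow_orderOf_eq_one D.σ
  have hp : ∀ j : ℕ, (D.σ : g →ₗ[ℂ] g) ^ j = ((D.σ ^ j : g ≃ₗ[ℂ] g) : g →ₗ[ℂ] g) := by
    intro j
    induction j with
    | zero => rfl
    | succ j ih => rw [pow_succ, pow_succ, ih]; rfl
  rw [hp, h]
  rfl

theorem proj_mem (k : ℤ) (x : g) : D.proj k x ∈ D.comp k := by
  change D.σ _ = _
  rw [proj_apply, map_smul, map_sum, smul_comm]
  congr 1
  set f : ℕ → g := fun j => D.omega ^ (-(k * j)) • ((D.σ : g →ₗ[ℂ] g) ^ j) x with hf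
  -- The summands are `n`-periodic, and `σ` takes each to `ω_n^k` times the next; so `σ` shifts the
  -- sum cyclically.
  have h0 : f D.n = f 0 := by
    simp only [hf, D.σ_pow_n, pow_zero, Nat.cast_zero, mul_zero, neg_zero, zpow_zero]
    rw [show -(k * (D.n : ℤ)) = D.n * (-k) by ring, zpow_mul, D.omega_pow, one_zpow]
  have h1 : ∑ j ∈ Finset.range D.n, f (j + 1) = ∑ j ∈ Finset.range D.n, f j := by
    have h2 := Finset.sum_range_succ f D.n
    rw [Finset.sum_range_succ', h0] at h2
    exact add_right_cancel h2
  have h3 : ∀ j : ℕ, D.σ (f j) = D.omega ^ k • f (j + 1) := by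
    intro j
    simp only [hf, map_smul, smul_smul, pow_succ', Module.End.mul_apply]
    rw [← zpow_add₀ D.omega_ne_zero, show k + -(k * ((j + 1 : ℕ) : ℤ)) = -(k * j) by push_cast; ring]
    rfl
  calc ∑ j ∈ Finset.range D.n, D.σ (f j) = D.omega ^ k • ∑ j ∈ Finset.range D.n, f (j + 1) := by
        rw [Finset.smul_sum]; exact Finset.sum_congr rfl fun j _ => h3 j
    _ = _ := by rw [h1, Finset.smul_sum]

theorem proj_of_mem {m : ℤ} {x : g} (hx : x ∈ D.comp m) (k : ℤ) :
    D.proj k x = if (D.n : ℤ) ∣ m - k then x else 0 := by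
  have hp : ∀ j : ℕ, ((D.σ : g →ₗ[ℂ] g) ^ j) x = D.omega ^ (m * j) • x := by
    intro j
    induction j with
    | zero => simp
    | succ j ih =>
      rw [pow_succ', Module.End.mul_apply, ih, map_smul]
      change _ • D.σ x = _
      rw [show D.σ x = D.omega ^ m • x from hx, smul_smul, ← zpow_add₀ D.omega_ne_zero]
      push_cast
      ring_nf
  rw [proj_apply]
  simp only [hp, smul_smul, ← zpow_add₀ D.omega_ne_zero]
  rw [← Finset.sum_smul]
  have : ∀ j : ℕ, -(k * j) + m * j = (m - k) * (j : ℤ) := fun j => by ring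
  simp only [this, D.sum_omega_zpow, smul_smul]
  split_ifs
  · rw [inv_mul_cancel₀ D.n_ne_zero, one_smul]
  · rw [mul_zero, zero_smul]

theorem proj_self {k : ℤ} {x : g} (hx : x ∈ D.comp k) : D.proj k x = x := by
  rw [D.proj_of_mem hx, sub_self, if_pos (dvd_zero _)]

/-- After exchanging the sums, orthogonality of the characters of `ℤ_n` leaves only the term with `σ
^ 0`. -/
theorem sum_proj (x : g) : ∑ k ∈ Finset.range D.n, D.proj (k : ℤ) x = x := by
  simp only [proj_apply]
  rw [← Finset.smul_sum, Finset.sum_comm]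
  simp only [← Finset.sum_smul]
  have h : ∀ j ∈ Finset.range D.n, ∑ k ∈ Finset.range D.n, D.omega ^ (-((k : ℤ) * j)) =
      if j = 0 then (D.n : ℂ) else 0 := by
    intro j hj
    have := D.sum_omega_zpow (-(j : ℤ))
    rw [Finset.sum_congr rfl fun k _ => by rw [show -((k : ℤ) * j) = -(j : ℤ) * k by ring], this]
    refine if_congr ?_ rfl rfl
    rw [dvd_neg, Int.natCast_dvd_natCast]
    exact ⟨fun h => Nat.eq_zero_of_dvd_of_lt h (Finset.mem_range.1 hj), fun h => h ▸ dvd_zero _⟩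
  rw [Finset.sum_congr rfl fun j hj => by rw [h j hj]]
  simp only [ite_smul, zero_smul, Finset.sum_ite_eq', Finset.mem_range, D.n_pos, if_true, pow_zero,
    Module.End.one_apply]
  rw [smul_smul, inv_mul_cancel₀ D.n_ne_zero, one_smul]

theorem proj_gr (k : ℤ) {i : ZMod 2} {x : g} (hx : x ∈ G.gr i) : D.proj k x ∈ G.gr i := by
  rw [proj_apply]
  refine Submodule.smul_mem _ _ (sum_mem fun j _ => Submodule.smul_mem _ _ ?_)
  clear * - hx
  induction j with
  | zero => exact hx
  | succ j ih =>
    rw [pow_succ', Module.End.mul_apply]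
    exact D.σ_mem ih

theorem proj_d (k : ℤ) (x : g) : D.proj k (D.d x) = D.d (D.proj k x) := by
  have hp : ∀ j : ℕ, ((D.σ : g →ₗ[ℂ] g) ^ j) (D.d x) = D.d (((D.σ : g →ₗ[ℂ] g) ^ j) x) := by
    intro j
    induction j with
    | zero => rfl
    | succ j ih =>
      rw [pow_succ', Module.End.mul_apply, Module.End.mul_apply, ih]
      exact D.σ_d _
  simp only [proj_apply, map_smul, map_sum, hp]

/-- The element `x_{[l]} t^{l/n}` of `𝔏 ⋉ A`, where `x_{[l]}` is the component of `x` in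
`g_{[l]}`. -/
def gel (l : ℤ) : g →ₗ[ℂ] D.tildeSpace where
  toFun x := ⟨(0, Finsupp.single l (D.proj l x), 0),
    D.mem_tildeSpace.2 (single_mem_coeffIn (D.proj_mem l x))⟩
  map_add' x y := Subtype.ext (by simp)
  map_smul' c x := Subtype.ext (by simp)

theorem gel_proj (l : ℤ) (x : g) : D.gel l (D.proj l x) = D.gel l x :=
  Subtype.ext (by
    change (_, Finsupp.single l (D.proj l (D.proj l x)), _) = _
    rw [D.proj_self (D.proj_mem l x)]
    rfl)

theorem ell_mem (i : ℤ) : D.ell i ∈ D.tilde.gr 0 := ⟨trivial, zero_mem _, trivial⟩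

theorem tpow_mem (i : ℤ) : D.tpow i ∈ D.tilde.gr 0 := ⟨trivial, zero_mem _, trivial⟩

theorem gel_mem (l : ℤ) {i : ZMod 2} {x : g} (hx : x ∈ G.gr i) : D.gel l x ∈ D.tilde.gr i :=
  D.mem_tilde_gr.2 ⟨zero_mem _, single_mem_coeffIn (P := fun _ => G.gr i) (D.proj_gr l hx),
    zero_mem _⟩

theorem br_ell_ell (i j : ℤ) :
    D.tilde.br (D.ell i) (D.ell j) = ((j : ℂ) - i) • D.ell (i + j) := by
  refine Subtype.ext ?_
  change D.fullBr (Finsupp.single i 1, 0, 0) (Finsupp.single j 1, 0, 0) =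
    ((j : ℂ) - i) • (Finsupp.single (i + j) 1, 0, 0)
  simp [fullBr_apply, brWW]

theorem br_ell_tpow (i j : ℤ) :
    D.tilde.br (D.ell i) (D.tpow j) = (j : ℂ) • D.tpow (i + j) := by
  refine Subtype.ext ?_
  change D.fullBr (Finsupp.single i 1, 0, 0) (0, 0, Finsupp.single j 1) =
    (j : ℂ) • (0, 0, Finsupp.single (i + j) 1)
  simp [fullBr_apply, brWA]

theorem br_gel_tpow (l j : ℤ) (x : g) : D.tilde.br (D.gel l x) (D.tpow j) = 0 := by
  refine Subtype.ext ?_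
  change D.fullBr (0, Finsupp.single l (D.proj l x), 0) (0, 0, Finsupp.single j 1) = 0
  simp [fullBr_apply]

theorem br_ell_gel (i l : ℤ) (x : g) : D.tilde.br (D.ell i) (D.gel l x) =
    ((l : ℂ) / D.n) • D.gel (D.n * i + l) x + (i : ℂ) • D.gel (D.n * i + l) (D.d x) := by
  refine Subtype.ext ?_
  change D.fullBr (Finsupp.single i 1, 0, 0) (0, Finsupp.single l (D.proj l x), 0) =
    ((l : ℂ) / D.n) • (0, Finsupp.single (D.n * i + l) (D.proj (D.n * i + l) x), 0) +
      (i : ℂ) • (0, Finsupp.single (D.n * i + l) (D.proj (D.n * i + l) (D.d x)), 0)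
  rw [FiberModule.proj_add_mul, proj_d]
  simp [fullBr_apply, brWL]

theorem br_gel_gel (l m : ℤ) (x y : g) : D.tilde.br (D.gel l x) (D.gel m y) =
    D.gel (l + m) (G.br (D.proj l x) (D.proj m y)) := by
  refine Subtype.ext ?_
  change D.fullBr (0, Finsupp.single l (D.proj l x), 0) (0, Finsupp.single m (D.proj m y), 0) =
    (0, Finsupp.single (l + m) (D.proj (l + m) (G.br (D.proj l x) (D.proj m y))), 0)
  rw [D.proj_self (D.br_mem_comp (D.proj_mem l x) (D.proj_mem m y))]
  simp [fullBr_apply, brLL]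

/-- Reduces statements linear in the element to the three families `ℓ_i`, `x t^{l/n}`, `t^i`. -/
theorem tilde_induction {p : D.tildeSpace → Prop} (hadd : ∀ x y, p x → p y → p (x + y))
    (hsmul : ∀ (c : ℂ) x, p x → p (c • x)) (hell : ∀ i, p (D.ell i))
    (hgel : ∀ l x, p (D.gel l x)) (htpow : ∀ i, p (D.tpow i)) (z : D.tildeSpace) : p z := by
  have h0 : p 0 := by simpa using hsmul 0 _ (hell 0)
  obtain ⟨⟨w, f, q⟩, hz⟩ := z
  have hf : f ∈ coeffIn D.comp := D.mem_tildeSpace.1 hz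
  -- The membership proof is kept existential so that it can be rebuilt along the induction on the
  -- coordinate.
  have h1 : ∃ h, p ⟨(w, 0, 0), h⟩ := by
    induction w using Finsupp.induction_linear with
    | zero => exact ⟨zero_mem _, h0⟩
    | add a b ha hb =>
      obtain ⟨h1, h2⟩ := ha ⟨trivial, hf, trivial⟩
      obtain ⟨h3, h4⟩ := hb ⟨trivial, hf, trivial⟩
      exact ⟨⟨trivial, zero_mem _, trivial⟩, by simpa using hadd _ _ h2 h4⟩
    | single i c =>
      refine ⟨⟨trivial, zero_mem _, trivial⟩, ?_⟩
      have := hsmul c _ (hell i)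
      rwa [show c • D.ell i = ⟨(Finsupp.single i c, 0, 0), trivial, zero_mem _, trivial⟩ from
        Subtype.ext (by change c • (_, _, _) = _; simp)] at this
  have h2 : ∃ h, p ⟨(0, f, 0), h⟩ := by
    refine coeffIn_induction (p := fun f => ∃ h, p ⟨(0, f, 0), h⟩) ?_ ?_ ?_ hf
    · exact ⟨zero_mem _, h0⟩
    · rintro a b ⟨h1, h2⟩ ⟨h3, h4⟩
      exact ⟨⟨trivial, add_mem h1.2.1 h3.2.1, trivial⟩, by simpa using hadd _ _ h2 h4⟩
    · intro k x hx
      refine ⟨D.mem_tildeSpace.2 (single_mem_coeffIn hx), ?_⟩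
      have := hgel k x
      simpa [gel, D.proj_self hx] using this
  have h3 : ∃ h, p ⟨(0, 0, q), h⟩ := by
    induction q using Finsupp.induction_linear with
    | zero => exact ⟨zero_mem _, h0⟩
    | add a b ha hb =>
      obtain ⟨h1, h2⟩ := ha ⟨trivial, hf, trivial⟩
      obtain ⟨h3, h4⟩ := hb ⟨trivial, hf, trivial⟩
      exact ⟨⟨trivial, zero_mem _, trivial⟩, by simpa using hadd _ _ h2 h4⟩
    | single i c =>
      refine ⟨⟨trivial, zero_mem _, trivial⟩, ?_⟩
      have := hsmul c _ (htpow i)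
      rwa [show c • D.tpow i = ⟨(0, 0, Finsupp.single i c), trivial, zero_mem _, trivial⟩ from
        Subtype.ext (by change c • (_, _, _) = _; simp)] at this
  obtain ⟨h1, h1'⟩ := h1
  obtain ⟨h2, h2'⟩ := h2
  obtain ⟨h3, h3'⟩ := h3
  simpa using hadd _ _ (hadd _ _ h1' h2') h3'

end TwistDatum

/-! ### Weight spaces and the action of the generators -/

namespace SuperModule

variable {g : Type*} [AddCommGroup g] [Module ℂ g] {G : LieSuperalgebra g} {D : TwistDatum G}
variable {M : Type*} [AddCommGroup M] [Module ℂ M] (X : SuperModule D.tilde M)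

theorem act_ell_ell (i j : ℤ) (m : M) : X.act (D.ell i) (X.act (D.ell j) m) =
    X.act (D.ell j) (X.act (D.ell i) m) + ((j : ℂ) - i) • X.act (D.ell (i + j)) m := by
  have h := X.act_br (D.ell_mem i) (D.ell_mem j) m
  rw [D.br_ell_ell, map_smul, LinearMap.smul_apply, koszul_zero_left, one_smul] at h
  rw [h, add_sub_cancel]

theorem act_ell_tpow (i j : ℤ) (m : M) : X.act (D.ell i) (X.act (D.tpow j) m) =
    X.act (D.tpow j) (X.act (D.ell i) m) + (j : ℂ) • X.act (D.tpow (i + j)) m := by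
  have h := X.act_br (D.ell_mem i) (D.tpow_mem j) m
  rw [D.br_ell_tpow, map_smul, LinearMap.smul_apply, koszul_zero_left, one_smul] at h
  rw [h, add_sub_cancel]

theorem act_ell_gel (i l : ℤ) (x : g) (m : M) : X.act (D.ell i) (X.act (D.gel l x) m) =
    X.act (D.gel l x) (X.act (D.ell i) m) + ((l : ℂ) / D.n) • X.act (D.gel (D.n * i + l) x) m +
      (i : ℂ) • X.act (D.gel (D.n * i + l) (D.d x)) m := by
  have key : ∀ (a : ZMod 2), ∀ y ∈ G.gr a, X.act (D.ell i) (X.act (D.gel l y) m) =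
    X.act (D.gel l y) (X.act (D.ell i) m) + (((l : ℂ) / D.n) • X.act (D.gel (D.n * i + l) y) m +
      (i : ℂ) • X.act (D.gel (D.n * i + l) (D.d y)) m) := by
    intro a y hy
    have h := X.act_br (D.ell_mem i) (D.gel_mem l hy) m
    rw [D.br_ell_gel, koszul_zero_left, one_smul, map_add, map_smul, map_smul, LinearMap.add_apply,
      LinearMap.smul_apply, LinearMap.smul_apply] at h
    rw [h, add_sub_cancel]
  obtain ⟨y, hy, z, hz, rfl⟩ := G.exists_add x
  simp only [map_add, LinearMap.add_apply, key 0 y hy, key 1 z hz]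
  module

theorem act_gel_tpow (l j : ℤ) (x : g) (m : M) : X.act (D.gel l x) (X.act (D.tpow j) m) =
    X.act (D.tpow j) (X.act (D.gel l x) m) := by
  have key : ∀ (a : ZMod 2), ∀ y ∈ G.gr a, X.act (D.gel l y) (X.act (D.tpow j) m) =
      X.act (D.tpow j) (X.act (D.gel l y) m) := by
    intro a y hy
    have h := X.act_br (D.gel_mem l hy) (D.tpow_mem j) m
    rw [D.br_gel_tpow, koszul_zero_right, one_smul, map_zero, LinearMap.zero_apply] at h
    exact sub_eq_zero.1 h.symm
  obtain ⟨y, hy, z, hz, rfl⟩ := G.exists_add x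
  simp only [map_add, LinearMap.add_apply, key 0 y hy, key 1 z hz]

theorem act_gel_gel (l k : ℤ) {a b : ZMod 2} {x y : g} (hx : x ∈ G.gr a) (hy : y ∈ G.gr b)
    (m : M) : X.act (D.gel l x) (X.act (D.gel k y) m) -
      koszul a b • X.act (D.gel k y) (X.act (D.gel l x) m) =
      X.act (D.gel (l + k) (G.br (D.proj l x) (D.proj k y))) m := by
  rw [← D.br_gel_gel, X.act_br (D.gel_mem l hx) (D.gel_mem k hy)]

variable {X}

theorem mem_weightSpace {μ : ℂ} {m : M} : m ∈ X.weightSpace μ ↔ X.act (D.ell 0) m = μ • m :=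
  Module.End.mem_eigenspace_iff

theorem act_ell_mem {μ : ℂ} {m : M} (hm : m ∈ X.weightSpace μ) (i : ℤ) :
    X.act (D.ell i) m ∈ X.weightSpace (μ + i) := by
  rw [mem_weightSpace] at *
  rw [X.act_ell_ell, hm, map_smul, zero_add, Int.cast_zero]
  module

theorem act_tpow_mem {μ : ℂ} {m : M} (hm : m ∈ X.weightSpace μ) (i : ℤ) :
    X.act (D.tpow i) m ∈ X.weightSpace (μ + i) := by
  rw [mem_weightSpace] at *
  rw [X.act_ell_tpow, hm, map_smul, zero_add]
  module

theorem act_gel_mem {μ : ℂ} {m : M} (hm : m ∈ X.weightSpace μ) (l : ℤ) (x : g) :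
    X.act (D.gel l x) m ∈ X.weightSpace (μ + l / D.n) := by
  rw [mem_weightSpace] at *
  rw [X.act_ell_gel, hm, map_smul, mul_zero, zero_add, Int.cast_zero]
  module

/-- As `ℓ_0` is even, the homogeneous components of an eigenvector are eigenvectors. -/
theorem weightSpace_isGraded (μ : ℂ) : X.IsGraded (X.weightSpace μ) := by
  intro m hm
  obtain ⟨a, ha, b, hb, rfl⟩ := X.exists_add m
  rw [mem_weightSpace, map_add, smul_add] at hm
  have h0 : ∀ {i : ZMod 2} {v : M}, v ∈ X.gr i → X.act (D.ell 0) v ∈ X.gr i := by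
    intro i v hv
    have := X.act_mem (D.ell_mem 0) hv
    rwa [zero_add] at this
  obtain ⟨h1, h2⟩ := X.eq_of_add_eq_add (h0 ha) (h0 hb) (Submodule.smul_mem _ _ ha)
    (Submodule.smul_mem _ _ hb) hm
  exact Submodule.mem_sup.2 ⟨a, ⟨mem_weightSpace.2 h1, ha⟩, b, ⟨mem_weightSpace.2 h2, hb⟩, rfl⟩

/-- A subspace stable under the elements `ℓ_i`, `x t^{l/n}`, `t^i` is stable under `𝔏 ⋉ A`. -/
theorem act_mem_of_generators {P : Submodule ℂ M} (h1 : ∀ i, ∀ m ∈ P, X.act (D.ell i) m ∈ P)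
    (h2 : ∀ l x, ∀ m ∈ P, X.act (D.gel l x) m ∈ P) (h3 : ∀ i, ∀ m ∈ P, X.act (D.tpow i) m ∈ P)
    (z : D.tildeSpace) : ∀ m ∈ P, X.act z m ∈ P := by
  induction z using D.tilde_induction with
  | hadd x y hx hy =>
    intro m hm
    rw [map_add]
    exact add_mem (hx m hm) (hy m hm)
  | hsmul c x hx =>
    intro m hm
    rw [map_smul]
    exact Submodule.smul_mem _ _ (hx m hm)
  | hell i => exact h1 i
  | hgel l x => exact h2 l x
  | htpow i => exact h3 i

theorem iSup_isGraded {ι : Type*} (S : Superspace M) (P : ι → Submodule ℂ M)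
    (h : ∀ i, S.IsGraded (P i)) : S.IsGraded (⨆ i, P i) :=
  iSup_le fun i => (h i).trans (sup_le_sup (inf_le_inf_right _ (le_iSup P i))
    (inf_le_inf_right _ (le_iSup P i)))

/-- Every generator shifts weights by a multiple of `1/n`, so one coset of `(1/n)ℤ` is never left.
For simple `X` a single coset therefore carries the whole module. -/
theorem iSup_weightSpace_isSubmodule (lam : ℂ) :
    X.IsSubmodule (⨆ k : ℤ, X.weightSpace (lam + k / D.n)) := by
  have hn := D.n_ne_zero
  have key : ∀ (f : M →ₗ[ℂ] M) (s : ℤ), (∀ μ, ∀ m ∈ X.weightSpace μ,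
      f m ∈ X.weightSpace (μ + s / D.n)) → ∀ m ∈ ⨆ k : ℤ, X.weightSpace (lam + k / D.n),
      f m ∈ ⨆ k : ℤ, X.weightSpace (lam + k / D.n) := by
    intro f s hf m hm
    have hle : (⨆ k : ℤ, X.weightSpace (lam + k / D.n)) ≤
        (⨆ k : ℤ, X.weightSpace (lam + k / D.n)).comap f := by
      refine iSup_le fun k m hm => ?_
      refine Submodule.mem_iSup_of_mem (k + s) ?_
      rw [Int.cast_add, add_div, ← add_assoc]
      exact hf _ m hm
    exact hle hm
  have hs : ∀ i : ℤ, ((D.n * i : ℤ) : ℂ) / D.n = i := fun i => by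
    rw [Int.cast_mul, Int.cast_natCast, mul_div_cancel_left₀ _ hn]
  refine ⟨iSup_isGraded _ _ fun k => weightSpace_isGraded _, act_mem_of_generators ?_ ?_ ?_⟩
  · exact fun i => key _ (D.n * i) fun μ m hm => by rw [hs]; exact act_ell_mem hm i
  · exact fun l x => key _ l fun μ m hm => act_gel_mem hm l x
  · exact fun i => key _ (D.n * i) fun μ m hm => by rw [hs]; exact act_tpow_mem hm i

theorem exists_iSup_weightSpace_eq_top (hs : X.IsSimple) (hc : X.IsCuspidal) :
    ∃ lam : ℂ, (⨆ k : ℤ, X.weightSpace (lam + k / D.n)) = ⊤ := by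
  have := hs.1
  obtain ⟨lam, hlam⟩ : ∃ lam, X.weightSpace lam ≠ ⊥ := by
    by_contra! h
    have := hc.1
    simp only [h, iSup_bot] at this
    exact bot_ne_top this
  refine ⟨lam, (hs.2 _ (iSup_weightSpace_isSubmodule lam)).resolve_left fun h => hlam ?_⟩
  have h1 := le_iSup (fun k : ℤ => X.weightSpace (lam + k / D.n)) 0
  simp only [Int.cast_zero, zero_div, add_zero] at h1
  exact eq_bot_iff.2 (h1.trans h.le)

end SuperModule
-- The fibre realized by `t`-invariant sections
namespace SuperModule

variable {g : Type*} [AddCommGroup g] [Module ℂ g] {G : LieSuperalgebra g} {D : TwistDatum G}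
variable {M : Type*} [AddCommGroup M] [Module ℂ M] (X : SuperModule D.tilde M) (lam : ℂ)

/-- The space of `t`-invariant sections: families `v_k ∈ M_{λ + k/n}`, `k ∈ ℤ`, with
`t v_k = v_{k+n}`. -/
def secSpace : Submodule ℂ (ℤ → M) where
  carrier := {v | ∀ k : ℤ, v k ∈ X.weightSpace (lam + k / D.n) ∧
    X.act (D.tpow 1) (v k) = v (k + D.n)}
  add_mem' ha hb k := ⟨add_mem (ha k).1 (hb k).1, by
    rw [Pi.add_apply, map_add, (ha k).2, (hb k).2, Pi.add_apply]⟩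
  zero_mem' k := ⟨zero_mem _, map_zero _⟩
  smul_mem' c a ha k := ⟨Submodule.smul_mem _ _ (ha k).1, by
    rw [Pi.smul_apply, map_smul, (ha k).2, Pi.smul_apply]⟩

variable {X lam}

/-- The definition constrains `t` only; associativity makes `t^{-1}` its inverse and so gives all
powers. -/
theorem tpow_sec (hA : X.IsALModule) {v : ℤ → M} (hv : v ∈ X.secSpace lam) (i k : ℤ) :
    X.act (D.tpow i) (v k) = v (k + D.n * i) := by
  induction i generalizing k with
  | zero => rw [hA.2, mul_zero, add_zero]
  | succ i ih =>
    rw [← hA.1, (hv k).2, ih]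
    congr 1
    ring
  | pred i ih =>
    have h := (hv (k - D.n)).2
    rw [sub_add_cancel] at h
    rw [← h, hA.1, sub_add_cancel, ih]
    congr 1
    ring

theorem cast_sub_mul_div (D : TwistDatum G) (k i : ℤ) :
    ((k - D.n * i : ℤ) : ℂ) / D.n = (k : ℂ) / D.n - i := by
  rw [Int.cast_sub, sub_div, Int.cast_mul, Int.cast_natCast, mul_div_cancel_left₀ _ D.n_ne_zero]

/-- The operator `t^{-i} ℓ_i - ℓ_0` on sections. -/
def secL (hA : X.IsALModule) (lam : ℂ) (i : ℤ) : Module.End ℂ (X.secSpace lam) where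
  -- The entry at `k - n i` is `t^{-i} v_k`. Moving `t^{-i}` to the left of `ℓ_i` costs `-i`, which
  -- is why the scalar is the weight at `k - n i` and not at `k`.
  toFun v := ⟨fun k => X.act (D.ell i) (v.1 (k - D.n * i)) -
    (lam + ((k - D.n * i : ℤ) : ℂ) / D.n) • v.1 k, fun k => by
      refine ⟨sub_mem ?_ (Submodule.smul_mem _ _ (v.2 k).1), ?_⟩
      · have h := act_ell_mem (v.2 (k - D.n * i)).1 i
        rwa [cast_sub_mul_div, add_assoc, sub_add_cancel] at h
      · have h := X.act_ell_tpow i 1 (v.1 (k - D.n * i))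
        rw [(v.2 _).2, tpow_sec hA v.2, Int.cast_one, one_smul,
          show k - D.n * i + D.n * (i + 1) = k + D.n by ring] at h
        rw [map_sub, map_smul, (v.2 k).2]
        beta_reduce
        rw [show k + D.n - D.n * i = k - D.n * i + D.n by ring, h,
          Int.cast_add, Int.cast_natCast, add_div, div_self D.n_ne_zero]
        module⟩
  map_add' v w := Subtype.ext (funext fun k => by
    simp only [Submodule.coe_add, Pi.add_apply, map_add]
    module)
  map_smul' c v := Subtype.ext (funext fun k => by
    simp only [Submodule.coe_smul, Pi.smul_apply, map_smul, RingHom.id_apply]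
    module)

/-- The operator of `x t^{l/n}` on sections. -/
def secX (X : SuperModule D.tilde M) (lam : ℂ) (l : ℤ) : g →ₗ[ℂ] Module.End ℂ (X.secSpace lam) :=
  LinearMap.mk₂ ℂ (fun x v => ⟨fun k => X.act (D.gel l x) (v.1 (k - l)), fun k => by
      refine ⟨?_, ?_⟩
      · have h := act_gel_mem (v.2 (k - l)).1 l x
        rwa [Int.cast_sub, sub_div, add_assoc, sub_add_cancel] at h
      · rw [← X.act_gel_tpow, (v.2 _).2]
        beta_reduce
        rw [show k + D.n - l = k - l + D.n by ring]⟩)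
    (fun x y v => Subtype.ext (funext fun k => by
      simp only [map_add, LinearMap.add_apply, Submodule.coe_add, Pi.add_apply]))
    (fun c x v => Subtype.ext (funext fun k => by
      simp only [map_smul, LinearMap.smul_apply, Submodule.coe_smul, Pi.smul_apply]))
    (fun x v w => Subtype.ext (funext fun k => by
      simp only [map_add, Submodule.coe_add, Pi.add_apply]))
    (fun c x v => Subtype.ext (funext fun k => by
      simp only [map_smul, Submodule.coe_smul, Pi.smul_apply]))

/-- The component of a section in a class modulo `n`. -/
def secR (X : SuperModule D.tilde M) (lam : ℂ) (j : ZMod D.n) :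
    Module.End ℂ (X.secSpace lam) where
  toFun v := ⟨fun k => if (k : ZMod D.n) = j then v.1 k else 0, fun k => by
    simp only [Int.cast_add, Int.cast_natCast, CharP.cast_eq_zero, add_zero]
    split_ifs
    · exact v.2 k
    · exact ⟨zero_mem _, map_zero _⟩⟩
  map_add' v w := Subtype.ext (funext fun k => by
    simp only [Submodule.coe_add, Pi.add_apply]
    split_ifs
    · rfl
    · rw [add_zero])
  map_smul' c v := Subtype.ext (funext fun k => by
    simp only [Submodule.coe_smul, Pi.smul_apply, RingHom.id_apply]
    split_ifs
    · rfl
    · rw [smul_zero])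

theorem secL_apply (hA : X.IsALModule) (i : ℤ) (v : X.secSpace lam) (k : ℤ) :
    (secL hA lam i v).1 k = X.act (D.ell i) (v.1 (k - D.n * i)) -
      (lam + ((k - D.n * i : ℤ) : ℂ) / D.n) • v.1 k := rfl

theorem secX_apply (l : ℤ) (x : g) (v : X.secSpace lam) (k : ℤ) :
    (secX X lam l x v).1 k = X.act (D.gel l x) (v.1 (k - l)) := rfl

theorem secR_apply (j : ZMod D.n) (v : X.secSpace lam) (k : ℤ) :
    (secR X lam j v).1 k = if (k : ZMod D.n) = j then v.1 k else 0 := rfl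

/-- The sections as a superspace. -/
def secSuper (X : SuperModule D.tilde M) (lam : ℂ) : Superspace (X.secSpace lam) where
  gr i :=
    { carrier := {v | ∀ k, v.1 k ∈ X.gr i}
      add_mem' := fun ha hb k => add_mem (ha k) (hb k)
      zero_mem' := fun k => zero_mem _
      smul_mem' := fun c a ha k => Submodule.smul_mem _ _ (ha k) }
  isCompl := by
    refine Superspace.isCompl_of
      (fun v h0 h1 => Subtype.ext (funext fun k => X.eq_zero (h0 k) (h1 k))) fun v => ?_
    have h : ∀ k : ℤ, ∃ a ∈ X.gr 0, ∃ b ∈ X.gr 1, a ∈ X.weightSpace (lam + k / D.n) ∧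
        b ∈ X.weightSpace (lam + k / D.n) ∧ a + b = v.1 k :=
      fun k => (weightSpace_isGraded _).exists_add (v.2 k).1
    choose a ha b hb haw hbw hab using h
    -- As `t` is even, the even and odd components of a section satisfy its recursion separately.
    have ht : ∀ k, X.act (D.tpow 1) (a k) = a (k + D.n) ∧ X.act (D.tpow 1) (b k) = b (k + D.n) := by
      intro k
      have h0 : ∀ {i : ZMod 2} {m : M}, m ∈ X.gr i → X.act (D.tpow 1) m ∈ X.gr i := by
        intro i m hm
        have := X.act_mem (D.tpow_mem 1) hm
        rwa [zero_add] at this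
      refine X.eq_of_add_eq_add (h0 (ha k)) (h0 (hb k)) (ha _) (hb _) ?_
      rw [← map_add, hab, hab, (v.2 k).2]
    exact ⟨⟨a, fun k => ⟨haw k, (ht k).1⟩⟩, ha, ⟨b, fun k => ⟨hbw k, (ht k).2⟩⟩, hb,
      Subtype.ext (funext hab)⟩

/-- The fibre of an `A𝔏`-module, realized on invariant sections. -/
def fiber (hA : X.IsALModule) (lam : ℂ) : D.FiberModule (X.secSpace lam) where
  toSuperspace := secSuper X lam
  L := secL hA lam
  X := secX X lam
  r := secR X lam
  L_mem i j v hv k := by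
    have h := X.act_mem (D.ell_mem i) (hv (k - D.n * i))
    rw [zero_add] at h
    exact sub_mem h (Submodule.smul_mem _ _ (hv k))
  X_mem l i j x v hx hv k := X.act_mem (D.gel_mem l hx) (hv (k - l))
  X_proj l x := by
    refine LinearMap.ext fun v => Subtype.ext (funext fun k => ?_)
    rw [secX_apply, secX_apply, D.gel_proj]
  L_r i j := by
    refine LinearMap.ext fun v => Subtype.ext (funext fun k => ?_)
    simp only [Module.End.mul_apply, secL_apply, secR_apply, Int.cast_sub, Int.cast_mul,
      Int.cast_natCast, CharP.cast_eq_zero, zero_mul, sub_zero]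
    split_ifs
    · rfl
    · simp
  X_r l x j := by
    refine LinearMap.ext fun v => Subtype.ext (funext fun k => ?_)
    simp only [Module.End.mul_apply, secX_apply, secR_apply, Int.cast_sub, sub_eq_iff_eq_add,
      add_comm j]
    split_ifs
    · rfl
    · simp
  L_zero := by
    refine LinearMap.ext fun v => Subtype.ext (funext fun k => ?_)
    have h := mem_weightSpace.1 (v.2 k).1
    rw [secL_apply, mul_zero, sub_zero, h, sub_self]
    rfl
  L_L i j := by
    refine LinearMap.ext fun v => Subtype.ext (funext fun k => ?_)
    have h := X.act_ell_ell i j (v.1 (k - D.n * i - D.n * j))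
    have e : k - D.n * j - D.n * i = k - D.n * i - D.n * j := by ring
    have e' : k - D.n * (i + j) = k - D.n * i - D.n * j := by ring
    simp only [LinearMap.sub_apply, LinearMap.add_apply, LinearMap.smul_apply,
      Module.End.mul_apply, Submodule.coe_sub, Submodule.coe_add, Submodule.coe_smul,
      Pi.sub_apply, Pi.add_apply, Pi.smul_apply, secL_apply, map_sub, map_smul, e, e', h,
      cast_sub_mul_div]
    module
  L_X i l x := by
    refine LinearMap.ext fun v => Subtype.ext (funext fun k => ?_)
    have h := X.act_ell_gel i l x (v.1 (k - D.n * i - l))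
    have e : k - l - D.n * i = k - D.n * i - l := by ring
    have e' : k - (D.n * i + l) = k - D.n * i - l := by ring
    simp only [LinearMap.sub_apply, LinearMap.add_apply, LinearMap.smul_apply,
      Module.End.mul_apply, Submodule.coe_sub, Submodule.coe_add, Submodule.coe_smul,
      Pi.sub_apply, Pi.add_apply, Pi.smul_apply, secL_apply, secX_apply, map_sub, map_smul, e, e',
      h, cast_sub_mul_div]
    rw [Int.cast_sub (k - D.n * i) l, sub_div, cast_sub_mul_div]
    module
  X_X l m a b x y hx hy := by
    refine LinearMap.ext fun v => Subtype.ext (funext fun k => ?_)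
    have h := X.act_gel_gel l m hx hy (v.1 (k - l - m))
    have e : k - m - l = k - l - m := by ring
    have e' : k - (l + m) = k - l - m := by ring
    simp only [LinearMap.sub_apply, LinearMap.smul_apply, Module.End.mul_apply,
      Submodule.coe_sub, Submodule.coe_smul, Pi.sub_apply, Pi.smul_apply, secX_apply, e, e', h]

/-- The section through `m ∈ M_{λ + k/n}` supported on the class of `k` modulo `n`. -/
theorem exists_sec (hA : X.IsALModule) {k : ℤ} {m : M} (hm : m ∈ X.weightSpace (lam + k / D.n)) :
    ∃ v : X.secSpace lam, v.1 k = m ∧ ∀ l : ℤ, (l : ZMod D.n) ≠ k → v.1 l = 0 := by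
  have hn : (D.n : ℤ) ≠ 0 := Nat.cast_ne_zero.2 D.n_pos.ne'
  have hdvd : ∀ l : ℤ, (l : ZMod D.n) = k ↔ (D.n : ℤ) ∣ l - k := fun l => by
    rw [eq_comm, ZMod.intCast_eq_intCast_iff_dvd_sub]
  refine ⟨⟨fun l => if (D.n : ℤ) ∣ l - k then X.act (D.tpow ((l - k) / D.n)) m else 0,
    fun l => ?_⟩, ?_, fun l hl => if_neg fun h => hl ((hdvd l).2 h)⟩
  · by_cases h : (D.n : ℤ) ∣ l - k
    · obtain ⟨q, hq⟩ := h
      obtain rfl : l = D.n * q + k := by omega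
      have e1 : (D.n * q + k : ℤ) - k = D.n * q := by ring
      have e2 : (D.n * q + k : ℤ) + D.n - k = D.n * (1 + q) := by ring
      simp only [e1, e2, dvd_mul_right, if_true, Int.mul_ediv_cancel_left _ hn]
      refine ⟨?_, hA.1 _ _ _⟩
      have := act_tpow_mem hm q
      rwa [add_assoc, show (k : ℂ) / D.n + q = ((D.n * q + k : ℤ) : ℂ) / D.n by
        rw [Int.cast_add, Int.cast_mul, Int.cast_natCast, add_div,
          mul_div_cancel_left₀ _ D.n_ne_zero, add_comm]] at this
    · have h' : ¬ (D.n : ℤ) ∣ l + D.n - k := by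
        rwa [show l + D.n - k = l - k + D.n by ring, dvd_add_self_right]
      simp only [if_neg h, if_neg h']
      exact ⟨zero_mem _, map_zero _⟩
  · simp [hA.2]

/-- Entries in one class modulo `n` differ by powers of `t`, so a section is determined by one value
in each class. -/
theorem sec_eq_zero_of_apply (hA : X.IsALModule) {v : X.secSpace lam} {k l : ℤ}
    (hkl : (l : ZMod D.n) = k) (h : v.1 k = 0) : v.1 l = 0 := by
  rw [eq_comm, ZMod.intCast_eq_intCast_iff_dvd_sub] at hkl
  obtain ⟨q, hq⟩ := hkl
  obtain rfl : l = k + D.n * q := by omega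
  rw [← tpow_sec hA v.2, h, map_zero]

/-- The values at `0, …, n - 1` embed the sections into a finite product of weight spaces. -/
theorem finiteDimensional_secSpace (hA : X.IsALModule) (hc : X.IsCuspidal) :
    FiniteDimensional ℂ (X.secSpace lam) := by
  obtain ⟨N, hN⟩ := hc.2
  have : ∀ μ, FiniteDimensional ℂ (X.weightSpace μ) := fun μ => (hN μ).1
  let f : X.secSpace lam →ₗ[ℂ] ∀ j : Fin D.n, X.weightSpace (lam + ((j : ℕ) : ℤ) / D.n) :=
    LinearMap.pi fun j => LinearMap.codRestrict _
      (LinearMap.proj ((j : ℕ) : ℤ) ∘ₗ (X.secSpace lam).subtype) fun v => (v.2 _).1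
  refine FiniteDimensional.of_injective f ?_
  rw [← LinearMap.ker_eq_bot, eq_bot_iff]
  intro v hv
  refine (Submodule.mem_bot ℂ).2 (Subtype.ext (funext fun k => ?_))
  have hn : (D.n : ℤ) ≠ 0 := Nat.cast_ne_zero.2 D.n_pos.ne'
  have h1 := Int.emod_nonneg k hn
  have h2 := Int.emod_lt_of_pos k (Nat.cast_pos.2 D.n_pos : (0 : ℤ) < D.n)
  have h3 : ((k % D.n).toNat : ℤ) = k % D.n := Int.toNat_of_nonneg h1
  have h4 : v.1 (k % D.n) = 0 := by
    have := congrArg Subtype.val (congrFun hv ⟨(k % D.n).toNat, by omega⟩)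
    rw [← h3]
    exact this
  exact sec_eq_zero_of_apply hA (by simp) h4

theorem iSupIndep_weightSpace (X : SuperModule D.tilde M) (lam : ℂ) :
    iSupIndep fun k : ℤ => X.weightSpace (lam + k / D.n) := by
  refine (Module.End.eigenspaces_iSupIndep (X.act (D.ell 0))).comp fun k l h => ?_
  have h1 := add_left_cancel h
  rw [div_left_inj' D.n_ne_zero] at h1
  exact_mod_cast h1

end SuperModule
-- By the modular law `p k` is the join of `q k` with the part of `p k` below the other `q i`, and
-- independence makes that part trivial. It is applied to weight spaces and to the subspaces of
-- values of a set of sections.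
theorem iSupIndep.le_of_iSup_eq_top {ι α : Type*} [CompleteLattice α] [IsModularLattice α]
    {p q : ι → α} (hp : iSupIndep p) (hqp : ∀ i, q i ≤ p i) (hq : ⨆ i, q i = ⊤) (k : ι) :
    p k ≤ q k := by
  rw [iSup_split_single q k] at hq
  have h1 : (q k ⊔ ⨆ (i) (_ : i ≠ k), q i) ⊓ p k = q k ⊔ (⨆ (i) (_ : i ≠ k), q i) ⊓ p k :=
    sup_inf_assoc_of_le _ (hqp k)
  rw [hq, top_inf_eq] at h1
  rw [h1]
  refine sup_le le_rfl ?_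
  have h2 : (⨆ (i) (_ : i ≠ k), q i) ⊓ p k ≤ ⊥ :=
    (inf_le_inf_right _ (iSup₂_mono fun i _ => hqp i)).trans
      ((inf_comm _ _).le.trans (hp k).le_bot)
  exact h2.trans bot_le

/-! ### A rigid fibre as a module over `ℂ∂ ⋉ g` -/

namespace TwistDatum.FiberModule

variable {g : Type*} [AddCommGroup g] [Module ℂ g] {G : LieSuperalgebra g} {D : TwistDatum G}
variable {V : Type*} [AddCommGroup V] [Module ℂ V] (J : D.FiberModule V)

/-- The action of `g` on a rigid fibre. -/
def gAct : g →ₗ[ℂ] Module.End ℂ V := ∑ k ∈ Finset.range D.n, J.X (k : ℤ)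

theorem gAct_apply (x : g) : J.gAct x = ∑ k ∈ Finset.range D.n, J.X (k : ℤ) x := by
  simp [gAct]

variable {J}

/-- Each `X k` sees only the component of `x` in `g_{[k]}`, so the one summand with `k` congruent to
`m` survives; rigidity identifies it with `X m`. -/
theorem gAct_of_mem (hX : ∀ i l : ℤ, J.X (D.n * i + l) = J.X l) {m : ℤ} {x : g}
    (hx : x ∈ D.comp m) : J.gAct x = J.X m x := by
  have hn : (D.n : ℤ) ≠ 0 := Nat.cast_ne_zero.2 D.n_pos.ne'
  have h1 := Int.emod_nonneg m hn
  have h2 := Int.emod_lt_of_pos m (Nat.cast_pos.2 D.n_pos : (0 : ℤ) < D.n)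
  have h3 : ((m % D.n).toNat : ℤ) = m % D.n := Int.toNat_of_nonneg h1
  rw [gAct_apply, Finset.sum_eq_single (m % D.n).toNat]
  · rw [h3]
    conv_rhs => rw [← Int.mul_ediv_add_emod m D.n, hX]
  · intro k hk hkm
    rw [← J.X_proj, D.proj_of_mem hx, if_neg, map_zero]
    rintro ⟨q, hq⟩
    apply hkm
    have hk' := Finset.mem_range.1 hk
    have : m % D.n = k := by
      rw [show m = k + D.n * q by omega, Int.add_mul_emod_self_left]
      exact Int.emod_eq_of_lt (by omega) (by omega)
    omega
  · intro h
    exact absurd (Finset.mem_range.2 (by omega)) h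

theorem L_gAct (hX : ∀ i l : ℤ, J.X (D.n * i + l) = J.X l) (x : g) :
    J.L 1 * J.gAct x - J.gAct x * J.L 1 = J.gAct (D.d x) := by
  simp only [gAct_apply, Finset.mul_sum, Finset.sum_mul, ← Finset.sum_sub_distrib]
  refine Finset.sum_congr rfl fun k _ => ?_
  -- With `X (n + k) = X k` the two terms with coefficient `k / n` cancel, and `L 1` acts as the
  -- derivation `d`.
  rw [J.L_X, hX, Int.cast_one, one_smul]
  abel

theorem gAct_gAct (hX : ∀ i l : ℤ, J.X (D.n * i + l) = J.X l) {a b : ZMod 2} {x y : g}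
    (hx : x ∈ G.gr a) (hy : y ∈ G.gr b) :
    J.gAct x * J.gAct y - koszul a b • (J.gAct y * J.gAct x) = J.gAct (G.br x y) := by
  have h : G.br x y = ∑ k ∈ Finset.range D.n, ∑ l ∈ Finset.range D.n,
      G.br (D.proj (k : ℤ) x) (D.proj (l : ℤ) y) := by
    conv_lhs => rw [← D.sum_proj x, ← D.sum_proj y]
    simp only [map_sum, LinearMap.sum_apply]
    exact Finset.sum_comm
  have h' : J.gAct y * J.gAct x = ∑ k ∈ Finset.range D.n, ∑ l ∈ Finset.range D.n,
      J.X (l : ℤ) y * J.X (k : ℤ) x := by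
    rw [gAct_apply, gAct_apply, Finset.sum_mul_sum, Finset.sum_comm]
  rw [h, h', gAct_apply J x, gAct_apply J y, Finset.sum_mul_sum, Finset.smul_sum,
    ← Finset.sum_sub_distrib, map_sum]
  refine Finset.sum_congr rfl fun k _ => ?_
  rw [Finset.smul_sum, ← Finset.sum_sub_distrib, map_sum]
  refine Finset.sum_congr rfl fun l _ => ?_
  rw [J.X_X _ _ hx hy, gAct_of_mem hX (D.br_mem_comp (D.proj_mem _ _) (D.proj_mem _ _))]

/-- The `ℂ∂ ⋉ g`-module given by a rigid fibre. -/
def toModule (J : D.FiberModule V) (hX : ∀ i l : ℤ, J.X (D.n * i + l) = J.X l) :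
    SuperModule D.ddg V where
  toSuperspace := J.toSuperspace
  act := LinearMap.coprod (LinearMap.toSpanSingleton ℂ _ (J.L 1)) J.gAct
  act_mem := by
    rintro i j ⟨a, x⟩ v ⟨ha, hx⟩ hv
    refine add_mem (J.even_smul_mem ha (J.L_mem 1 hv)) ?_
    change J.gAct x v ∈ _
    rw [gAct_apply, LinearMap.sum_apply]
    exact sum_mem fun k _ => J.X_mem _ hx hv
  act_br := by
    rintro i j ⟨a, x⟩ ⟨b, y⟩ ⟨ha, hx⟩ ⟨hb, hy⟩ v
    have h1 := LinearMap.congr_fun (L_gAct hX x) v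
    have h2 := LinearMap.congr_fun (L_gAct hX y) v
    have h3 := LinearMap.congr_fun (gAct_gAct hX hx hy) v
    change (LinearMap.coprod (LinearMap.toSpanSingleton ℂ _ (J.L 1)) J.gAct)
      (0, a • D.d y - b • D.d x + G.br x y) v = _
    simp only [LinearMap.coprod_apply, LinearMap.toSpanSingleton_apply, zero_smul, zero_add,
      map_add, map_sub, map_smul, LinearMap.add_apply, LinearMap.sub_apply, LinearMap.smul_apply,
      Module.End.mul_apply] at h1 h2 h3 ⊢
    rcases parity_cases i with rfl | rfl
    · simp only [koszul_zero_left, one_smul] at *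
      linear_combination (norm := module) b • h1 - a • h2 - h3
    · obtain rfl : a = 0 := ha
      rcases parity_cases j with rfl | rfl
      · simp only [koszul_zero_right, one_smul] at *
        linear_combination (norm := module) b • h1 - h3
      · obtain rfl : b = 0 := hb
        linear_combination (norm := module) - h3

theorem toModule_act (hX : ∀ i l : ℤ, J.X (D.n * i + l) = J.X l) (a : ℂ) (x : g) (v : V) :
    (J.toModule hX).act (a, x) v = a • J.L 1 v + J.gAct x v := rfl

end TwistDatum.FiberModule

/-! ### Simplicity of the fibre and reconstruction of the module -/

namespace SuperModule

variable {g : Type*} [AddCommGroup g] [Module ℂ g] {G : LieSuperalgebra g} {D : TwistDatum G}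
variable {M : Type*} [AddCommGroup M] [Module ℂ M] {X : SuperModule D.tilde M} {lam : ℂ}

/-- Evaluation of a section at `k`. -/
def secEval (X : SuperModule D.tilde M) (lam : ℂ) (k : ℤ) : X.secSpace lam →ₗ[ℂ] M :=
  LinearMap.proj k ∘ₗ (X.secSpace lam).subtype

theorem secEval_apply (k : ℤ) (v : X.secSpace lam) : secEval X lam k v = v.1 k := rfl

theorem act_ell_secEval (hA : X.IsALModule) (i k : ℤ) (v : X.secSpace lam) :
    X.act (D.ell i) (v.1 k) = (secL hA lam i v).1 (k + D.n * i) +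
      (lam + (k : ℂ) / D.n) • v.1 (k + D.n * i) := by
  rw [secL_apply, add_sub_cancel_right, sub_add_cancel]

theorem act_gel_secEval (l k : ℤ) (x : g) (v : X.secSpace lam) :
    X.act (D.gel l x) (v.1 k) = (secX X lam l x v).1 (k + l) := by
  rw [secX_apply, add_sub_cancel_right]

/-- The values of the sections in a graded submodule `P` span a submodule of `M`. If it is zero, so
is `P`. If it is `M`, the values of `P` at `k` fill the whole weight space, and the projections `r`
cut out of `P` the component of any section in any class. -/
theorem fiber_isSimple (hA : X.IsALModule) (hs : X.IsSimple) : (fiber hA lam).IsSimple := by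
  intro P hP
  have hsub : X.IsSubmodule (⨆ k, P.map (secEval X lam k)) := by
    have key : ∀ (f : M →ₗ[ℂ] M), (∀ k, ∀ v ∈ P,
        f (v.1 k) ∈ ⨆ k, P.map (secEval X lam k)) → ∀ m ∈ ⨆ k, P.map (secEval X lam k),
        f m ∈ ⨆ k, P.map (secEval X lam k) := by
      intro f hf m hm
      have hle : (⨆ k, P.map (secEval X lam k)) ≤ (⨆ k, P.map (secEval X lam k)).comap f := by
        refine iSup_le fun k => ?_
        rintro _ ⟨v, hv, rfl⟩
        exact hf k v hv
      exact hle hm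
    have hmem : ∀ k, ∀ v ∈ P, v.1 k ∈ ⨆ k, P.map (secEval X lam k) := fun k v hv =>
      Submodule.mem_iSup_of_mem k ⟨v, hv, rfl⟩
    refine ⟨iSup_isGraded _ _ fun k => ?_, act_mem_of_generators (fun i => key _ fun k v hv => ?_)
      (fun l x => key _ fun k v hv => ?_) (fun i => key _ fun k v hv => ?_)⟩
    · rintro _ ⟨v, hv, rfl⟩
      obtain ⟨a, ha, b, hb, haP, hbP, rfl⟩ := hP.graded.exists_add hv
      exact Submodule.mem_sup.2 ⟨a.1 k, ⟨⟨a, haP, rfl⟩, ha k⟩, b.1 k, ⟨⟨b, hbP, rfl⟩, hb k⟩, rfl⟩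
    · rw [act_ell_secEval hA]
      exact add_mem (hmem _ _ (hP.L_mem i v hv)) (Submodule.smul_mem _ _ (hmem _ _ hv))
    · rw [act_gel_secEval]
      exact hmem _ _ (hP.X_mem l x v hv)
    · rw [tpow_sec hA v.2]
      exact hmem _ _ hv
  rcases hs.2 _ hsub with h | h
  · left
    refine eq_bot_iff.2 fun v hv => (Submodule.mem_bot ℂ).2 (Subtype.ext (funext fun k => ?_))
    have : v.1 k ∈ ⨆ k, P.map (secEval X lam k) := Submodule.mem_iSup_of_mem k ⟨v, hv, rfl⟩
    rw [h] at this
    exact (Submodule.mem_bot ℂ).1 this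
  · right
    have : NeZero D.n := ⟨D.n_pos.ne'⟩
    refine eq_top_iff.2 fun v _ => ?_
    have hsum : v = ∑ j, secR X lam j v := by
      refine Subtype.ext (funext fun k => ?_)
      rw [Submodule.coe_sum, Finset.sum_apply]
      simp [secR_apply]
    rw [hsum]
    refine sum_mem fun j _ => ?_
    obtain ⟨k, rfl⟩ := ZMod.intCast_surjective j
    have hle := (iSupIndep_weightSpace X lam).le_of_iSup_eq_top (fun k => by
      rintro _ ⟨v, -, rfl⟩
      exact (v.2 k).1) h k
    obtain ⟨w, hw, hwk⟩ := hle (v.2 k).1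
    have : secR X lam k v = secR X lam k w := by
      rw [← sub_eq_zero, ← map_sub]
      refine Subtype.ext (funext fun l => ?_)
      rw [secR_apply]
      split_ifs with hl
      · exact sec_eq_zero_of_apply hA hl (sub_eq_zero.2 hwk.symm)
      · rfl
    rw [this]
    exact hP.r_mem _ _ hw

theorem nontrivial_secSpace (hA : X.IsALModule) (hs : X.IsSimple)
    (htop : ⨆ k : ℤ, X.weightSpace (lam + k / D.n) = ⊤) : Nontrivial (X.secSpace lam) := by
  by_contra h
  rw [not_nontrivial_iff_subsingleton] at h
  have := hs.1
  refine bot_ne_top (α := Submodule ℂ M) (htop ▸ (eq_bot_iff.2 (iSup_le fun k m hm => ?_)).symm)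
  obtain ⟨v, rfl, -⟩ := exists_sec hA hm
  rw [Subsingleton.elim v 0]
  exact zero_mem _

section Rigid

variable (hA : X.IsALModule)
  (hX : ∀ i l : ℤ, (fiber hA lam).X (D.n * i + l) = (fiber hA lam).X l)

/-- The `ℤ_n`-gradation of the fibre. -/
def fiberGrading : ((fiber hA lam).toModule hX).ZnGrading where
  comp j :=
    { carrier := {v | ∀ k : ℤ, (k : ZMod D.n) ≠ j → v.1 k = 0}
      add_mem' := fun ha hb k hk => by
        rw [Submodule.coe_add, Pi.add_apply, ha k hk, hb k hk, add_zero]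
      zero_mem' := fun k hk => rfl
      smul_mem' := fun c a ha k hk => by
        rw [Submodule.coe_smul, Pi.smul_apply, ha k hk, smul_zero] }
  isInternal := by
    have : NeZero D.n := ⟨D.n_pos.ne'⟩
    rw [DirectSum.isInternal_submodule_iff_iSupIndep_and_iSup_eq_top]
    constructor
    · rw [iSupIndep_iff_finsetSum_eq_zero_imp_eq_zero]
      intro s f hf h0 i hi
      refine Subtype.ext (funext fun k => ?_)
      by_cases hk : (k : ZMod D.n) = i
      · have h := congrFun (congrArg Subtype.val h0) k
        rw [Submodule.coe_sum, Finset.sum_apply, Finset.sum_eq_single i] at h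
        · exact h
        · exact fun j hj hji => hf j hj k fun h' => hji (h'.symm.trans hk)
        · exact fun h' => absurd hi h'
      · exact hf i hi k hk
    · refine eq_top_iff.2 fun v _ => ?_
      have hsum : v = ∑ j, secR X lam j v := by
        refine Subtype.ext (funext fun k => ?_)
        rw [Submodule.coe_sum, Finset.sum_apply]
        simp [secR_apply]
      rw [hsum]
      exact sum_mem fun j _ => Submodule.mem_iSup_of_mem j fun k hk => if_neg hk
  graded j := by
    intro v hv
    obtain ⟨a, ha, b, hb, rfl⟩ := (secSuper X lam).exists_add v
    have h : ∀ k : ℤ, (k : ZMod D.n) ≠ j → a.1 k = 0 ∧ b.1 k = 0 := fun k hk =>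
      X.eq_zero_of_add_eq_zero (i := 0) (ha k) (hb k) (hv k hk)
    exact Submodule.mem_sup.2 ⟨a, ⟨fun k hk => (h k hk).1, ha⟩, b, ⟨fun k hk => (h k hk).2, hb⟩,
      rfl⟩
  partial_mem j v hv k hk := by
    rw [TwistDatum.FiberModule.toModule_act, one_smul, map_zero, LinearMap.zero_apply, add_zero]
    change (secL hA lam 1 v).1 k = 0
    rw [secL_apply, hv k hk, hv, map_zero, smul_zero, sub_zero]
    simpa using hk
  act_mem l j x hx v hv k hk := by
    rw [TwistDatum.FiberModule.toModule_act, zero_smul, zero_add, TwistDatum.FiberModule.gAct_of_mem hX hx]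
    change (secX X lam l x v).1 k = 0
    rw [secX_apply, hv, map_zero]
    intro h
    apply hk
    rw [← h]
    push_cast
    ring

/-- By rigidity every `L i` is a multiple of `∂` and every `X l x` is the action of the component of
`x` in `g_{[l]}`, so `ℤ_n`-graded submodules are submodules of the fibre. -/
theorem fiber_isZnGradedSimple (hs : X.IsSimple)
    (hL : ∀ i : ℤ, (fiber hA lam).L i = (i : ℂ) • (fiber hA lam).L 1)
    (htop : ⨆ k : ℤ, X.weightSpace (lam + k / D.n) = ⊤) :
    ((fiber hA lam).toModule hX).IsZnGradedSimple (fiberGrading hA hX) := by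
  refine ⟨nontrivial_secSpace hA hs htop, fun P hP hPE => fiber_isSimple hA hs P
    ⟨hP.graded, fun j v hv => ?_, fun i v hv => ?_, fun l x v hv => ?_⟩⟩
  · have hle : (⨆ i, P ⊓ (fiberGrading hA hX).comp i) ≤ P.comap (secR X lam j) := by
      refine iSup_le ?_
      rintro i w ⟨hw, hwi⟩
      by_cases hij : j = i
      · have : secR X lam j w = w := by
          refine Subtype.ext (funext fun k => ?_)
          rw [secR_apply]
          split_ifs with hk
          · rfl
          · exact (hwi k fun h => hk (h.trans hij.symm)).symm
        exact (this.symm ▸ hw : secR X lam j w ∈ P)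
      · have : secR X lam j w = 0 := by
          refine Subtype.ext (funext fun k => ?_)
          rw [secR_apply]
          split_ifs with hk
          · exact hwi k fun h => hij (hk.symm.trans h)
          · rfl
        exact (this.symm ▸ zero_mem P : secR X lam j w ∈ P)
    exact hle (hPE hv)
  · have h := hP.act_mem (1, 0) v hv
    rw [TwistDatum.FiberModule.toModule_act, one_smul, map_zero, LinearMap.zero_apply, add_zero] at h
    rw [hL]
    exact Submodule.smul_mem _ _ h
  · have h := hP.act_mem (0, D.proj l x) v hv
    rwa [TwistDatum.FiberModule.toModule_act, zero_smul, zero_add,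
      TwistDatum.FiberModule.gAct_of_mem hX (D.proj_mem l x), (fiber hA lam).X_proj] at h

/-- The map `v ⊗ t^{k/n} ↦ v_k`. -/
def secSum (X : SuperModule D.tilde M) (lam : ℂ) : (ℤ →₀ X.secSpace lam) →ₗ[ℂ] M :=
  Finsupp.lsum ℂ fun k => secEval X lam k

theorem secSum_single (k : ℤ) (v : X.secSpace lam) :
    secSum X lam (Finsupp.single k v) = v.1 k := by
  rw [secSum, Finsupp.lsum_single, secEval_apply]

theorem Gamma_act_ell {V : Type*} [AddCommGroup V] [Module ℂ V] (Y : SuperModule D.ddg V)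
    (lam : ℂ) (i k : ℤ) (v : V) : (Y.Gamma lam).act (D.ell i) (Finsupp.single k v) =
      Finsupp.single (D.n * i + k) ((lam + (k : ℂ) / D.n) • v + (i : ℂ) • Y.act (1, 0) v) := by
  change Y.loopW lam (Finsupp.single i 1) _ + Y.loopL 0 _ + loopA D.n V 0 _ = _
  simp [loopW]

theorem Gamma_act_gel {V : Type*} [AddCommGroup V] [Module ℂ V] (Y : SuperModule D.ddg V)
    (lam : ℂ) (l k : ℤ) (x : g) (v : V) : (Y.Gamma lam).act (D.gel l x) (Finsupp.single k v) =
      Finsupp.single (l + k) (Y.act (0, D.proj l x) v) := by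
  change Y.loopW lam 0 _ + Y.loopL (Finsupp.single l (D.proj l x)) _ + loopA D.n V 0 _ = _
  simp [loopL]

theorem Gamma_act_tpow {V : Type*} [AddCommGroup V] [Module ℂ V] (Y : SuperModule D.ddg V)
    (lam : ℂ) (i k : ℤ) (v : V) : (Y.Gamma lam).act (D.tpow i) (Finsupp.single k v) =
      Finsupp.single (D.n * i + k) v := by
  change Y.loopW lam 0 _ + Y.loopL 0 _ + loopA D.n V (Finsupp.single i 1) _ = _
  simp [loopA]

/-- The relation `ℓ_i v_k = (L_i v)_{k+ni} + (λ + k/n) v_{k+ni}` becomes the formula for the loop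
module once `L_i = i ∂`. -/
theorem secSum_isHom (hL : ∀ i : ℤ, (fiber hA lam).L i = (i : ℂ) • (fiber hA lam).L 1) :
    (((fiber hA lam).toModule hX).Gamma lam).IsHom X (secSum X lam) where
  map_mem i f hf := by
    rw [secSum, Finsupp.lsum_apply]
    exact sum_mem fun k _ => hf k k
  map_act z f := by
    induction f using Finsupp.induction_linear with
    | zero => simp only [map_zero]
    | add f h hf hh => simp only [map_add, hf, hh]
    | single k v =>
      induction z using D.tilde_induction with
      | hadd x y hx hy => simp only [map_add, LinearMap.add_apply, hx, hy]
      | hsmul c x hx => simp only [map_smul, LinearMap.smul_apply, hx]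
      | hell i =>
        have h : secL hA lam i = (i : ℂ) • (fiber hA lam).L 1 := hL i
        rw [Gamma_act_ell, secSum_single, secSum_single, act_ell_secEval hA, h,
          TwistDatum.FiberModule.toModule_act, one_smul, map_zero, LinearMap.zero_apply, add_zero,
          add_comm (D.n * i : ℤ) k, add_comm ((_ : ℂ) • v)]
        rfl
      | hgel l x =>
        rw [Gamma_act_gel, secSum_single, secSum_single, act_gel_secEval,
          TwistDatum.FiberModule.toModule_act, zero_smul, zero_add,
          TwistDatum.FiberModule.gAct_of_mem hX (D.proj_mem l x), (fiber hA lam).X_proj, add_comm l k]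
        rfl
      | htpow i =>
        rw [Gamma_act_tpow, secSum_single, secSum_single, tpow_sec hA v.2, add_comm]

/-- In `F` the section attached to `t^{k/n}` is supported on the class of `k`, so its value at `k`
determines it; independence of weight spaces then gives injectivity. Any weight vector extends to
such a section by `exists_sec`, which gives surjectivity. -/
theorem iso_F (hL : ∀ i : ℤ, (fiber hA lam).L i = (i : ℂ) • (fiber hA lam).L 1)
    (htop : ⨆ k : ℤ, X.weightSpace (lam + k / D.n) = ⊤) :
    X.IsIso (((fiber hA lam).toModule hX).F (fiberGrading hA hX) lam) := by
  let Φ : FSpace (fiberGrading hA hX) →ₗ[ℂ] M := secSum X lam ∘ₗ Submodule.subtype _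
  have hom := secSum_isHom hA hX hL
  have hinj : Function.Injective Φ := by
    rw [← LinearMap.ker_eq_bot, eq_bot_iff]
    rintro ⟨f, hf⟩ h0
    have h0' : ∑ k ∈ f.support, (f k).1 k = 0 := by
      have : secSum X lam f = 0 := h0
      rwa [secSum, Finsupp.lsum_apply] at this
    have h1 := (iSupIndep_iff_finsetSum_eq_zero_imp_eq_zero _).1 (iSupIndep_weightSpace X lam)
      f.support (fun k => (f k).1 k) (fun k _ => ((f k).2 k).1) h0'
    refine (Submodule.mem_bot ℂ).2 (Subtype.ext (Finsupp.ext fun k => ?_))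
    by_cases hk : k ∈ f.support
    · refine Subtype.ext (funext fun l => ?_)
      by_cases hl : (l : ZMod D.n) = k
      · exact sec_eq_zero_of_apply hA hl (h1 k hk)
      · exact hf k l hl
    · exact Finsupp.notMem_support_iff.1 hk
  have hsurj : Function.Surjective Φ := by
    rw [← LinearMap.range_eq_top, eq_top_iff, ← htop]
    refine iSup_le fun k m hm => ?_
    obtain ⟨v, hv, hv'⟩ := exists_sec hA hm
    refine ⟨⟨Finsupp.single k v, single_mem_coeffIn (P := fun k : ℤ =>
      (fiberGrading hA hX).comp k) hv'⟩, ?_⟩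
    exact (secSum_single k v).trans hv
  exact IsIso.symm ⟨LinearEquiv.ofBijective Φ ⟨hinj, hsurj⟩, fun i m hm => hom.map_mem i _ hm,
    fun x m => hom.map_act _ _⟩

end Rigid

/-! ### Loop modules of simple quotients -/

theorem IsHom.gamma {V V' : Type*} [AddCommGroup V] [Module ℂ V] [AddCommGroup V'] [Module ℂ V']
    {Y : SuperModule D.ddg V} {Y' : SuperModule D.ddg V'} {f : V →ₗ[ℂ] V'} (hf : Y.IsHom Y' f)
    (lam : ℂ) : (Y.Gamma lam).IsHom (Y'.Gamma lam) (Finsupp.mapRange.linearMap f) where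
  map_mem i m hm k := hf.map_mem i _ (hm k)
  map_act z m := by
    induction m using Finsupp.induction_linear with
    | zero => simp only [map_zero]
    | add f h hf hh => simp only [map_add, hf, hh]
    | single k v =>
      have hs : ∀ (k : ℤ) (v : V), Finsupp.mapRange.linearMap f (Finsupp.single k v) =
          Finsupp.single k (f v) := fun k v => by
        rw [Finsupp.mapRange.linearMap_apply, Finsupp.mapRange_single]
      induction z using D.tilde_induction with
      | hadd x y hx hy => simp only [map_add, LinearMap.add_apply, hx, hy]
      | hsmul c x hx => simp only [map_smul, LinearMap.smul_apply, hx]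
      | hell i =>
        rw [Gamma_act_ell, hs, hs, Gamma_act_ell, map_add, map_smul, map_smul, hf.map_act]
      | hgel l x => rw [Gamma_act_gel, hs, hs, Gamma_act_gel, hf.map_act]
      | htpow i => rw [Gamma_act_tpow, hs, hs, Gamma_act_tpow]

/-- A simple module of the form `F(V, λ)` is a subquotient of `Γ(V', λ)` for a simple quotient
`V'` of `V`. -/
theorem exists_iso_subquot_Gamma {V : Type*} [AddCommGroup V] [Module ℂ V]
    [FiniteDimensional ℂ V] [Nontrivial V] {Y : SuperModule D.ddg V} {E : Y.ZnGrading}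
    (hs : X.IsSimple) (hXF : X.IsIso (Y.F E lam)) :
    ∃ (R : Submodule ℂ V) (hR : Y.IsSubmodule R), (Y.quot R hR).IsSimple ∧
      ∃ (P Q : Submodule ℂ (ℤ →₀ V ⧸ R)) (hP : ((Y.quot R hR).Gamma lam).IsSubmodule P)
        (hQ : ((Y.quot R hR).Gamma lam).IsSubmodule Q) (hPQ : P ≤ Q),
        X.IsIso (((Y.quot R hR).Gamma lam).subquot hP hQ hPQ) := by
  obtain ⟨R, hR, hsimple⟩ := Y.exists_simple_quotient
  refine ⟨R, hR, hsimple, ?_⟩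
  obtain ⟨e, he, hact⟩ := hXF
  have hq := (Y.mkQ_isHom hR).gamma lam
  have hf : X.IsHom ((Y.quot R hR).Gamma lam)
      (Finsupp.mapRange.linearMap R.mkQ ∘ₗ (FSpace E).subtype ∘ₗ (e : M →ₗ[ℂ] FSpace E)) :=
    ⟨fun i m hm => hq.map_mem i _ (he i m hm), fun x m => by
      have h : ((e (X.act x m) : FSpace E) : ℤ →₀ V) = (Y.Gamma lam).act x (e m) :=
        congrArg Subtype.val (hact x m)
      simp only [LinearMap.comp_apply, LinearEquiv.coe_coe, Submodule.subtype_apply, h]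
      exact hq.map_act x _⟩
  refine ⟨_, _, _, _, _, hs.iso_subquot hf fun h0 => ?_⟩
  -- `R` need not be `ℤ_n`-graded. If the map were zero, `R` would contain every component, hence
  -- all of `V`, contradicting that the quotient is nonzero.
  have hle : ∀ j, E.comp j ≤ R := by
    intro j v hv
    obtain ⟨k, rfl⟩ := ZMod.intCast_surjective j
    have h1 := LinearMap.congr_fun h0 (e.symm ⟨Finsupp.single k v, single_mem_coeffIn
      (P := fun k : ℤ => E.comp k) hv⟩)
    have h2 : (Finsupp.mapRange.linearMap R.mkQ (Finsupp.single k v) : ℤ →₀ V ⧸ R) = 0 := by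
      simpa using h1
    have h3 := congrArg (fun f => f k) h2
    simpa using h3
  have htop : R = ⊤ := eq_top_iff.2 (E.isInternal.submodule_iSup_eq_top ▸ iSup_le hle)
  have := hsimple.1
  exact Submodule.Quotient.nontrivial_iff.1 this htop

end SuperModule

end
-- The classification of simple cuspidal `A𝔏`-modules
theorem mainTheorem3 {g : Type u} [AddCommGroup g] [Module ℂ g] [FiniteDimensional ℂ g]
    (G : LieSuperalgebra g) (D : TwistDatum G) (hd : ¬ Module.End.HasEigenvalue D.d 1)
    {M : Type v} [AddCommGroup M] [Module ℂ M] (X : SuperModule D.tilde M)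
    (hAL : X.IsALModule) (hsimple : X.IsSimple) (hcusp : X.IsCuspidal) :
    (∃ (lam : ℂ) (V : Type v) (_ : AddCommGroup V) (_ : Module ℂ V)
        (Y : SuperModule D.ddg V) (E : Y.ZnGrading),
        FiniteDimensional ℂ V ∧ Y.IsZnGradedSimple E ∧ X.IsIso (Y.F E lam)) ∧
      (∃ (lam : ℂ) (V' : Type v) (_ : AddCommGroup V') (_ : Module ℂ V')
        (Y' : SuperModule D.ddg V'),
        FiniteDimensional ℂ V' ∧ Y'.IsSimple ∧
          ∃ (P Q : Submodule ℂ (ℤ →₀ V')) (hP : (Y'.Gamma lam).IsSubmodule P)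
            (hQ : (Y'.Gamma lam).IsSubmodule Q) (hPQ : P ≤ Q),
            ((Y'.Gamma lam).subquot hP hQ hPQ).IsSimple ∧
              X.IsIso ((Y'.Gamma lam).subquot hP hQ hPQ)) := by
  obtain ⟨lam, htop⟩ := SuperModule.exists_iSup_weightSpace_eq_top hsimple hcusp
  have hfin := SuperModule.finiteDimensional_secSpace (lam := lam) hAL hcusp
  have hnt := SuperModule.nontrivial_secSpace hAL hsimple htop
  obtain ⟨hL, hX⟩ := TwistDatum.FiberModule.IsSimple.rigid _ hd
    (SuperModule.fiber_isSimple (lam := lam) hAL hsimple)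
  have hiso := SuperModule.iso_F hAL hX hL htop
  refine ⟨⟨lam, _, _, _, _, SuperModule.fiberGrading hAL hX, hfin,
    SuperModule.fiber_isZnGradedSimple hAL hX hsimple hL htop, hiso⟩, ?_⟩
  obtain ⟨R, hR, hs, P, Q, hP, hQ, hPQ, h⟩ := SuperModule.exists_iso_subquot_Gamma hsimple hiso
  exact ⟨lam, _, _, _, _, inferInstance, hs, P, Q, hP, hQ, hPQ, hsimple.of_iso h, h⟩
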